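/- **Theorem 2.** For $t>0$ define $S(t)$ as follows. If $t$ is not the ordinate of a nontrivial zero of the Riemann zeta-function $\zeta$, let $S(t)=\frac1\pi\arg\zeta(\frac12+it)$, where the argument is obtained by continuous variation along the straight line segments joining $2$, $2+it$ and $\frac12+it$, starting with the value $0$ at $2$. If $t$ is the ordinate of a zero, let $S(t)=\frac12\lim_{\epsilon\to0^+}\{S(t+\epsilon)+S(t-\epsilon)\}$. Assume the Riemann Hypothesis. Then $S(t)$ is well defined for every $t>0$ (in particular, the limits above exist), and, as $t\to\infty$, $$|S(t)|\le\Big(\frac12+o(1)\Big)\frac{\log t}{\log\log t}$$ for all sufficiently large $t$; that is, there is a function $o(t)$ with $o(t)\to0$ as $t\to\infty$ such that the inequality holds with $\frac12+o(t)$ for all sufficiently large $t$. -/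

import Mathlib

open Filter Topology

/-- The polygonal path from `2` to `2 + i t` (for `0 ≤ u ≤ 1`) and then from `2 + i t`
to `1/2 + i t` (for `1 ≤ u ≤ 2`), each segment at constant speed. -/
noncomputable def argPath (t u : ℝ) : ℂ :=
  if u ≤ 1 then 2 + (u * t : ℝ) * Complex.I
  else (2 - 3 / 2 * (u - 1) : ℝ) + (t : ℝ) * Complex.I

/-- `θ` is a continuous determination of the argument of `ζ` along the path
`2`, `2 + i t`, `1/2 + i t`, starting with the value `0`. -/
structure IsZetaArgAlong (t : ℝ) (θ : ℝ → ℝ) : Prop where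
  continuousOn : ContinuousOn θ (Set.Icc 0 2)
  zero : θ 0 = 0
  polar : ∀ u ∈ Set.Icc (0 : ℝ) 2,
    riemannZeta (argPath t u) =
      ‖riemannZeta (argPath t u)‖ * Complex.exp (θ u * Complex.I)

/-- `t` is the ordinate of a nontrivial zero of `ζ`. -/
def IsZetaOrdinate (t : ℝ) : Prop :=
  ∃ ρ : ℂ, riemannZeta ρ = 0 ∧ 0 < ρ.re ∧ ρ.re < 1 ∧ ρ.im = t

open Classical in
/-- The value of `arg ζ(1/2 + i t)` obtained by continuous variation along the segments
joining `2`, `2 + i t` and `1/2 + i t`, starting with the value `0`. For `t > 0` that is not the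
ordinate of a zero, such a variation exists and its end value is unique
(`exists_isZetaArgAlong` and `zetaArg_eq` below); otherwise the value is not meaningful. -/
noncomputable def zetaArg (t : ℝ) : ℝ :=
  if h : ∃ θ : ℝ → ℝ, IsZetaArgAlong t θ then h.choose 2 else 0

open Classical in
/-- The function `S(t)`, for `t > 0`: it is `(1/π) arg ζ(1/2 + i t)` if `t` is not the ordinate
of a zero, and `(1/2) lim_{ε → 0+} (S(t + ε) + S(t - ε))` if it is. (Ordinates are isolated, so
`S` at `t ± ε` is given by the first case for small `ε`.) -/
noncomputable def zetaS (t : ℝ) : ℝ :=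
  if IsZetaOrdinate t then
    1 / 2 * limUnder (𝓝[>] (0 : ℝ))
      (fun ε => 1 / Real.pi * zetaArg (t + ε) + 1 / Real.pi * zetaArg (t - ε))
  else 1 / Real.pi * zetaArg t

theorem continuous_argPath (t : ℝ) : Continuous (argPath t) := by
  unfold argPath
  refine Continuous.if_le (by fun_prop) (by fun_prop) continuous_id continuous_const ?_
  intro u hu
  have hu : u = 1 := hu
  subst hu
  norm_num

theorem argPath_zero (t : ℝ) : argPath t 0 = 2 := by
  simp [argPath]

theorem argPath_one (t : ℝ) : argPath t 1 = 2 + t * Complex.I := by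
  simp [argPath]

theorem argPath_two (t : ℝ) : argPath t 2 = 1 / 2 + t * Complex.I := by
  norm_num [argPath]

theorem argPath_ne_one {t : ℝ} (ht : 0 < t) (u : ℝ) : argPath t u ≠ 1 := by
  intro h
  unfold argPath at h
  split_ifs at h with hu
  · simpa using congrArg Complex.re h
  · exact ht.ne' (by simpa using congrArg Complex.im h)

theorem zeta_argPath_ne_zero {t : ℝ} (ht : ¬ IsZetaOrdinate t) {u : ℝ} (hu : u ≤ 2) :
    riemannZeta (argPath t u) ≠ 0 := by
  intro h0
  by_cases h1 : 1 ≤ (argPath t u).re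
  · exact riemannZeta_ne_zero_of_one_le_re h1 h0
  · refine ht ⟨argPath t u, h0, ?_, not_le.mp h1, ?_⟩ <;>
      unfold argPath at * <;> split_ifs at * with h <;> simp at * <;> linarith

theorem zeta_two_eq_norm : riemannZeta 2 = (‖riemannZeta 2‖ : ℂ) := by
  have h : riemannZeta 2 = ((Real.pi ^ 2 / 6 : ℝ) : ℂ) := by
    rw [riemannZeta_two]; push_cast; rfl
  rw [h, Complex.norm_real, Real.norm_of_nonneg (by positivity)]

theorem circle_exp_eq_iff {z : ℂ} (hz : z ≠ 0) (x : ℝ) :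
    z = ‖z‖ * Complex.exp (x * Complex.I) ↔ (Circle.exp x : ℂ) = z / ‖z‖ := by
  have : (‖z‖ : ℂ) ≠ 0 := by simpa using hz
  rw [Circle.coe_exp, eq_div_iff this, mul_comm, eq_comm]

/-- For `t > 0` not an ordinate, the argument of `ζ` can be continued along the path. -/
theorem exists_isZetaArgAlong {t : ℝ} (ht : 0 < t) (hord : ¬ IsZetaOrdinate t) :
    ∃ θ : ℝ → ℝ, IsZetaArgAlong t θ := by
  have hne : ∀ s : unitInterval, riemannZeta (argPath t (2 * s)) ≠ 0 := fun s =>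
    zeta_argPath_ne_zero hord (by linarith [s.2.2])
  have hc : Continuous fun s : unitInterval => riemannZeta (argPath t (2 * s)) :=
    continuous_iff_continuousAt.2 fun s =>
      ContinuousAt.comp (f := fun s : unitInterval => argPath t (2 * s))
        (differentiableAt_riemannZeta (argPath_ne_one ht _)).continuousAt
        ((continuous_argPath t).comp (by fun_prop)).continuousAt
  let γ : C(unitInterval, Circle) :=
    { toFun := fun s => ⟨riemannZeta (argPath t (2 * s)) / ‖riemannZeta (argPath t (2 * s))‖, by
        refine mem_sphere_zero_iff_norm.2 ?_
        simp [hne s]⟩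
      continuous_toFun := by
        refine Continuous.subtype_mk (hc.div (by fun_prop) fun s => ?_) _
        simpa using hne s }
  have hγ : ∀ s : unitInterval, (γ s : ℂ) =
      riemannZeta (argPath t (2 * s)) / ‖riemannZeta (argPath t (2 * s))‖ := fun _ => rfl
  have h2 : riemannZeta 2 ≠ 0 := riemannZeta_ne_zero_of_one_le_re (by norm_num)
  have hγ0 : γ 0 = Circle.exp 0 := by
    apply Circle.ext
    rw [(circle_exp_eq_iff h2 0).1 (by simpa using zeta_two_eq_norm)]
    rw [hγ]; simp [argPath_zero]
  obtain ⟨Γ, hΓ, hΓ0⟩ := Circle.isCoveringMap_exp.exists_path_lifts γ 0 hγ0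
  refine ⟨fun u => Γ (Set.projIcc 0 1 zero_le_one (u / 2)), ?_, ?_, ?_⟩
  · exact (Γ.continuous.comp (continuous_projIcc.comp (by fun_prop))).continuousOn
  · simpa using hΓ0
  · intro u hu
    have hu' : u / 2 ∈ Set.Icc (0 : ℝ) 1 := ⟨by linarith [hu.1], by linarith [hu.2]⟩
    rw [circle_exp_eq_iff (zeta_argPath_ne_zero hord hu.2), Set.projIcc_of_mem _ hu']
    have := congrArg (fun c : Circle => (c : ℂ)) (congrFun hΓ ⟨u / 2, hu'⟩)
    simp only [Function.comp_apply] at this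
    rw [this, hγ]
    simp only [mul_div_cancel₀ u (two_ne_zero' ℝ)]

/-- For `t` not an ordinate, the continuous argument along the path is unique, so that `zetaArg t`
is the end value of every such argument. -/
theorem zetaArg_eq {t : ℝ} (hord : ¬ IsZetaOrdinate t) {θ : ℝ → ℝ} (hθ : IsZetaArgAlong t θ) :
    zetaArg t = θ 2 := by
  have hex : ∃ θ : ℝ → ℝ, IsZetaArgAlong t θ := ⟨θ, hθ⟩
  have h' := hex.choose_spec
  rw [zetaArg, dif_pos hex]
  refine Circle.isCoveringMap_exp.eqOn_of_comp_eqOn (s := Set.Icc (0 : ℝ) 2) isPreconnected_Icc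
    h'.continuousOn hθ.continuousOn (fun u hu => ?_) (a := 0) (by norm_num)
    (h'.zero.trans hθ.zero.symm) (by norm_num)
  have hz := zeta_argPath_ne_zero hord hu.2
  apply Circle.ext
  exact ((circle_exp_eq_iff hz _).1 (h'.polar u hu)).trans
    ((circle_exp_eq_iff hz _).1 (hθ.polar u hu)).symm

/-! Under RH there is a holomorphic logarithm L of (s - 1)ζ(s) on Re s > 1/2, and π S(t) is, up to a
bounded argument, the limit of Im L(σ + it) as σ → 1/2 from the right. It therefore suffices to
bound g(τ) = Im log((s - 1)ζ(s)/(s + 1)) at s = σ + iτ uniformly for 1/2 < σ ≤ 1. Two facts about g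
carry the proof.

First, g cannot decrease fast: g' ≥ -(1/2 log(|τ| + 2) + 2). Indeed g' = Re(L' - 1/(s + 1)), and on
RH the modulus of the ξ-function increases away from the critical line (`IsLogZeta.norm_xiHalf_le`,
by Phragmén–Lindelöf). Taking the Gamma factor out of ξ costs 1/2 log (`norm_Gamma_add_le`,
`IsLogZeta.re_deriv_ge`).

Second, averages of g are small. The kernel sinc(l(τ - v))^4 has Fourier support in [-4l, 4l], so
only the terms n ≤ e^{4l} of the Dirichlet series of log ζ survive; estimated trivially they give
O(e^{2l}). The pole contributes O(e^{6l}/(1 + |v|)) (`IsLogZeta.abs_integral_im_logZetaQuot_le`).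

These combine as follows (`mul_le_of_smoothing`, `abs_le_of_smoothing`). Average g with centre v +
4/(5l), a little to the right of v. At points right of v, g is at least g(v) minus slope times
distance; at points left of v only the trivial bound -M is available, M being a supremum of |g|. The
function -g(-τ) has the same properties, so M itself satisfies an inequality in which the mass of
sinc^4 left of -4/5 appears twice. What remains is the mass on [-4/5, 4/5], at least 1.37. Since g
is known a priori only to grow at most linearly, M is a supremum against a slowly varying weight.

The outcome is 1.36 |g(t)| ≤ 0.612 π (1/2 log t)/l plus lower-order terms and O(e^{2l}). With l =
0.475 log log t one has e^{2l} = (log t)^{0.95}, which is negligible, and the constant is π ·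
0.306/(0.475 · 1.36) < 0.475 π. Being strictly below π/2, it leaves room for every error term, so
the function o may be taken to be zero.

At an ordinate, arg ζ becomes increasing nearby after adding a smooth function, again by the slope
bound, so one-sided limits exist and the bound passes to the limit. -/

/-! ### Moments of the kernels sinc^2 and sinc^4. -/

/-- The triangle function. -/
noncomputable def triangle (x : ℝ) : ℂ := (max 0 (1 - |x|) : ℝ)

theorem continuous_triangle : Continuous triangle := by
  unfold triangle; fun_prop

theorem triangle_eq_zero {x : ℝ} (hx : 1 ≤ |x|) : triangle x = 0 := by
  simp [triangle, max_eq_left (by linarith : 1 - |x| ≤ 0)]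

theorem integral_mul_triangle (f : ℝ → ℂ) (hf : Continuous f) :
    ∫ x, f x * triangle x = ∫ x in (0:ℝ)..1, (1 - x) * (f x + f (-x)) := by
  have h1 : ∫ x, f x * triangle x = ∫ x in (-1:ℝ)..1, f x * triangle x := by
    rw [intervalIntegral.integral_of_le (by norm_num), MeasureTheory.setIntegral_eq_integral_of_forall_compl_eq_zero]
    intro x hx
    rw [triangle_eq_zero, mul_zero]
    simp only [Set.mem_Ioc, not_and_or, not_lt, not_le] at hx
    rcases hx with h | h
    · rw [abs_of_nonpos (by linarith)]; linarith
    · rw [abs_of_nonneg (by linarith)]; linarith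
  have hc : Continuous fun x => f x * triangle x := hf.mul continuous_triangle
  rw [h1, ← intervalIntegral.integral_add_adjacent_intervals (b := 0)
    (hc.intervalIntegrable _ _) (hc.intervalIntegrable _ _)]
  have h2 : ∫ x in (-1:ℝ)..0, f x * triangle x = ∫ x in (0:ℝ)..1, f (-x) * triangle (-x) := by
    rw [intervalIntegral.integral_comp_neg (fun x => f x * triangle x)]; simp
  have hc' : Continuous fun x => f (-x) * triangle (-x) := hc.comp continuous_neg
  rw [h2, ← intervalIntegral.integral_add (hc'.intervalIntegrable _ _) (hc.intervalIntegrable _ _)]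
  refine intervalIntegral.integral_congr fun x hx => ?_
  rw [Set.uIcc_of_le zero_le_one] at hx
  have : triangle x = 1 - x := by
    simp [triangle, abs_of_nonneg hx.1, max_eq_right (by linarith [hx.2] : 0 ≤ 1 - x)]
  have h' : triangle (-x) = 1 - x := by simpa [triangle] using this
  simp only [this, h']; ring

theorem integral_one_sub_mul_exp {c : ℂ} (hc : c ≠ 0) :
    ∫ x in (0:ℝ)..1, (1 - x : ℂ) * Complex.exp (c * x) = (Complex.exp c - 1 - c) / c ^ 2 := by
  have h : ∀ x ∈ Set.uIcc (0:ℝ) 1, HasDerivAt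
      (fun x : ℝ => (1 - x : ℂ) * Complex.exp (c * x) / c + Complex.exp (c * x) / c ^ 2)
      ((1 - x : ℂ) * Complex.exp (c * x)) x := by
    intro x _
    have h0 : HasDerivAt (fun x : ℝ => (x : ℂ)) 1 x := Complex.ofRealCLM.hasDerivAt
    have h1 : HasDerivAt (fun x : ℝ => Complex.exp (c * x)) (Complex.exp (c * x) * (c * 1)) x :=
      (h0.const_mul c).cexp
    convert! (((h0.const_sub 1).mul h1).div_const c).add (h1.div_const (c ^ 2)) using 1
    field_simp
    ring
  rw [intervalIntegral.integral_eq_sub_of_hasDerivAt h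
    (Continuous.intervalIntegrable (by fun_prop) _ _)]
  simp
  field_simp
  ring

open MeasureTheory Real FourierTransform in
theorem fourier_triangle (ξ : ℝ) : 𝓕 triangle ξ = (sinc (π * ξ) : ℂ) ^ 2 := by
  rw [Real.fourier_real_eq_integral_exp_smul]
  simp only [smul_eq_mul]
  rw [integral_mul_triangle _ (by fun_prop)]
  rcases eq_or_ne ξ 0 with rfl | hξ
  · simp only [mul_zero, Complex.ofReal_zero, zero_mul, Complex.exp_zero, sinc_zero,
      Complex.ofReal_one, one_pow]
    have : ∫ x in (0:ℝ)..1, (1 - x : ℂ) * (1 + 1) = ((∫ x in (0:ℝ)..1, (1 - x) * (1 + 1) : ℝ) : ℂ) := by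
      rw [← intervalIntegral.integral_ofReal]; push_cast; rfl
    rw [this, intervalIntegral.integral_mul_const, intervalIntegral.integral_sub (by simp) (by simp)]
    norm_num
  set c : ℂ := 2 * π * ξ * Complex.I with hc
  have hc0 : c ≠ 0 := by simp [hc, hξ, pi_ne_zero]
  have e1 : ∀ x : ℝ, Complex.exp (((-2 * π * x * ξ : ℝ) : ℂ) * Complex.I) = Complex.exp (-c * x) := by
    intro x; congr 1; push_cast; rw [hc]; ring
  have e2 : ∀ x : ℝ, Complex.exp (-c * ((-x : ℝ) : ℂ)) = Complex.exp (c * x) := by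
    intro x; congr 1; push_cast; ring
  simp only [e1, e2, mul_add]
  rw [intervalIntegral.integral_add (Continuous.intervalIntegrable (by fun_prop) _ _)
    (Continuous.intervalIntegrable (by fun_prop) _ _), integral_one_sub_mul_exp hc0,
    integral_one_sub_mul_exp (neg_ne_zero.2 hc0), sinc_of_ne_zero (mul_ne_zero pi_ne_zero hξ)]
  have hp : (π : ℂ) ≠ 0 := by exact_mod_cast pi_ne_zero
  have hx : (ξ : ℂ) ≠ 0 := by exact_mod_cast hξ
  have e3 : Complex.exp c + Complex.exp (-c) = 2 - 4 * Complex.sin (π * ξ) ^ 2 := by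
    have h1 := Complex.two_cos (2 * (π * ξ) : ℂ)
    rw [Complex.cos_two_mul, Complex.cos_sq'] at h1
    have h2 : c = 2 * (π * ξ) * Complex.I := by rw [hc]; ring
    have h3 : -c = -(2 * (π * ξ)) * Complex.I := by rw [hc]; ring
    rw [h3, h2, ← h1]; ring
  have e4 : c ^ 2 = - 4 * π ^ 2 * ξ ^ 2 := by rw [hc]; linear_combination (4 * π ^ 2 * ξ ^ 2 : ℂ) * Complex.I_sq
  have : (Complex.exp (-c) - 1 - -c) / (-c) ^ 2 + (Complex.exp c - 1 - c) / c ^ 2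
    = (Complex.exp c + Complex.exp (-c) - 2) / c ^ 2 := by rw [neg_sq]; ring
  rw [this, e3, e4]
  push_cast
  field_simp
  ring

theorem sinc_sq_le (x : ℝ) : Real.sinc x ^ 2 ≤ 2 * (1 + x ^ 2)⁻¹ := by
  have h1 : (Real.sinc x) ^ 2 ≤ 1 := by
    have := Real.abs_sinc_le_one x
    rw [← sq_abs]; exact pow_le_one₀ (abs_nonneg _) this
  have h2 : x ^ 2 * (Real.sinc x) ^ 2 ≤ 1 := by
    rcases eq_or_ne x 0 with rfl | hx
    · simp
    · rw [Real.sinc_of_ne_zero hx, div_pow, mul_div_cancel₀ _ (by positivity)]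
      exact Real.sin_sq_le_one x
  rw [← div_eq_mul_inv, le_div_iff₀ (by positivity)]
  linarith

open MeasureTheory Real in
theorem integrable_sinc_sq : Integrable fun x => sinc x ^ 2 :=
  (integrable_inv_one_add_sq.const_mul 2).mono' (by fun_prop)
    (ae_of_all _ fun x => by
      rw [norm_of_nonneg (by positivity)]; exact sinc_sq_le x)

open MeasureTheory Real FourierTransform in
theorem integrable_triangle : Integrable triangle := by
  refine continuous_triangle.integrable_of_hasCompactSupport ?_
  refine HasCompactSupport.of_support_subset_isCompact (isCompact_Icc (a := -1) (b := 1)) ?_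
  intro x hx
  by_contra h
  refine hx (triangle_eq_zero ?_)
  by_contra h'
  exact h (abs_le.1 (not_le.1 h').le)

open MeasureTheory Real FourierTransform in
theorem integrable_fourier_triangle : Integrable (𝓕 triangle) := by
  have : 𝓕 triangle = fun ξ => (((sinc (π * ξ)) ^ 2 : ℝ) : ℂ) := by
    ext ξ; rw [fourier_triangle]; push_cast; rfl
  rw [this]
  exact (integrable_sinc_sq.comp_mul_left' pi_ne_zero).ofReal

open MeasureTheory Real FourierTransform in
theorem fourier_fourier_triangle (x : ℝ) : 𝓕 (𝓕 triangle) x = triangle x := by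
  have h := congrFun (continuous_triangle.fourierInv_fourier_eq integrable_triangle
    integrable_fourier_triangle) (-x)
  rw [Real.fourierInv_eq_fourier_neg, neg_neg] at h
  rw [h]; simp [triangle]

open MeasureTheory Real FourierTransform in
-- Fourier inversion for the triangle function, evaluated at 0.
theorem integral_sinc_sq : ∫ x, sinc x ^ 2 = π := by
  have h := fourier_fourier_triangle 0
  rw [Real.fourier_real_eq_integral_exp_smul] at h
  have e : ∀ v : ℝ, Complex.exp (((-2 * π * v * 0 : ℝ) : ℂ) * Complex.I) • 𝓕 triangle v
      = ((sinc (π * v) ^ 2 : ℝ) : ℂ) := by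
    intro v; rw [fourier_triangle]; simp
  simp only [e] at h
  rw [integral_complex_ofReal, Measure.integral_comp_mul_left (fun x => sinc x ^ 2)] at h
  have h' : triangle 0 = 1 := by simp [triangle]
  rw [h', abs_inv, abs_of_pos pi_pos, smul_eq_mul] at h
  have := Complex.ofReal_eq_one.1 h
  field_simp at this
  exact this

open MeasureTheory Real FourierTransform in
-- Parseval: the multiplication formula for the triangle and its transform reduces the integral to
-- that of the squared triangle, which is 2/3.
theorem integral_sinc_pow_four : ∫ x, sinc x ^ 4 = 2 * π / 3 := by
  have h := VectorFourier.integral_fourierIntegral_smul_eq_flip (μ := volume) (ν := volume)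
    (L := innerₗ ℝ) (f := triangle) (g := 𝓕 triangle) Real.continuous_fourierChar
    continuous_inner integrable_triangle integrable_fourier_triangle
  rw [flip_innerₗ] at h
  change ∫ ξ, 𝓕 triangle ξ • 𝓕 triangle ξ = ∫ x, triangle x • 𝓕 (𝓕 triangle) x at h
  have e1 : ∀ ξ : ℝ, 𝓕 triangle ξ • 𝓕 triangle ξ = ((sinc (π * ξ) ^ 4 : ℝ) : ℂ) := by
    intro v; rw [fourier_triangle, smul_eq_mul]; push_cast; ring
  simp only [e1, fourier_fourier_triangle, smul_eq_mul] at h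
  rw [integral_complex_ofReal, Measure.integral_comp_mul_left (fun x => sinc x ^ 4),
    integral_mul_triangle _ continuous_triangle, abs_inv, abs_of_pos pi_pos, smul_eq_mul] at h
  have h2 : ∫ x in (0:ℝ)..1, (1 - x : ℂ) * (triangle x + triangle (-x))
      = ((∫ x in (0:ℝ)..1, 2 * (1 - x) ^ 2 : ℝ) : ℂ) := by
    rw [← intervalIntegral.integral_ofReal]
    refine intervalIntegral.integral_congr fun x hx => ?_
    rw [Set.uIcc_of_le zero_le_one] at hx
    have : triangle x = 1 - x := by
      simp [triangle, abs_of_nonneg hx.1, max_eq_right (by linarith [hx.2] : 0 ≤ 1 - x)]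
    have h' : triangle (-x) = 1 - x := by simpa [triangle] using this
    simp only [this, h']; push_cast; ring
  have h3 : ∫ x in (0:ℝ)..1, 2 * (1 - x) ^ 2 = 2 / 3 := by
    rw [intervalIntegral.integral_const_mul,
      intervalIntegral.integral_comp_sub_left (fun x => x ^ 2) (1:ℝ)]
    simp; norm_num
  rw [h2, h3] at h
  have := Complex.ofReal_inj.1 h
  field_simp at this ⊢
  linarith

open MeasureTheory Real in
-- From sin^4 = sin^2 - sin^2 cos^2 and the double-angle formula. It reduces the second moment of
-- sinc^4 to `integral_sinc_sq`.
theorem sq_mul_sinc_pow_four (x : ℝ) :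
    x ^ 2 * sinc x ^ 4 = sinc x ^ 2 - sinc (2 * x) ^ 2 := by
  rcases eq_or_ne x 0 with rfl | hx
  · simp
  · rw [sinc_of_ne_zero hx, sinc_of_ne_zero (by positivity), Real.sin_two_mul]
    field_simp
    rw [Real.cos_sq']
    ring

open MeasureTheory Real in
theorem integrable_sq_mul_sinc_pow_four : Integrable fun x => x ^ 2 * sinc x ^ 4 := by
  simp only [sq_mul_sinc_pow_four]
  exact integrable_sinc_sq.sub (integrable_sinc_sq.comp_mul_left' two_ne_zero)

open MeasureTheory Real in
theorem integral_sq_mul_sinc_pow_four : ∫ x, x ^ 2 * sinc x ^ 4 = π / 2 := by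
  simp only [sq_mul_sinc_pow_four]
  rw [integral_sub integrable_sinc_sq (integrable_sinc_sq.comp_mul_left' two_ne_zero),
    Measure.integral_comp_mul_left (fun x => sinc x ^ 2), integral_sinc_sq, abs_inv,
    abs_of_pos two_pos, smul_eq_mul]
  ring

open MeasureTheory Real in
theorem sinc_pow_four_le (x : ℝ) : sinc x ^ 4 ≤ sinc x ^ 2 := by
  have h1 : sinc x ^ 2 ≤ 1 := by
    rw [← sq_abs]; exact pow_le_one₀ (abs_nonneg _) (abs_sinc_le_one x)
  nlinarith [sq_nonneg (sinc x)]

open MeasureTheory Real in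
theorem integrable_sinc_pow_four : Integrable fun x => sinc x ^ 4 :=
  integrable_sinc_sq.mono' (by fun_prop) (ae_of_all _ fun x => by
      rw [norm_of_nonneg (by positivity)]; exact sinc_pow_four_le x)

open MeasureTheory Real in
theorem sinc_pow_four_ge {x : ℝ} (hx : |x| ≤ 1) : 1 - 2 / 3 * x ^ 2 ≤ sinc x ^ 4 := by
  have key : ∀ x : ℝ, 0 < x → x ≤ 1 → 1 - 2 / 3 * x ^ 2 ≤ sinc x ^ 4 := by
    intro x h0 h1
    have h2 : 1 - x ^ 2 / 6 ≤ sinc x := by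
      rw [sinc_of_ne_zero h0.ne', le_div_iff₀ h0]
      have := sin_ge_sub_cube h0.le
      linarith
    have h3 : 0 ≤ 1 - x ^ 2 / 6 := by nlinarith
    calc 1 - 2 / 3 * x ^ 2 ≤ (1 - x ^ 2 / 6) ^ 4 := by
          have := one_add_mul_le_pow (a := -(x ^ 2 / 6)) (by nlinarith) 4
          norm_num at this
          rw [← sub_eq_add_neg] at this
          linarith
      _ ≤ _ := by gcongr
  rcases lt_trichotomy x 0 with h | rfl | h
  · have := key (-x) (by linarith) (by rwa [abs_of_neg h] at hx)
    rwa [sinc_neg, neg_sq] at this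
  · simp
  · exact key x h (by rwa [abs_of_pos h] at hx)

/-! ### Numerical constants of the kernel sinc^4 with cut-off -4/5. -/

/-- The mass of `sinc ^ 4` to the left of `-4/5`. -/
noncomputable def sincTail : ℝ := ∫ y in Set.Iio (-(4/5) : ℝ), Real.sinc y ^ 4

open MeasureTheory Real in
-- By evenness this is the mass on [-4/5, 4/5], where `sinc_pow_four_ge` can be integrated. It
-- becomes the coefficient of the supremum of |g| in the final inequality, so it has to be positive,
-- and its size decides the constant.
theorem two_pi_div_three_sub_sincTail : 137 / 100 ≤ 2 * π / 3 - 2 * sincTail := by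
  have hi := integrable_sinc_pow_four
  have h1 : sincTail = ∫ y in Set.Ioi (4/5 : ℝ), sinc y ^ 4 := by
    have := integral_comp_neg_Ioi (4/5 : ℝ) (fun y => sinc y ^ 4)
    rw [sincTail, ← integral_Iic_eq_integral_Iio, ← this]
    simp
  have h2 : 2 * π / 3 = sincTail + ((∫ y in (-(4/5) : ℝ)..(4/5), sinc y ^ 4) + sincTail) := by
    nth_rewrite 2 [h1]
    rw [← integral_sinc_pow_four, sincTail, ← integral_Iic_eq_integral_Iio,
      intervalIntegral.integral_interval_add_Ioi hi.integrableOn hi.integrableOn,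
      intervalIntegral.integral_Iic_add_Ioi hi.integrableOn hi.integrableOn]
  have h3 : ∫ y in (-(4/5) : ℝ)..(4/5), (1 - 2 / 3 * y ^ 2) ≤
      ∫ y in (-(4/5) : ℝ)..(4/5), sinc y ^ 4 := by
    refine intervalIntegral.integral_mono_on (by norm_num)
      (Continuous.intervalIntegrable (by fun_prop) _ _)
      (Continuous.intervalIntegrable (by fun_prop) _ _) fun y hy => ?_
    exact sinc_pow_four_ge (abs_le.2 ⟨by linarith [hy.1], by linarith [hy.2]⟩)
  have h4 : ∫ y in (-(4/5) : ℝ)..(4/5), (1 - 2 / 3 * y ^ 2) = 8/5 - 2/9 * 2 * (4/5)^3 := by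
    rw [intervalIntegral.integral_sub (by simp) (Continuous.intervalIntegrable (by fun_prop) _ _),
      intervalIntegral.integral_const_mul, integral_pow]
    norm_num
  rw [h4] at h3
  norm_num at h3
  linarith

theorem sincTail_nonneg : 0 ≤ sincTail :=
  MeasureTheory.setIntegral_nonneg measurableSet_Iio fun _ _ => by positivity

open MeasureTheory Real in
theorem integral_quadratic_mul_sinc (a b : ℝ) :
    Integrable (fun y => (a + b * y ^ 2) * sinc y ^ 4) ∧
    ∫ y, (a + b * y ^ 2) * sinc y ^ 4 = a * (2 * π / 3) + b * (π / 2) := by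
  have e : (fun y => (a + b * y ^ 2) * sinc y ^ 4) =
      fun y => a * sinc y ^ 4 + b * (y ^ 2 * sinc y ^ 4) := by ext; ring
  rw [e]
  refine ⟨(integrable_sinc_pow_four.const_mul a).add (integrable_sq_mul_sinc_pow_four.const_mul b), ?_⟩
  rw [integral_add (integrable_sinc_pow_four.const_mul a)
    (integrable_sq_mul_sinc_pow_four.const_mul b), integral_const_mul, integral_const_mul,
    integral_sinc_pow_four, integral_sq_mul_sinc_pow_four]

open MeasureTheory Real in
theorem integrable_mul_sinc {f : ℝ → ℝ} (hf : Continuous f) {C : ℝ}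
    (h : ∀ y, |f y| ≤ C * (1 + y ^ 2)) : Integrable fun y => f y * sinc y ^ 4 := by
  refine (integral_quadratic_mul_sinc C C).1.mono'
    (Continuous.aestronglyMeasurable (by fun_prop)) (ae_of_all _ fun y => ?_)
  rw [norm_mul, norm_of_nonneg (by positivity : 0 ≤ sinc y ^ 4), norm_eq_abs]
  have := mul_le_mul_of_nonneg_right (h y) (by positivity : 0 ≤ sinc y ^ 4)
  linarith

theorem abs_le_one_add_sq (y : ℝ) : |y| ≤ (1 + y ^ 2) / 2 := by
  rw [← sq_abs]; nlinarith [sq_nonneg (|y| - 1)]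

open MeasureTheory Real in
theorem integral_posPart_mul_sinc :
    Integrable (fun y => max (4/5 + y) 0 * sinc y ^ 4) ∧
    ∫ y, max (4/5 + y) 0 * sinc y ^ 4 ≤ 612 / 1000 * π := by
  have hi : Integrable (fun y => max (4/5 + y) 0 * sinc y ^ 4) := by
    refine integrable_mul_sinc (C := 2) (by fun_prop) fun y => ?_
    rw [abs_of_nonneg (le_max_right _ _)]
    have := abs_le_one_add_sq y
    have := le_abs_self y
    exact max_le (by nlinarith [sq_nonneg y]) (by positivity)
  refine ⟨hi, ?_⟩
  have h1 : ∫ y, max (4/5 + y) 0 * sinc y ^ 4 = ∫ y, max (4/5 + -y) 0 * sinc y ^ 4 := by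
    rw [← integral_neg_eq_self]; simp
  have hi' : Integrable (fun y => max (4/5 + -y) 0 * sinc y ^ 4) := by simpa using hi.comp_neg
  -- Symmetrizing replaces the positive part by max(8/5, 4/5 + |y|). The parabola lies above it and
  -- touches 4/5 + |y| at |y| = 8/5, and its integral follows from the known moments.
  have h2 : (∫ y, max (4/5 + y) 0 * sinc y ^ 4) + (∫ y, max (4/5 + -y) 0 * sinc y ^ 4) ≤
      ∫ y, (8/5 + 5/16 * y ^ 2) * sinc y ^ 4 := by
    rw [← integral_add hi hi']
    refine integral_mono (hi.add hi') (integral_quadratic_mul_sinc _ _).1 fun y => ?_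
    simp only [← add_mul]
    refine mul_le_mul_of_nonneg_right ?_ (by positivity)
    rcases max_cases (4/5 + y) 0 with h | h <;> rcases max_cases (4/5 + -y) 0 with h' | h' <;>
      rw [h.1, h'.1] <;> nlinarith [sq_nonneg (y - 8/5), sq_nonneg (y + 8/5)]
  rw [(integral_quadratic_mul_sinc _ _).2, ← h1] at h2
  linarith [pi_pos]

/-! ### From a one-sided slope bound and small averages to a pointwise bound. -/

open MeasureTheory Real in
/-- A one-sided Lipschitz bound for `g` at `v`, a global lower bound for `g`, and an upper bound for
a smoothed value of `g` together bound `g v` from above. -/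
theorem mul_le_of_smoothing {g : ℝ → ℝ} (hg : Continuous g) {C : ℝ}
    (hgrow : ∀ τ, |g τ| ≤ C * (1 + |τ|)) {l M κ β v t E : ℝ} (hl : 1 ≤ l) (hM : 0 ≤ M)
    (hκ : 0 ≤ κ) (hβ : 0 ≤ β)
    (h1 : ∀ u, 0 ≤ u → g v - u * β - u ^ 2 ≤ g (v + u))
    (h2 : ∀ τ, -(M * (1 + κ * |τ - t|)) ≤ g τ)
    (hE : ∫ y, g (v + 4/5 / l + y / l) * sinc y ^ 4 ≤ E) :
    g v * (2 * π / 3 - sincTail) ≤ M * (1 + κ * |v - t|) * sincTail + β * (612 / 1000 * π) / l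
      + 7 / l ^ 2 + 5 * (M * κ) / l + E := by
  have hl0 : 0 < l := by linarith
  set W := M * (1 + κ * |v - t|) with hW
  have hWn : 0 ≤ W := by positivity
  have hgi : Integrable fun y => g (v + 4/5 / l + y / l) * sinc y ^ 4 := by
    have hC : 0 ≤ C := by have := (abs_nonneg _).trans (hgrow 0); simpa using this
    refine integrable_mul_sinc (C := C * (3 + |v|)) (by fun_prop) fun y => ?_
    refine (hgrow _).trans ?_
    rw [mul_assoc]
    refine mul_le_mul_of_nonneg_left ?_ hC
    have e1 : |v + 4/5 / l + y / l| ≤ |v| + 1 + |y| := by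
      refine (abs_add_le _ _).trans (add_le_add ((abs_add_le _ _).trans (add_le_add le_rfl ?_)) ?_)
      · rw [abs_of_nonneg (by positivity), div_le_one hl0]; linarith
      · rw [abs_div, abs_of_pos hl0]; exact div_le_self (abs_nonneg _) hl
    have := abs_le_one_add_sq y
    nlinarith [abs_nonneg v, mul_nonneg (abs_nonneg v) (sq_nonneg y), sq_nonneg y]
  have hφi : Integrable fun y => (Set.Iio (-(4/5) : ℝ)).indicator (fun y => (g v + W) * sinc y ^ 4) y :=
    (integrable_sinc_pow_four.const_mul _).indicator measurableSet_Iio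
  have hφ : ∫ y, (Set.Iio (-(4/5) : ℝ)).indicator (fun y => (g v + W) * sinc y ^ 4) y
      = (g v + W) * sincTail := by
    rw [integral_indicator measurableSet_Iio, integral_const_mul]; rfl
  obtain ⟨hpi, hp⟩ := integral_posPart_mul_sinc
  set q := fun y : ℝ => ((g v - (8/5) / l ^ 2 - M * κ * (8/5) / l) +
    (-(2 / l ^ 2) - M * κ / l) * y ^ 2) * sinc y ^ 4 with hq
  obtain ⟨hqi, hqv⟩ := integral_quadratic_mul_sinc (g v - (8/5) / l ^ 2 - M * κ * (8/5) / l)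
    (-(2 / l ^ 2) - M * κ / l)
  -- The left integrand is a pointwise minorant. For y ≥ -4/5 it comes from the slope bound with u =
  -- (4/5 + y)/l; for y < -4/5 the indicator trades g(v) for the trivial lower bound -W. The
  -- quadratic in `q` absorbs both u^2 and the variation of the weight.
  have hmain : ∫ y, (q y - (Set.Iio (-(4/5) : ℝ)).indicator (fun y => (g v + W) * sinc y ^ 4) y
      - β / l * (max (4/5 + y) 0 * sinc y ^ 4)) ≤ ∫ y, g (v + 4/5 / l + y / l) * sinc y ^ 4 := by
    refine integral_mono ((hqi.sub hφi).sub (hpi.const_mul _)) hgi fun y => ?_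
    have hK : 0 ≤ sinc y ^ 4 := by positivity
    have hy := abs_le_one_add_sq y
    have hll : 1 / l ^ 2 * (4/5 + y) ^ 2 ≤ 1 / l ^ 2 * (8/5 + 2 * y ^ 2) :=
      mul_le_mul_of_nonneg_left (by nlinarith [sq_nonneg (4/5 - y)]) (by positivity)
    have hmk : M * κ / l * (4/5 + |y|) ≤ M * κ / l * (8/5 + y ^ 2) :=
      mul_le_mul_of_nonneg_left (by nlinarith [sq_nonneg y]) (by positivity)
    by_cases hlt : y < -(4/5)
    · rw [Set.indicator_of_mem (show y ∈ Set.Iio _ from hlt), max_eq_right (by linarith)]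
      simp only [hq, zero_mul, mul_zero, sub_zero, ← sub_mul]
      refine mul_le_mul_of_nonneg_right ?_ hK
      have hb := h2 (v + 4/5 / l + y / l)
      have e1 : |v + 4/5 / l + y / l - t| ≤ |v - t| + (4/5 + |y|) / l := by
        have : v + 4/5 / l + y / l - t = (v - t) + (4/5 + y) / l := by ring
        rw [this]
        refine (abs_add_le _ _).trans (add_le_add le_rfl ?_)
        rw [abs_div, abs_of_pos hl0]
        gcongr
        exact (abs_add_le _ _).trans (by rw [abs_of_pos (by norm_num : (0:ℝ) < 4/5)])
      have e2 : M * (1 + κ * |v + 4/5 / l + y / l - t|) ≤ W + M * κ / l * (4/5 + |y|) := by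
        have := mul_le_mul_of_nonneg_left e1 (by positivity : 0 ≤ M * κ)
        rw [hW]
        have e3 : M * κ * (|v - t| + (4/5 + |y|) / l) = M * κ * |v - t| + M * κ / l * (4/5 + |y|) := by
          ring
        linarith
      have e4 : 0 ≤ (1 / l ^ 2) * (8/5 + 2 * y ^ 2) := by positivity
      have e5 : g v - (8/5) / l ^ 2 - M * κ * (8/5) / l + (-(2 / l ^ 2) - M * κ / l) * y ^ 2 - (g v + W)
        = - W - (1 / l ^ 2) * (8/5 + 2 * y ^ 2) - M * κ / l * (8/5 + y ^ 2) := by ring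
      linarith
    · rw [Set.indicator_of_notMem (show y ∉ Set.Iio _ from hlt), max_eq_left (by linarith)]
      simp only [hq, sub_zero, ← mul_assoc, ← sub_mul]
      refine mul_le_mul_of_nonneg_right ?_ hK
      have hb := h1 ((4/5 + y) / l) (div_nonneg (by linarith) hl0.le)
      have e1 : v + (4/5 + y) / l = v + 4/5 / l + y / l := by ring
      rw [e1] at hb
      have e2 : (4/5 + y) / l * β = β / l * (4/5 + y) := by ring
      have e3 : ((4/5 + y) / l) ^ 2 = 1 / l ^ 2 * (4/5 + y) ^ 2 := by rw [div_pow]; ring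
      have e4 : 0 ≤ M * κ / l * (8/5 + y ^ 2) := by positivity
      have e5 : g v - (8/5) / l ^ 2 - M * κ * (8/5) / l + (-(2 / l ^ 2) - M * κ / l) * y ^ 2
        = g v - (1 / l ^ 2) * (8/5 + 2 * y ^ 2) - M * κ / l * (8/5 + y ^ 2) := by ring
      linarith
  have hqφ : Integrable fun y =>
      q y - (Set.Iio (-(4/5) : ℝ)).indicator (fun y => (g v + W) * sinc y ^ 4) y := hqi.sub hφi
  rw [integral_sub hqφ (hpi.const_mul _), integral_sub hqi hφi, hφ, hqv,
    integral_const_mul] at hmain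
  have e1 : β / l * ∫ y, max (4/5 + y) 0 * sinc y ^ 4 ≤ β * (612 / 1000 * π) / l := by
    rw [mul_div_right_comm]
    gcongr
  have hπ := pi_lt_d2
  have e2 : (1 / l ^ 2) * (8/5 * (2 * π / 3) + 2 * (π / 2)) ≤ 7 / l ^ 2 := by
    rw [div_mul_eq_mul_div]; exact div_le_div_of_nonneg_right (by linarith) (by positivity)
  have e3 : (M * κ / l) * (8/5 * (2 * π / 3) + π / 2) ≤ 5 * (M * κ) / l := by
    have h0 : 0 ≤ M * κ / l := by positivity
    calc _ ≤ (M * κ / l) * 5 := mul_le_mul_of_nonneg_left (by linarith) h0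
      _ = _ := by ring
  have e4 : (g v - 8 / 5 / l ^ 2 - M * κ * (8 / 5) / l) * (2 * π / 3)
      + (-(2 / l ^ 2) - M * κ / l) * (π / 2) = g v * (2 * π / 3)
      - (1 / l ^ 2) * (8/5 * (2 * π / 3) + 2 * (π / 2)) - (M * κ / l) * (8/5 * (2 * π / 3) + π / 2) := by
    ring
  linarith

/-- The one-sided Lipschitz constant. -/
noncomputable def slopeBound (c τ : ℝ) : ℝ := 1 / 2 * Real.log (|τ| + 2) + c

theorem slopeBound_nonneg {c : ℝ} (hc : 0 ≤ c) (τ : ℝ) : 0 ≤ slopeBound c τ := by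
  have := Real.log_nonneg (by linarith [abs_nonneg τ] : 1 ≤ |τ| + 2)
  unfold slopeBound; linarith

/-- Since κ ≥ 1/r, the weight w satisfies |v| + 2 ≤ (r + 2) w, and log w ≤ w - 1. The slope may thus
be treated as its value near t times the weight. -/
theorem slopeBound_le_mul_weight {c : ℝ} (hc : 0 ≤ c) {κ r t : ℝ} (hr : 0 < r) (ht : |t| ≤ r)
    (hκ : 1 / r ≤ κ) (v : ℝ) :
    slopeBound c v ≤ (1 / 2 * Real.log (r + 2) + 1 / 2 + c) * (1 + κ * |v - t|) := by
  set w := 1 + κ * |v - t| with hw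
  have hw1 : 1 ≤ w := by
    have : 0 ≤ κ := le_trans (by positivity) hκ
    have := mul_nonneg this (abs_nonneg (v - t)); linarith
  have h1 : |v| + 2 ≤ (r + 2) * w := by
    have e1 : |v| ≤ |t| + |v - t| := by
      have := abs_add_le t (v - t); rwa [add_sub_cancel] at this
    have e2 : |v - t| ≤ r * (κ * |v - t|) := by
      rw [← mul_assoc]
      refine le_mul_of_one_le_left (abs_nonneg _) ?_
      rw [div_le_iff₀ hr] at hκ; linarith
    have e3 : 0 ≤ κ * |v - t| := by linarith
    rw [hw]; nlinarith
  have h2 : Real.log (|v| + 2) ≤ Real.log (r + 2) + w := by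
    refine (Real.log_le_log (by positivity) h1).trans ?_
    rw [Real.log_mul (by positivity) (by positivity)]
    have := Real.log_le_sub_one_of_pos (by linarith : 0 < w)
    linarith
  have h3 := Real.log_nonneg (by linarith : 1 ≤ r + 2)
  unfold slopeBound
  nlinarith

/-- The error term is dominated by the weight. -/
theorem error_le_mul_weight {B l r κ t v : ℝ} (hB : 0 ≤ B) (hl : 1 ≤ l) (ht : |t| = r)
    (hr : 2 * Real.exp (6 * l) ≤ r) (hκ : κ = Real.exp (8 * l) / r) :
    B * Real.exp (2 * l) + B * Real.exp (6 * l) / (1 + |v + 4/5/l|) ≤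
      (B * Real.exp (2 * l) + 4 * B) * (1 + κ * |v - t|) := by
  have hl0 : 0 < l := by linarith
  have hr0 : 0 < r := lt_of_lt_of_le (by positivity) hr
  set w := 1 + κ * |v - t| with hw
  have hκ0 : 0 ≤ κ := by rw [hκ]; positivity
  have hw1 : 1 ≤ w := by
    have := mul_nonneg hκ0 (abs_nonneg (v - t)); linarith
  have h1 : 1 + |v| ≤ 2 * (1 + |v + 4/5/l|) := by
    have e1 : |v| ≤ |v + 4/5/l| + 4/5/l := by
      have := abs_sub (v + 4/5/l) (4/5/l)
      rwa [add_sub_cancel_right, abs_of_nonneg (a := 4/5/l) (by positivity)] at this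
    have e2 : 4/5/l ≤ 1 := by rw [div_le_one hl0]; linarith
    have := abs_nonneg (v + 4/5/l)
    linarith
  have h2 : Real.exp (6 * l) ≤ 2 * w * (1 + |v|) := by
    -- If |v| ≥ r/2, then 1 + |v| alone exceeds e^{6l}. Otherwise v is far from t and the weight is
    -- at least e^{8l}/2; κ is chosen to make this true near the origin, where the pole term is
    -- large.
    rcases le_total (r / 2) |v| with h | h
    · have := abs_nonneg v
      nlinarith
    · have e1 : r / 2 ≤ |v - t| := by
        have := abs_sub_abs_le_abs_sub t v
        rw [abs_sub_comm t v] at this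
        linarith
      have e2 : κ * (r / 2) ≤ κ * |v - t| := mul_le_mul_of_nonneg_left e1 hκ0
      have e3 : κ * (r / 2) = Real.exp (8 * l) / 2 := by rw [hκ]; field_simp
      have e4 : Real.exp (6 * l) ≤ Real.exp (8 * l) := Real.exp_le_exp.2 (by linarith)
      have := abs_nonneg v
      nlinarith
  have h3 : Real.exp (6 * l) / (1 + |v + 4/5/l|) ≤ 4 * w := by
    rw [div_le_iff₀ (by positivity)]
    nlinarith
  have h4 := mul_le_mul_of_nonneg_left h3 hB
  have h5 : 0 ≤ B * Real.exp (2 * l) * (w - 1) := mul_nonneg (by positivity) (by linarith)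
  rw [mul_div_assoc]
  nlinarith

open MeasureTheory Real in
/-- A function with a one-sided Lipschitz bound whose smoothed values are small is small. -/
theorem abs_le_of_smoothing {g : ℝ → ℝ} (hg : Continuous g) {C : ℝ}
    (hgrow : ∀ τ, |g τ| ≤ C * (1 + |τ|)) {c B : ℝ} (hc : 0 ≤ c) (hB : 0 ≤ B)
    (h1 : ∀ τ u, 0 ≤ u → g τ - u * slopeBound c τ - u ^ 2 ≤ g (τ + u))
    (h2 : ∀ τ u, 0 ≤ u → g τ - u * slopeBound c (τ + u) - u ^ 2 ≤ g (τ + u))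
    {l t : ℝ} (hl : 1 ≤ l) (ht : 500 * exp (8 * l) ≤ t)
    (hsm : ∀ v, |∫ y, g (v + y / l) * sinc y ^ 4| ≤ B * exp (2 * l) + B * exp (6 * l) / (1 + |v|)) :
    |g t| * (136 / 100) ≤ (1 / 2 * log (t + 2) + 1 / 2 + c) * (612 / 1000 * π) / l + 7
      + (B * exp (2 * l) + 4 * B) := by
  have hl0 : 0 < l := by linarith
  have ht0 : 0 < t := lt_of_lt_of_le (by positivity) ht
  have hexp : exp (6 * l) ≤ exp (8 * l) := exp_le_exp.2 (by linarith)
  have hexp0 := exp_pos (6 * l)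
  obtain ⟨κ, hκ⟩ : ∃ κ, κ = exp (8 * l) / t := ⟨_, rfl⟩
  have hκ0 : 0 ≤ κ := by rw [hκ]; positivity
  have hκ1 : 500 * κ ≤ 1 := by
    rw [hκ, ← mul_div_assoc, div_le_one ht0]; exact ht
  have hκt : 1 / t ≤ κ := by rw [hκ]; gcongr; exact one_le_exp (by linarith)
  obtain ⟨R, hR⟩ : ∃ R, R = (1 / 2 * log (t + 2) + 1 / 2 + c) * (612 / 1000 * π) / l + 7
      + (B * exp (2 * l) + 4 * B) := ⟨_, rfl⟩
  -- Stated for a general function because it is used for g at t and for -g(-τ) at -t. Together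
  -- these control |g|.
  have key : ∀ (f : ℝ → ℝ) (s M : ℝ), Continuous f → (∀ τ, |f τ| ≤ C * (1 + |τ|)) → |s| = t →
      (∀ τ u, 0 ≤ u → f τ - u * slopeBound c τ - u ^ 2 ≤ f (τ + u)) →
      (∀ v, |∫ y, f (v + y / l) * sinc y ^ 4| ≤ B * exp (2 * l) + B * exp (6 * l) / (1 + |v|)) →
      0 ≤ M → (∀ τ, |f τ| ≤ M * (1 + κ * |τ - s|)) → ∀ v,
      f v * (2 * π / 3 - sincTail) ≤ (1 + κ * |v - s|) * (M * sincTail + M / 100 + R) := by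
    intro f s M hf hfg hs hf1 hfs hM hfM v
    have h := mul_le_of_smoothing hf hfg hl hM hκ0 (slopeBound_nonneg hc v) (hf1 v)
      (fun τ => (abs_le.1 (hfM τ)).1) ((le_abs_self _).trans (hfs (v + 4/5/l)))
    have e1 := slopeBound_le_mul_weight hc ht0 hs.le hκt v
    have e2 := error_le_mul_weight (v := v) hB hl hs (by linarith) hκ
    set w := 1 + κ * |v - s| with hw
    have hw1 : 1 ≤ w := by
      have := mul_nonneg hκ0 (abs_nonneg (v - s)); linarith
    have e3 : slopeBound c v * (612 / 1000 * π) / l ≤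
        (1 / 2 * log (t + 2) + 1 / 2 + c) * w * (612 / 1000 * π) / l := by gcongr
    have e4 : 7 / l ^ 2 ≤ 7 * w := by
      rw [div_le_iff₀ (by positivity)]
      have : 1 ≤ l ^ 2 := one_le_pow₀ hl
      nlinarith
    -- The factor 500 in the hypothesis on t gives 500 κ ≤ 1, so the variation of the weight costs
    -- at most one hundredth of M.
    have e5 : 5 * (M * κ) / l ≤ M / 100 * w := by
      rw [div_le_iff₀ hl0]
      have : M * κ * 500 ≤ M := by nlinarith
      have : 0 ≤ M / 100 * (w * l - 1) := mul_nonneg (by positivity) (by nlinarith)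
      nlinarith
    have e6 : w * (M * sincTail + M / 100 + R) = M * w * sincTail + M / 100 * w +
        ((1 / 2 * log (t + 2) + 1 / 2 + c) * w * (612 / 1000 * π) / l + 7 * w
        + (B * exp (2 * l) + 4 * B) * w) := by rw [hR]; ring
    linarith
  have hw1 : ∀ v, 1 ≤ 1 + κ * |v - t| := fun v => by
    have := mul_nonneg hκ0 (abs_nonneg (v - t)); linarith
  have hC : 0 ≤ C := by have := (abs_nonneg _).trans (hgrow 0); simpa using this
  -- The growth constant C serves only for integrability and for the finiteness of this supremum. It
  -- does not enter the final bound, so it may depend on σ in the application.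
  have hbdd : BddAbove (Set.range fun v => |g v| / (1 + κ * |v - t|)) := by
    refine ⟨C * (1 + t) + C * t, ?_⟩
    rintro _ ⟨v, rfl⟩
    simp only
    rw [div_le_iff₀ (by linarith [hw1 v])]
    refine (hgrow v).trans ?_
    have e1 : |v| ≤ t + |v - t| := by
      have := abs_add_le t (v - t); rwa [add_sub_cancel, abs_of_pos ht0] at this
    have e2 : |v - t| ≤ t * (κ * |v - t|) := by
      rw [← mul_assoc]
      refine le_mul_of_one_le_left (abs_nonneg _) ?_
      rw [div_le_iff₀ ht0] at hκt; linarith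
    have e3 : 0 ≤ κ * |v - t| := mul_nonneg hκ0 (abs_nonneg _)
    have : 1 + |v| ≤ (1 + t + t) * (1 + κ * |v - t|) := by nlinarith
    nlinarith
  obtain ⟨M, hM⟩ : ∃ M, M = ⨆ v, |g v| / (1 + κ * |v - t|) := ⟨_, rfl⟩
  have hle : ∀ v, |g v| ≤ M * (1 + κ * |v - t|) := fun v => by
    rw [← div_le_iff₀ (by linarith [hw1 v]), hM]
    exact le_ciSup hbdd v
  have hM0 : 0 ≤ M := by
    have := (abs_nonneg _).trans (hle t); simpa using this
  have ha := two_pi_div_three_sub_sincTail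
  have hst := sincTail_nonneg
  have hpos : 0 < 2 * π / 3 - sincTail := by linarith
  have hfin : ∀ v, |g v| * (2 * π / 3 - sincTail) ≤
      (1 + κ * |v - t|) * (M * sincTail + M / 100 + R) := by
    intro v
    have k1 := key g t M hg hgrow (abs_of_pos ht0) h1 hsm hM0 hle v
    -- Reflection together with the change of sign preserves the direction of the slope inequality
    -- but exchanges the endpoints of the interval, hence the hypothesis `h2` with the slope read at
    -- the right end.
    have k2 := key (fun τ => -g (-τ)) (-t) M (by fun_prop)
      (fun τ => by rw [abs_neg]; simpa using hgrow (-τ)) (by rw [abs_neg, abs_of_pos ht0])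
      (fun τ u hu => by
        have := h2 (-(τ + u)) u hu
        rw [show -(τ + u) + u = -τ by ring] at this
        have e : slopeBound c (-τ) = slopeBound c τ := by simp [slopeBound]
        rw [e] at this
        linarith)
      (fun v => by
        have := hsm (-v)
        rw [abs_neg, ← integral_neg_eq_self] at this
        convert! this using 1
        rw [← abs_neg, ← integral_neg]
        congr 1
        refine integral_congr_ae (ae_of_all _ fun y => ?_)
        simp only [sinc_neg]
        rw [show -(v + y / l) = -v + -y / l by ring]
        ring) hM0
      (fun τ => by
        rw [abs_neg]
        have := hle (-τ)
        rwa [show |-τ - t| = |τ - -t| by rw [← abs_neg]; congr 1; ring] at this) (-v)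
    rw [neg_neg, show |-v - -t| = |v - t| by rw [← abs_neg]; congr 1; ring] at k2
    rcases abs_cases (g v) with h | h <;> rw [h.1] <;> linarith
  have hMle : M ≤ (M * sincTail + M / 100 + R) / (2 * π / 3 - sincTail) := by
    rw [hM]
    refine ciSup_le fun v => ?_
    rw [← hM, div_le_div_iff₀ (by linarith [hw1 v]) hpos]
    linarith [hfin v]
  rw [le_div_iff₀ hpos] at hMle
  -- The coefficient is 1.37, from the mass on [-4/5, 4/5], minus the 1/100 lost to the weight.
  have hMR : M * (136 / 100) ≤ R := by nlinarith
  have := hle t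
  simp only [sub_self, abs_zero, mul_zero, add_zero, mul_one] at this
  rw [← hR]
  linarith

/-! ### Polynomial growth of (s - 1)ζ(s) to the right of Re s = 1/4. -/

/-- The `n`-th term of a series for `(s - 1) ζ(s) - 1`, valid for `Re s > 0`. -/
noncomputable def zetaTerm (n : ℕ) (s : ℂ) : ℂ :=
  (s - 1) * (1 / ((n : ℂ) + 1) ^ s) + (((n : ℂ) + 2) ^ (1 - s) - ((n : ℂ) + 1) ^ (1 - s))

theorem hasDerivAt_ofReal_cpow_real {x : ℝ} (hx : 0 < x) (c : ℂ) :
    HasDerivAt (fun y : ℝ => (y : ℂ) ^ c) (c * (x : ℂ) ^ (c - 1)) x := by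
  have h := ((hasDerivAt_id (x : ℂ)).cpow_const (c := c)
    (by simpa using hx)).comp_ofReal
  simpa using h

/-- The term is the increment over [n + 1, n + 2] of y ↦ (s - 1)(n + 1)^{-s} y + y^{1-s}. Its
derivative (s - 1)((n + 1)^{-s} - y^{-s}) vanishes at the left end and is estimated by a second
application of the mean value inequality. -/
theorem norm_zetaTerm_le (n : ℕ) {s : ℂ} (hs : 0 < s.re) :
    ‖zetaTerm n s‖ ≤ ‖s - 1‖ * ‖s‖ * ((n : ℝ) + 1) ^ (-(s.re + 1)) := by
  have hn : (0:ℝ) < (n : ℝ) + 1 := by positivity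
  have h1 : ∀ x ∈ Set.Icc ((n : ℝ) + 1) (n + 2),
      ‖((n : ℂ) + 1) ^ (-s) - (x : ℂ) ^ (-s)‖ ≤ ‖s‖ * ((n : ℝ) + 1) ^ (-(s.re + 1)) := by
    intro x hx
    have h := Convex.norm_image_sub_le_of_norm_hasDerivWithin_le (𝕜 := ℝ)
      (f := fun y : ℝ => (y : ℂ) ^ (-s)) (f' := fun y => -s * (y : ℂ) ^ (-s - 1))
      (s := Set.Icc ((n : ℝ) + 1) (n + 2)) (x := x) (y := n + 1)
      (C := ‖s‖ * ((n : ℝ) + 1) ^ (-(s.re + 1)))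
      (fun y hy => (hasDerivAt_ofReal_cpow_real (by linarith [hy.1]) _).hasDerivWithinAt)
      (fun y hy => ?_) (convex_Icc _ _) hx ⟨le_rfl, by linarith⟩
    · refine (le_of_eq_of_le (by push_cast; rfl) h).trans ?_
      have : ‖(n : ℝ) + 1 - x‖ ≤ 1 := by
        rw [Real.norm_eq_abs, abs_le]; constructor <;> linarith [hx.1, hx.2]
      exact mul_le_of_le_one_right (by positivity) this
    · have hy0 : 0 < y := by linarith [hy.1]
      rw [norm_mul, norm_neg, Complex.norm_cpow_eq_rpow_re_of_pos hy0]
      gcongr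
      have : (-s - 1).re = -(s.re + 1) := by simp; ring
      rw [this]
      exact Real.rpow_le_rpow_of_nonpos hn hy.1 (by linarith)
  have h := Convex.norm_image_sub_le_of_norm_hasDerivWithin_le (𝕜 := ℝ)
      (f := fun y : ℝ => (s - 1) * ((n : ℂ) + 1) ^ (-s) * y + (y : ℂ) ^ (1 - s))
      (f' := fun y => (s - 1) * (((n : ℂ) + 1) ^ (-s) - (y : ℂ) ^ (-s)))
      (s := Set.Icc ((n : ℝ) + 1) (n + 2)) (x := n + 1) (y := n + 2)
      (C := ‖s - 1‖ * ‖s‖ * ((n : ℝ) + 1) ^ (-(s.re + 1)))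
      (fun y hy => ?_) (fun y hy => ?_) (convex_Icc _ _) ⟨le_rfl, by linarith⟩ ⟨by linarith, le_rfl⟩
  · have e1 : ‖(n : ℝ) + 2 - (n + 1)‖ = 1 := by
      rw [show (n : ℝ) + 2 - (n + 1) = 1 by ring]; simp
    rw [e1, mul_one] at h
    refine (le_of_eq ?_).trans h
    congr 1
    simp only [zetaTerm, one_div, ← Complex.cpow_neg]
    push_cast
    ring
  · have hy0 : 0 < y := by linarith [hy.1]
    have h0 : HasDerivAt (fun x : ℝ => (x : ℂ)) 1 y := Complex.ofRealCLM.hasDerivAt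
    have := ((h0.const_mul ((s - 1) * ((n : ℂ) + 1) ^ (-s))).add
      (hasDerivAt_ofReal_cpow_real hy0 (1 - s))).hasDerivWithinAt
        (s := Set.Icc ((n : ℝ) + 1) (n + 2))
    convert! this using 1
    rw [show 1 - s - 1 = -s by ring]; ring
  · rw [norm_mul, mul_assoc]
    exact mul_le_mul_of_nonneg_left (h1 y hy) (norm_nonneg _)

theorem summable_add_one_rpow {p : ℝ} (hp : p < -1) : Summable fun n : ℕ => ((n : ℝ) + 1) ^ p := by
  have := (summable_nat_add_iff 1).2 (Real.summable_nat_rpow.2 hp)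
  simpa using this

theorem hasSum_zetaTerm_of_one_lt {s : ℂ} (hs : 1 < s.re) :
    HasSum (fun n => zetaTerm n s) (riemannZeta₁ s - 1) := by
  have hsum : Summable fun n => zetaTerm n s := by
    refine Summable.of_norm_bounded ((summable_add_one_rpow (p := -(s.re + 1)) (by linarith)).mul_left
      (‖s - 1‖ * ‖s‖)) fun n => norm_zetaTerm_le n (by linarith)
  rw [hsum.hasSum_iff_tendsto_nat]
  have h1 : Tendsto (fun N => ∑ n ∈ Finset.range N, 1 / ((n : ℂ) + 1) ^ s) atTop
      (𝓝 (riemannZeta s)) := by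
    rw [zeta_eq_tsum_one_div_nat_add_one_cpow hs]
    refine Summable.tendsto_sum_tsum_nat (Summable.of_norm ?_)
    refine (summable_add_one_rpow (p := -s.re) (by linarith)).congr fun n => ?_
    have : ((n : ℂ) + 1) = ((n + 1 : ℝ) : ℂ) := by push_cast; rfl
    rw [norm_div, norm_one, this, Complex.norm_cpow_eq_rpow_re_of_pos (by positivity),
      Real.rpow_neg (by positivity), one_div]
  -- The differences of (n + 1)^{1-s} telescope; for Re s > 1 the surviving power tends to 0.
  have h2 : ∀ N, ∑ n ∈ Finset.range N, zetaTerm n s =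
      (s - 1) * (∑ n ∈ Finset.range N, 1 / ((n : ℂ) + 1) ^ s) + (((N : ℂ) + 1) ^ (1 - s) - 1) := by
    intro N
    induction N with
    | zero => simp
    | succ N ih =>
      rw [Finset.sum_range_succ, Finset.sum_range_succ, ih, zetaTerm]
      push_cast
      rw [show (N : ℂ) + 1 + 1 = N + 2 by ring]
      ring
  have h3 : Tendsto (fun N : ℕ => ((N : ℂ) + 1) ^ (1 - s)) atTop (𝓝 0) := by
    rw [tendsto_zero_iff_norm_tendsto_zero]
    have : Tendsto (fun N : ℕ => ((N : ℝ) + 1) ^ (-(s.re - 1))) atTop (𝓝 0) :=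
      (tendsto_rpow_neg_atTop (by linarith)).comp
        (tendsto_atTop_add_const_right _ _ tendsto_natCast_atTop_atTop)
    refine this.congr fun n => ?_
    have h : ((n : ℂ) + 1) = ((n + 1 : ℝ) : ℂ) := by push_cast; rfl
    rw [h, Complex.norm_cpow_eq_rpow_re_of_pos (by positivity)]
    congr 1; simp
  simp only [h2]
  have hs1 : s ≠ 1 := by rintro rfl; simp at hs
  have h4 : riemannZeta₁ s = (s - 1) * riemannZeta s := by
    rw [riemannZeta_eq_inv_sub_mul hs1, mul_inv_cancel_left₀ (sub_ne_zero.2 hs1)]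
  have := (h1.const_mul (s - 1)).add (h3.sub_const 1)
  rw [h4]
  simpa [sub_eq_add_neg] using this

theorem differentiable_zetaTerm (n : ℕ) : Differentiable ℂ (zetaTerm n) := by
  have h1 : ((n : ℂ) + 1) ≠ 0 := by exact_mod_cast n.succ_ne_zero
  have h2 : ((n : ℂ) + 2) ≠ 0 := by exact_mod_cast (n + 1).succ_ne_zero
  have h3 : ∀ s : ℂ, ((n : ℂ) + 1) ^ s ≠ 0 := fun s => by simp [Complex.cpow_eq_zero_iff, h1]
  intro s
  unfold zetaTerm
  refine ((differentiableAt_id.sub_const 1).mul ((differentiableAt_const _).div ?_ (h3 s))).add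
    (DifferentiableAt.sub ?_ ?_)
  · exact differentiableAt_id.const_cpow (Or.inl h1)
  · exact (differentiableAt_id.const_sub 1).const_cpow (Or.inl h2)
  · exact (differentiableAt_id.const_sub 1).const_cpow (Or.inl h1)

theorem riemannZeta₁_eq_tsum {s : ℂ} (hs : 1 / 8 < s.re) :
    riemannZeta₁ s = 1 + ∑' n, zetaTerm n s := by
  set R := ‖s‖ + 3
  -- Intersecting with a ball bounds the factors ‖s - 1‖ ‖s‖, so that the series converges uniformly
  -- on a convex set where the identity theorem applies.
  set U : Set ℂ := {z | 1 / 8 < z.re} ∩ Metric.ball 0 R with hU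
  have hUo : IsOpen U := (isOpen_lt continuous_const Complex.continuous_re).inter Metric.isOpen_ball
  have hUc : Convex ℝ U := (convex_halfSpace_re_gt _).inter (convex_ball _ _)
  have hd : DifferentiableOn ℂ (fun z => ∑' n, zetaTerm n z) U := by
    refine Complex.differentiableOn_tsum_of_summable_norm
      ((summable_add_one_rpow (p := -(1/8 + 1)) (by norm_num)).mul_left ((R + 1) * R))
      (fun n => (differentiable_zetaTerm n).differentiableOn) hUo fun n w hw => ?_
    have hw1 : 1 / 8 < w.re := hw.1
    have hw2 : ‖w‖ < R := by simpa using hw.2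
    refine (norm_zetaTerm_le n (by linarith)).trans ?_
    have : ‖w - 1‖ ≤ R + 1 := (norm_sub_le _ _).trans (by simp; linarith)
    gcongr
    linarith
  have h2 : (2 : ℂ) ∈ U := ⟨by norm_num, by
    simp only [Metric.mem_ball, dist_zero_right, Complex.norm_ofNat, R]; linarith [norm_nonneg s]⟩
  have := AnalyticOnNhd.eqOn_of_preconnected_of_eventuallyEq (f := riemannZeta₁)
    (g := fun z => 1 + ∑' n, zetaTerm n z) (U := U) (z₀ := 2)
    (differentiable_riemannZeta₁.differentiableOn.analyticOnNhd hUo)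
    ((hd.const_add 1).analyticOnNhd hUo) hUc.isPreconnected h2 ?_
  · exact this ⟨hs, by simp [R]⟩
  · have : ∀ᶠ z : ℂ in 𝓝 2, 1 < z.re :=
      (isOpen_lt continuous_const Complex.continuous_re).mem_nhds (by simp)
    filter_upwards [this] with z hz
    rw [(hasSum_zetaTerm_of_one_lt hz).tsum_eq]; ring

/-- The range extends left to 1/4 because the ξ-quotient below evaluates at s - h with Re s ≥ 1/2
and h ≤ 1/4. -/
theorem exists_norm_riemannZeta₁_le :
    ∃ C : ℝ, 1 ≤ C ∧ ∀ s : ℂ, 1 / 4 ≤ s.re → ‖riemannZeta₁ s‖ ≤ C * (1 + ‖s‖) ^ 2 := by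
  have hS := summable_add_one_rpow (p := -(1/4 + 1)) (by norm_num)
  set A := ∑' n : ℕ, ((n : ℝ) + 1) ^ (-(1/4 + 1) : ℝ)
  have hA : 0 ≤ A := tsum_nonneg fun n => by positivity
  refine ⟨1 + A, by linarith, fun s hs => ?_⟩
  rw [riemannZeta₁_eq_tsum (by linarith)]
  have h : ‖∑' n, zetaTerm n s‖ ≤ ‖s - 1‖ * ‖s‖ * A := by
    refine tsum_of_norm_bounded (hS.hasSum.mul_left _) fun n => ?_
    refine (norm_zetaTerm_le n (by linarith)).trans ?_
    gcongr
    linarith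
  have h1 : ‖s - 1‖ ≤ 1 + ‖s‖ := (norm_sub_le _ _).trans (by simp; linarith)
  have h2 : ‖s - 1‖ * ‖s‖ ≤ (1 + ‖s‖) ^ 2 := by
    have := norm_nonneg s
    nlinarith [norm_nonneg (s - 1)]
  have h3 : 1 ≤ (1 + ‖s‖) ^ 2 := one_le_pow₀ (by linarith [norm_nonneg s])
  have h4 := norm_add_le 1 (∑' n, zetaTerm n s)
  rw [norm_one] at h4
  nlinarith [norm_nonneg s]

/-! ### The logarithm of (s - 1)ζ(s) under the Riemann Hypothesis. -/

/-- `L` is the holomorphic logarithm of `(s - 1) ζ(s)` on `Re s > 1/2` that is real at `2`. -/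
structure IsLogZeta (L : ℂ → ℂ) : Prop where
  differentiableAt : ∀ s : ℂ, 1 / 2 < s.re → DifferentiableAt ℂ L s
  exp_eq : ∀ s : ℂ, 1 / 2 < s.re → Complex.exp (L s) = riemannZeta₁ s
  im_two : (L 2).im = 0

theorem riemannZeta₁_eq {s : ℂ} (hs : s ≠ 1) : riemannZeta₁ s = (s - 1) * riemannZeta s := by
  rw [riemannZeta_eq_inv_sub_mul hs, mul_inv_cancel_left₀ (sub_ne_zero.2 hs)]

theorem riemannZeta₁_ne_zero (hRH : RiemannHypothesis) {s : ℂ} (hs : 1 / 2 < s.re) :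
    riemannZeta₁ s ≠ 0 := by
  intro h
  rcases eq_or_ne s 1 with rfl | hs1
  · simp at h
  rw [riemannZeta₁_eq hs1, mul_eq_zero, or_iff_right (sub_ne_zero.2 hs1)] at h
  refine hs.ne' (hRH s h ?_ hs1)
  rintro ⟨n, rfl⟩
  have : (-2 * ((n : ℂ) + 1)).re = -2 * ((n : ℝ) + 1) := by simp
  rw [this] at hs
  have : (0:ℝ) ≤ n := n.cast_nonneg
  linarith

theorem isOpen_re_gt (a : ℝ) : IsOpen {s : ℂ | a < s.re} :=
  isOpen_lt continuous_const Complex.continuous_re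

/-- Near z, continuity keeps Im(f - f(z)) inside (-π, π), so f coincides there with f(z) plus the
principal logarithm of g/g(z). -/
theorem differentiableAt_of_exp_eq {f g : ℂ → ℂ} {U : Set ℂ} (hU : IsOpen U)
    (hf : ContinuousOn f U) (hg : ∀ z ∈ U, DifferentiableAt ℂ g z)
    (h : ∀ z ∈ U, Complex.exp (f z) = g z) {z : ℂ} (hz : z ∈ U) : DifferentiableAt ℂ f z := by
  have hgz : g z ≠ 0 := by rw [← h z hz]; exact Complex.exp_ne_zero _
  have hd : DifferentiableAt ℂ (fun w => Complex.log (g w / g z) + f z) z := by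
    refine (DifferentiableAt.clog ((hg z hz).div_const _) ?_).add_const _
    rw [div_self hgz]; exact Complex.one_mem_slitPlane
  refine hd.congr_of_eventuallyEq ?_
  have hc : ContinuousAt (fun w => (f w - f z).im) z :=
    Complex.continuous_im.continuousAt.comp
      (((hf.continuousAt (hU.mem_nhds hz)).sub continuousAt_const))
  have h1 : ∀ᶠ w in 𝓝 z, (f w - f z).im ∈ Set.Ioo (-Real.pi) Real.pi :=
    hc.eventually (Ioo_mem_nhds (by simp [Real.pi_pos]) (by simp [Real.pi_pos]))
  filter_upwards [h1, hU.mem_nhds hz] with w hw hwU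
  rw [← h w hwU, ← h z hz, ← Complex.exp_sub, Complex.log_exp hw.1 hw.2.le]
  ring

theorem exists_isLogZeta (hRH : RiemannHypothesis) : ∃ L, IsLogZeta L := by
  set U : Set ℂ := {s | 1 / 2 < s.re}
  have hU : IsOpen U := isOpen_re_gt _
  have h2 : (2 : ℂ) ∈ U := by simp [U]; norm_num
  have hsc : IsSimplyConnected U := by
    have := (convex_halfSpace_re_gt (1/2 : ℝ)).contractibleSpace ⟨2, h2⟩
    exact SimplyConnectedSpace.ofContractible U
  obtain ⟨f, hfc, hf⟩ := Complex.exists_continuousOn_eqOn_exp_comp hsc hU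
    differentiable_riemannZeta₁.continuous.continuousOn (g := riemannZeta₁) (by
      rintro ⟨s, hs, h0⟩
      exact riemannZeta₁_ne_zero hRH hs h0)
  have hf' : ∀ z ∈ U, Complex.exp (f z) = riemannZeta₁ z := fun z hz => hf hz
  have hreal : riemannZeta₁ 2 = (‖riemannZeta 2‖ : ℂ) := by
    rw [riemannZeta₁_eq (by norm_num), ← zeta_two_eq_norm]; ring
  have hpos : 0 < ‖riemannZeta 2‖ :=
    norm_pos_iff.2 (riemannZeta_ne_zero_of_one_le_re (by norm_num))
  -- At 2 the function equals ζ(2) > 0, so its logarithm is real up to a multiple of 2πi, which is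
  -- then subtracted.
  obtain ⟨n, hn⟩ : ∃ n : ℤ, f 2 = Real.log ‖riemannZeta 2‖ + n * (2 * Real.pi * Complex.I) := by
    rw [← Complex.exp_eq_exp_iff_exists_int, hf' 2 h2, hreal, ← Complex.ofReal_exp,
      Real.exp_log hpos]
  refine ⟨fun s => f s - n * (2 * Real.pi * Complex.I), fun s hs =>
    (differentiableAt_of_exp_eq hU hfc (fun z _ => differentiable_riemannZeta₁ z) hf' hs).sub_const _,
    fun s hs => ?_, ?_⟩
  · rw [Complex.exp_sub, Complex.exp_int_mul_two_pi_mul_I, div_one, hf' s hs]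
  · simp only [hn, add_sub_cancel_right, Complex.ofReal_im]

theorem IsLogZeta.log_norm {L : ℂ → ℂ} (hL : IsLogZeta L) {s : ℂ} (hs : 1 / 2 < s.re) :
    (L s).re = Real.log ‖riemannZeta₁ s‖ := by
  rw [← hL.exp_eq s hs, Complex.norm_exp, Real.log_exp]

/-- The coefficients of the Dirichlet series of `log ζ`. -/
noncomputable def logZetaCoeff (n : ℕ) : ℂ :=
  (ArithmeticFunction.vonMangoldt n / Real.log n : ℝ)

theorem norm_logZetaCoeff_le (n : ℕ) : ‖logZetaCoeff n‖ ≤ 1 := by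
  have h0 : 0 ≤ Real.log n := Real.log_natCast_nonneg n
  rw [logZetaCoeff, Complex.norm_real, Real.norm_of_nonneg
    (div_nonneg ArithmeticFunction.vonMangoldt_nonneg h0)]
  exact div_le_one_of_le₀ ArithmeticFunction.vonMangoldt_le_log h0

theorem logMul_logZetaCoeff :
    LSeries.logMul logZetaCoeff = fun n => (ArithmeticFunction.vonMangoldt n : ℂ) := by
  ext n
  rw [LSeries.logMul, logZetaCoeff, ← Complex.natCast_log]
  rcases eq_or_ne (Real.log n) 0 with h | h
  · have : ArithmeticFunction.vonMangoldt n ≤ 0 := h ▸ ArithmeticFunction.vonMangoldt_le_log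
    rw [le_antisymm this ArithmeticFunction.vonMangoldt_nonneg, h]; simp
  · rw [← Complex.ofReal_mul, mul_div_cancel₀ _ h]

theorem abscissa_logZetaCoeff_lt {s : ℂ} (hs : 1 < s.re) :
    LSeries.abscissaOfAbsConv logZetaCoeff < s.re :=
  (LSeries.abscissaOfAbsConv_le_of_le_const ⟨1, fun n _ => norm_logZetaCoeff_le n⟩).trans_lt
    (by exact_mod_cast hs)

theorem hasDerivAt_LSeries_logZetaCoeff {s : ℂ} (hs : 1 < s.re) :
    HasDerivAt (LSeries logZetaCoeff) (deriv riemannZeta s / riemannZeta s) s := by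
  have h := LSeries_hasDerivAt (abscissa_logZetaCoeff_lt hs)
  rw [logMul_logZetaCoeff, ArithmeticFunction.LSeries_vonMangoldt_eq_deriv_riemannZeta_div hs,
    neg_div, neg_neg] at h
  exact h

theorem IsLogZeta.hasDerivAt {L : ℂ → ℂ} (hL : IsLogZeta L) {s : ℂ} (hs : 1 / 2 < s.re) :
    HasDerivAt L (deriv riemannZeta₁ s / riemannZeta₁ s) s := by
  have h1 := (hL.differentiableAt s hs).hasDerivAt
  have h2 := h1.cexp
  have h3 : (fun z => Complex.exp (L z)) =ᶠ[𝓝 s] riemannZeta₁ := by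
    filter_upwards [(isOpen_re_gt (1/2)).mem_nhds hs] with z hz using hL.exp_eq z hz
  have h4 := (h2.congr_of_eventuallyEq h3.symm).deriv
  rw [hL.exp_eq s hs] at h4
  have h5 : riemannZeta₁ s ≠ 0 := by rw [← hL.exp_eq s hs]; exact Complex.exp_ne_zero _
  rw [h4, mul_div_cancel_left₀ _ h5]
  exact h1

theorem sub_one_mem_slitPlane {s : ℂ} (hs : 1 < s.re) : s - 1 ∈ Complex.slitPlane :=
  Or.inl (by simpa using hs)

theorem im_LSeries_logZetaCoeff_two : (LSeries logZetaCoeff 2).im = 0 := by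
  have h : ∀ n, LSeries.term logZetaCoeff 2 n = ((if n = 0 then 0 else
      ArithmeticFunction.vonMangoldt n / Real.log n / (n : ℝ) ^ 2 : ℝ) : ℂ) := by
    intro n
    rw [LSeries.term_def]
    split_ifs
    · simp
    · have : (n : ℂ) ^ (2 : ℂ) = (n : ℂ) ^ 2 := by exact_mod_cast Complex.cpow_natCast (n : ℂ) 2
      rw [this, logZetaCoeff]; push_cast; rfl
  rw [LSeries, tsum_congr h, ← Complex.ofReal_tsum, Complex.ofReal_im]

/-- Both sides have the same derivative on the half-plane and are real at 2. Only the reality of c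
matters: against a real kernel it does not contribute to imaginary parts. -/
theorem IsLogZeta.eq_LSeries {L : ℂ → ℂ} (hL : IsLogZeta L) :
    ∃ c : ℝ, ∀ s : ℂ, 1 < s.re → L s = LSeries logZetaCoeff s + Complex.log (s - 1) + c := by
  set E : ℂ → ℂ := fun s => L s - LSeries logZetaCoeff s - Complex.log (s - 1) with hE
  have hd : ∀ s : ℂ, 1 < s.re → HasDerivAt E 0 s := by
    intro s hs
    have hs1 : s ≠ 1 := by rintro rfl; simp at hs
    have hz : riemannZeta s ≠ 0 := riemannZeta_ne_zero_of_one_le_re hs.le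
    have hs1' := sub_ne_zero.2 hs1
    have h1 := ((hL.hasDerivAt (s := s) (by linarith)).sub (hasDerivAt_LSeries_logZetaCoeff hs)).sub
      (((hasDerivAt_id s).sub_const 1).clog (sub_one_mem_slitPlane hs))
    convert! h1 using 1
    have h2 : deriv riemannZeta₁ s = riemannZeta s + (s - 1) * deriv riemannZeta s := by
      have h3 : riemannZeta₁ =ᶠ[𝓝 s] fun z => (z - 1) * riemannZeta z := by
        filter_upwards [isOpen_ne.mem_nhds hs1] with z hz using riemannZeta₁_eq hz
      rw [h3.deriv_eq]
      have := ((hasDerivAt_id s).sub_const 1).mul (differentiableAt_riemannZeta hs1).hasDerivAt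
      exact this.deriv.trans (by simp)
    rw [h2, riemannZeta₁_eq hs1, id]
    field_simp
    ring
  have h2 : (1:ℝ) < (2:ℂ).re := by norm_num
  have hc : ∀ s : ℂ, 1 < s.re → E s = E 2 := fun s hs =>
    (isOpen_re_gt 1).is_const_of_deriv_eq_zero (convex_halfSpace_re_gt 1).isPreconnected
      (fun z hz => (hd z hz).differentiableAt.differentiableWithinAt)
      (fun z hz => (hd z hz).deriv) hs h2
  refine ⟨(E 2).re, fun s hs => ?_⟩
  have him : (E 2).im = 0 := by
    simp only [hE, Complex.sub_im, hL.im_two, im_LSeries_logZetaCoeff_two]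
    norm_num
  have : ((E 2).re : ℂ) = E 2 := Complex.ext (by simp) (by simp [him])
  rw [this, ← hc s hs, hE]; ring

theorem norm_term_logZetaCoeff_le {s : ℂ} (hs : 2 ≤ s.re) (n : ℕ) :
    ‖LSeries.term logZetaCoeff s n‖ ≤ (n : ℝ) ^ (-2 : ℝ) := by
  rw [LSeries.norm_term_eq]
  split_ifs with h
  · positivity
  · rw [Real.rpow_neg (by positivity), div_eq_mul_inv]
    have h1 : (1:ℝ) ≤ n := by exact_mod_cast Nat.one_le_iff_ne_zero.2 h
    have : (n : ℝ) ^ (2:ℝ) ≤ (n : ℝ) ^ s.re := Real.rpow_le_rpow_of_exponent_le h1 hs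
    calc _ ≤ 1 * ((n : ℝ) ^ (2:ℝ))⁻¹ := by
          gcongr
          exact norm_logZetaCoeff_le n
      _ = _ := one_mul _

theorem summable_rpow_neg_two : Summable fun n : ℕ => (n : ℝ) ^ (-2 : ℝ) :=
  Real.summable_nat_rpow.2 (by norm_num)

theorem norm_LSeries_logZetaCoeff_le {s : ℂ} (hs : 2 ≤ s.re) :
    ‖LSeries logZetaCoeff s‖ ≤ ∑' n : ℕ, (n : ℝ) ^ (-2 : ℝ) :=
  tsum_of_norm_bounded summable_rpow_neg_two.hasSum (norm_term_logZetaCoeff_le hs)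

theorem norm_log_one_add_mul_I_le (τ : ℝ) : ‖Complex.log (1 + τ * Complex.I)‖ ≤ 4 + |τ| := by
  have h1 : 1 ≤ ‖(1 + τ * Complex.I : ℂ)‖ := by
    have := Complex.abs_re_le_norm (1 + τ * Complex.I); simpa using this
  have h2 : ‖(1 + τ * Complex.I : ℂ)‖ ≤ 1 + |τ| := by
    refine (norm_add_le _ _).trans ?_; simp
  have h3 : ‖Complex.log (1 + τ * Complex.I)‖ ≤ |(Complex.log (1 + τ * Complex.I)).re| +
    |(Complex.log (1 + τ * Complex.I)).im| := Complex.norm_le_abs_re_add_abs_im _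
  rw [Complex.log_re, Complex.log_im, abs_of_nonneg (Real.log_nonneg h1)] at h3
  have h4 := Complex.abs_arg_le_pi (1 + τ * Complex.I)
  have h5 := Real.log_le_sub_one_of_pos (by linarith : 0 < ‖(1 + τ * Complex.I : ℂ)‖)
  linarith [Real.pi_lt_four]

/-- Borel–Carathéodory on the disc of radius 3/2 about 2 + iτ, where Re L is the logarithm of a
polynomially bounded modulus. Linear growth is crude but enough: the kernel's decay absorbs it, and
it gives order one in the Phragmén–Lindelöf argument. -/
theorem IsLogZeta.exists_norm_le {L : ℂ → ℂ} (hL : IsLogZeta L) {δ : ℝ} (hδ : 0 < δ) :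
    ∃ C : ℝ, ∀ s : ℂ, 1 / 2 + δ ≤ s.re → s.re ≤ 2 → ‖L s‖ ≤ C * (1 + |s.im|) := by
  obtain ⟨c, hc⟩ := hL.eq_LSeries
  obtain ⟨C₀, hC₀, hZ⟩ := exists_norm_riemannZeta₁_le
  set A := ∑' n : ℕ, (n : ℝ) ^ (-2 : ℝ)
  have hA : 0 ≤ A := tsum_nonneg fun n => by positivity
  refine ⟨2 * (C₀ + 10) * 2 / δ + (A + 4 + |c|) * 3 / δ, fun s hs hs2 => ?_⟩
  set τ := s.im
  have hcen : ‖L (2 + τ * Complex.I)‖ ≤ (A + 4 + |c|) * (1 + |τ|) := by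
    rw [hc _ (by simp)]
    have e : (2 + τ * Complex.I - 1 : ℂ) = 1 + τ * Complex.I := by ring
    rw [e]
    have h1 := norm_LSeries_logZetaCoeff_le (s := 2 + τ * Complex.I) (by simp)
    have h2 := norm_log_one_add_mul_I_le τ
    have h3 := norm_add₃_le (a := LSeries logZetaCoeff (2 + τ * Complex.I))
      (b := Complex.log (1 + τ * Complex.I)) (c := (c : ℂ))
    rw [Complex.norm_real, Real.norm_eq_abs] at h3
    nlinarith [abs_nonneg τ, abs_nonneg c]
  set M := (C₀ + 10) * (1 + |τ|)
  have hM : 0 < M := by positivity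
  have hball : ∀ z ∈ Metric.ball (0:ℂ) (3/2), 1 / 2 < (2 + τ * Complex.I + z).re := by
    intro z hz
    have : |z.re| < 3 / 2 := (Complex.abs_re_le_norm z).trans_lt (by simpa using hz)
    have := (abs_lt.1 this).1
    simp; linarith
  have hz : s - (2 + τ * Complex.I) = ((s.re - 2 : ℝ) : ℂ) := by
    apply Complex.ext <;> simp [τ]
  have hzn : ‖s - (2 + τ * Complex.I)‖ = 2 - s.re := by
    rw [hz, Complex.norm_real, Real.norm_eq_abs, abs_of_nonpos (by linarith)]; ring
  have hbc := Complex.borelCaratheodory (f := fun z => L (2 + τ * Complex.I + z)) (M := M)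
    (R := 3/2) (z := s - (2 + τ * Complex.I)) hM
    (fun z hz => ((hL.differentiableAt _ (hball z hz)).comp z
      (differentiableAt_id.const_add _)).differentiableWithinAt)
    (fun z hz => by
      have h1 := hball z hz
      simp only [Set.mem_ofPred_eq]
      rw [hL.log_norm h1]
      set w := 2 + τ * Complex.I + z
      have h2 := hZ w (by linarith)
      have h3 : ‖w‖ ≤ 4 + |τ| := by
        have hz' : ‖z‖ < 3 / 2 := by simpa using hz
        have := norm_add₃_le (a := (2:ℂ)) (b := τ * Complex.I) (c := z)
        simp at this
        linarith
      have h0 : 0 < ‖riemannZeta₁ w‖ := by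
        rw [← hL.exp_eq w h1]; exact norm_pos_iff.2 (Complex.exp_ne_zero _)
      have h4 := Real.log_le_log h0 h2
      rw [Real.log_mul (by positivity) (by positivity), Real.log_pow] at h4
      have h5 := Real.log_le_sub_one_of_pos (by linarith : 0 < C₀)
      have h6 := Real.log_le_sub_one_of_pos (by positivity : 0 < 1 + ‖w‖)
      push_cast at h4
      have : 0 ≤ (C₀ + 10) * |τ| := by positivity
      simp only [M]
      nlinarith [abs_nonneg τ])
    (by norm_num) (by rw [mem_ball_zero_iff, hzn]; linarith)
  rw [hzn, add_sub_cancel, add_zero] at hbc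
  refine hbc.trans ?_
  have hδ' : δ ≤ 3 / 2 - (2 - s.re) := by linarith
  have e1 : 2 * M * (2 - s.re) / (3 / 2 - (2 - s.re)) ≤ 2 * M * 2 / δ := by
    gcongr; linarith
  have e2 : ‖L (2 + τ * Complex.I)‖ * (3 / 2 + (2 - s.re)) / (3 / 2 - (2 - s.re)) ≤
      (A + 4 + |c|) * (1 + |τ|) * 3 / δ := by
    gcongr; linarith
  calc _ ≤ _ := add_le_add e1 e2
    _ = _ := by simp only [M]; ring

/-! ### Comparison of Gamma at z + h and z - h. -/

/-- Each increment of 1/2 log((N + 3)^2 + a^2) exceeds the corresponding summand by at most 5/2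
times a term bounded by 1/(N + 2) - 1/(N + 3). These errors telescope. -/
theorem sum_ge_log (a : ℝ) (N : ℕ) :
    1 / 2 * Real.log (((N : ℝ) + 3) ^ 2 + a ^ 2) - 1 / 2 * Real.log (9 + a ^ 2)
      - 5 / 2 * (1 / 2 - 1 / ((N : ℝ) + 2)) ≤
    ∑ j ∈ Finset.range N, ((j : ℝ) + 1) / (((j : ℝ) + 3) ^ 2 + a ^ 2) := by
  induction N with
  | zero => norm_num
  | succ N ih =>
    rw [Finset.sum_range_succ]
    have hN : (0:ℝ) ≤ N := N.cast_nonneg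
    set D := ((N : ℝ) + 3) ^ 2 + a ^ 2 with hD
    have hD0 : 0 < D := by positivity
    have hD1 : ((N : ℝ) + 3) ^ 2 ≤ D := by rw [hD]; nlinarith [sq_nonneg a]
    have h1 : Real.log (((N : ℝ) + 1 + 3) ^ 2 + a ^ 2) ≤ Real.log D + (2 * N + 7) / D := by
      have e : ((N : ℝ) + 1 + 3) ^ 2 + a ^ 2 = D * (1 + (2 * N + 7) / D) := by
        field_simp; rw [hD]; ring
      rw [e, Real.log_mul hD0.ne' (by positivity)]
      have := Real.log_le_sub_one_of_pos (by positivity : 0 < 1 + (2 * (N:ℝ) + 7) / D)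
      linarith
    have h2 : 1 / D ≤ 1 / ((N : ℝ) + 2) - 1 / ((N : ℝ) + 1 + 2) := by
      rw [div_sub_div _ _ (by positivity) (by positivity), div_le_div_iff₀ hD0 (by positivity)]
      nlinarith
    have h3 : (2 * (N:ℝ) + 7) / D = 2 * (((N:ℝ) + 1) / D) + 5 * (1 / D) := by ring
    push_cast
    linarith

/-- The squared moduli differ by 4h(Re z + j), a proportion of at least 4h(j + 1)/((j + 3)^2 + y^2)
of the larger one; then 1 - x ≤ e^{-x}. -/
theorem norm_sub_le_norm_add_mul_exp {z : ℂ} {h : ℝ} (hh : 0 < h) (hh' : h ≤ 1 / 2)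
    (hz1 : 1 ≤ z.re) (hz2 : z.re ≤ 2) (j : ℕ) :
    ‖z - h + j‖ ≤ ‖z + h + j‖ *
      Real.exp (-(2 * h * (((j : ℝ) + 1) / (((j : ℝ) + 3) ^ 2 + z.im ^ 2)))) := by
  have hj : (0:ℝ) ≤ j := j.cast_nonneg
  rw [← sq_le_sq₀ (norm_nonneg _) (by positivity), mul_pow, ← Real.exp_nat_mul,
    Complex.sq_norm, Complex.sq_norm, Complex.normSq_apply, Complex.normSq_apply]
  simp only [Complex.add_re, Complex.sub_re, Complex.ofReal_re, Complex.natCast_re, Complex.add_im,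
    Complex.sub_im, Complex.ofReal_im, Complex.natCast_im, sub_zero, add_zero]
  set x := z.re
  set y := z.im
  set P := (x + h + j) * (x + h + j) + y * y with hP
  have hP0 : 0 < P := by
    have := mul_pos (by linarith : 0 < x + h + j) (by linarith : 0 < x + h + j)
    have := mul_self_nonneg y
    linarith
  set D := ((j : ℝ) + 3) ^ 2 + y ^ 2 with hD
  have hPD : P ≤ D := by rw [hP, hD]; nlinarith
  have hD0 : 0 < D := by positivity
  have e1 : (x - h + j) * (x - h + j) + y * y = P - 4 * h * (x + j) := by rw [hP]; ring
  have e2 : P * (((j : ℝ) + 1) / D) ≤ x + j := by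
    rw [← mul_div_assoc, div_le_iff₀ hD0, mul_comm]
    exact mul_le_mul (by linarith) hPD hP0.le (by linarith)
  have e3 := Real.add_one_le_exp (((2 : ℕ) : ℝ) * (-(2 * h * (((j : ℝ) + 1) / D))))
  rw [e1]
  refine le_trans ?_ (mul_le_mul_of_nonneg_left e3 hP0.le)
  push_cast
  nlinarith

/-- The factors of the finite Gauss product are compared one at a time. The resulting sum is at
least log n - log(|y| + 2) - 2, and its log n cancels n^{2h}. This replaces Stirling's formula. -/
theorem norm_GammaSeq_le {z : ℂ} {h : ℝ} (hh : 0 < h) (hh' : h ≤ 1 / 2)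
    (hz1 : 1 ≤ z.re) (hz2 : z.re ≤ 2) {n : ℕ} (hn : n ≠ 0) :
    ‖Complex.GammaSeq (z + h) n‖ ≤ ‖Complex.GammaSeq (z - h) n‖ *
      Real.exp (2 * h * (Real.log (|z.im| + 2) + 2)) := by
  have hn0 : (0:ℝ) < n := by exact_mod_cast Nat.pos_of_ne_zero hn
  have hprod : ∏ j ∈ Finset.range (n + 1), ‖z - h + j‖ ≤
      (∏ j ∈ Finset.range (n + 1), ‖z + h + j‖) * Real.exp (-(2 * h * ∑ j ∈ Finset.range (n + 1),
        (((j : ℝ) + 1) / (((j : ℝ) + 3) ^ 2 + z.im ^ 2)))) := by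
    rw [Finset.mul_sum, ← Finset.sum_neg_distrib, Real.exp_sum, ← Finset.prod_mul_distrib]
    exact Finset.prod_le_prod (fun _ _ => norm_nonneg _)
      fun j _ => norm_sub_le_norm_add_mul_exp hh hh' hz1 hz2 j
  have hpos : ∀ w : ℂ, 0 < w.re → 0 < ∏ j ∈ Finset.range (n + 1), ‖w + j‖ := fun w hw =>
    Finset.prod_pos fun j _ => norm_pos_iff.2 fun h0 => by
      have := congrArg Complex.re h0
      simp at this
      have : (0:ℝ) ≤ j := j.cast_nonneg
      linarith
  have hp1 := hpos (z + h) (by simp; linarith)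
  have hp2 := hpos (z - h) (by simp; linarith)
  have hsum := sum_ge_log z.im (n + 1)
  set S := ∑ j ∈ Finset.range (n + 1), (((j : ℝ) + 1) / (((j : ℝ) + 3) ^ 2 + z.im ^ 2))
  have hS : Real.log n - Real.log (|z.im| + 2) - 2 ≤ S := by
    refine le_trans ?_ hsum
    push_cast
    have h1 : 2 * Real.log n ≤ Real.log (((n : ℝ) + 1 + 3) ^ 2 + z.im ^ 2) := by
      have : 2 * Real.log n = Real.log ((n : ℝ) ^ 2) := by rw [Real.log_pow]; norm_num
      rw [this]
      exact Real.log_le_log (by positivity) (by nlinarith [sq_nonneg z.im])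
    have h2 : Real.log (9 + z.im ^ 2) ≤ 2 * (Real.log (|z.im| + 2) + 1/2) + 1/2 := by
      have h3 : 9 + z.im ^ 2 ≤ (|z.im| + 2) ^ 2 * (9 / 4) := by
        rw [← sq_abs]; nlinarith [abs_nonneg z.im]
      have h4 := Real.log_le_log (by positivity) h3
      rw [Real.log_mul (by positivity) (by norm_num), Real.log_pow] at h4
      have h5 := Real.log_le_sub_one_of_pos (by norm_num : (0:ℝ) < 9 / 4)
      push_cast at h4
      linarith
    have h6 : 0 < 1 / ((n : ℝ) + 1 + 2) := by positivity
    linarith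
  simp only [Complex.GammaSeq, norm_div, norm_mul, norm_prod]
  have e1 : ∀ w : ℂ, ‖(n : ℂ) ^ w‖ = (n : ℝ) ^ w.re := fun w => by
    rw [← Complex.ofReal_natCast, Complex.norm_cpow_eq_rpow_re_of_pos hn0]
  rw [e1, e1, div_mul_eq_mul_div, div_le_div_iff₀ hp1 hp2]
  have e2 : (n : ℝ) ^ (z + h).re = (n : ℝ) ^ (z - h).re * Real.exp (2 * h * Real.log n) := by
    rw [Real.rpow_def_of_pos hn0, Real.rpow_def_of_pos hn0, ← Real.exp_add]
    congr 1; simp; ring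
  rw [e2]
  have e3 : Real.exp (2 * h * Real.log n) * Real.exp (-(2 * h * S)) ≤
      Real.exp (2 * h * (Real.log (|z.im| + 2) + 2)) := by
    rw [← Real.exp_add, Real.exp_le_exp]
    nlinarith
  calc (n : ℝ) ^ (z - h).re * Real.exp (2 * h * Real.log n) * ‖(n.factorial : ℂ)‖ *
        ∏ j ∈ Finset.range (n + 1), ‖z - h + j‖
      ≤ (n : ℝ) ^ (z - h).re * Real.exp (2 * h * Real.log n) * ‖(n.factorial : ℂ)‖ *
        ((∏ j ∈ Finset.range (n + 1), ‖z + h + j‖) * Real.exp (-(2 * h * S))) := by gcongr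
    _ = (n : ℝ) ^ (z - h).re * ‖(n.factorial : ℂ)‖ * (Real.exp (2 * h * Real.log n) *
          Real.exp (-(2 * h * S))) * ∏ j ∈ Finset.range (n + 1), ‖z + h + j‖ := by ring
    _ ≤ _ := by gcongr

theorem norm_Gamma_add_le {z : ℂ} {h : ℝ} (hh : 0 < h) (hh' : h ≤ 1 / 2)
    (hz1 : 1 ≤ z.re) (hz2 : z.re ≤ 2) :
    ‖Complex.Gamma (z + h)‖ ≤ ‖Complex.Gamma (z - h)‖ *
      Real.exp (2 * h * (Real.log (|z.im| + 2) + 2)) :=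
  le_of_tendsto_of_tendsto (Complex.GammaSeq_tendsto_Gamma _).norm
    ((Complex.GammaSeq_tendsto_Gamma _).norm.mul_const _)
    ((eventually_ne_atTop 0).mono fun _ hn => norm_GammaSeq_le hh hh' hz1 hz2 hn)

/-! ### Growth of ξ away from the critical line and the slope bound. -/

/-- Half of the completed zeta function times `w (w - 1)`. -/
noncomputable def xiHalf (w : ℂ) : ℂ :=
  (Real.pi : ℂ) ^ (-w / 2) * Complex.Gamma (w / 2 + 1) * riemannZeta₁ w

theorem xiHalf_eq {w : ℂ} (hw : 0 < w.re) (hw1 : w ≠ 1) :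
    xiHalf w = w * (w - 1) / 2 * completedRiemannZeta w := by
  have h0 : w ≠ 0 := by rintro rfl; simp at hw
  have hG := Complex.Gammaℝ_ne_zero_of_re_pos hw
  rw [xiHalf, riemannZeta₁_eq hw1, riemannZeta_def_of_ne_zero h0,
    Complex.Gamma_add_one _ (div_ne_zero h0 two_ne_zero)]
  have := Complex.Gammaℝ_def w
  field_simp
  rw [this]
  ring_nf

theorem norm_completedRiemannZeta_conj {w : ℂ} (hw : 0 < w.re) :
    ‖completedRiemannZeta (starRingEnd ℂ w)‖ = ‖completedRiemannZeta w‖ := by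
  have key : ∀ w : ℂ, 0 < w.re → ‖completedRiemannZeta w‖ =
      ‖riemannZeta w‖ * (Real.pi ^ (-w.re / 2) * ‖Complex.Gamma (w / 2)‖) := by
    intro w hw
    have h0 : w ≠ 0 := by rintro rfl; simp at hw
    have hG := Complex.Gammaℝ_ne_zero_of_re_pos hw
    have h1 : completedRiemannZeta w = riemannZeta w * w.Gammaℝ := by
      rw [riemannZeta_def_of_ne_zero h0, div_mul_cancel₀ _ hG]
    rw [h1, norm_mul, Complex.Gammaℝ_def, norm_mul,
      Complex.norm_cpow_eq_rpow_re_of_pos Real.pi_pos]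
    simp
  rw [key _ (by simpa using hw), key _ hw, riemannZeta_conj, RCLike.norm_conj, Complex.conj_re]
  have h2 : starRingEnd ℂ 2 = 2 := map_ofNat _ 2
  have : starRingEnd ℂ w / 2 = starRingEnd ℂ (w / 2) := by rw [map_div₀, h2]
  rw [this, Complex.Gamma_conj, RCLike.norm_conj]

/-- The functional equation combined with complex conjugation gives reflection in the critical line.
-/
theorem norm_xiHalf_reflect {w : ℂ} (h0 : 0 < w.re) (h1 : w.re < 1) :
    ‖xiHalf (1 - starRingEnd ℂ w)‖ = ‖xiHalf w‖ := by
  have hw1 : w ≠ 1 := by rintro rfl; simp at h1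
  have hw0 : w ≠ 0 := by rintro rfl; simp at h0
  rw [xiHalf_eq h0 hw1, xiHalf_eq (by simpa using h1) (by simpa using hw0), norm_mul, norm_mul,
    completedRiemannZeta_one_sub, norm_completedRiemannZeta_conj h0]
  congr 1
  have h2 : starRingEnd ℂ 2 = 2 := map_ofNat _ 2
  have : (1 - starRingEnd ℂ w) * (1 - starRingEnd ℂ w - 1) / 2 =
    starRingEnd ℂ (w * (w - 1) / 2) := by
    rw [map_div₀, h2]; simp; ring
  rw [this, RCLike.norm_conj]

theorem norm_betaIntegral_le {u : ℂ} {h : ℝ} (hu : 1 ≤ u.re) (hh : 0 < h) :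
    ‖Complex.betaIntegral u h‖ ≤ ∫ x in (0:ℝ)..1, (1 - x) ^ (h - 1) := by
  have hint : IntervalIntegrable (fun x : ℝ => (1 - x) ^ (h - 1)) MeasureTheory.volume 0 1 := by
    have := (intervalIntegral.intervalIntegrable_rpow' (a := 0) (b := 1) (r := h - 1)
      (by linarith)).comp_sub_left 1
    simpa using this.symm
  refine intervalIntegral.norm_integral_le_of_norm_le zero_le_one ?_ hint
  filter_upwards [MeasureTheory.Measure.ae_ne MeasureTheory.volume 1] with x hx1 hx
  have hx' : 0 < 1 - x := by
    have := lt_of_le_of_ne hx.2 hx1; linarith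
  have e : (1 - x : ℂ) = ((1 - x : ℝ) : ℂ) := by push_cast; rfl
  rw [norm_mul, e, Complex.norm_cpow_eq_rpow_re_of_pos hx.1,
    Complex.norm_cpow_eq_rpow_re_of_pos hx']
  have h1 : x ^ (u - 1).re ≤ 1 := Real.rpow_le_one hx.1.le hx.2 (by simpa using hu)
  have h2 : ((h : ℂ) - 1).re = h - 1 := by simp
  rw [h2]
  exact mul_le_of_le_one_left (by positivity) h1

/-- The quotient is B(u, h)/Γ(h), and the beta integral is bounded for Re u ≥ 1. Hence the
ξ-quotient grows no faster than the corresponding quotient of (s - 1)ζ(s). -/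
theorem exists_norm_Gamma_div_le {h : ℝ} (hh : 0 < h) :
    ∃ B : ℝ, 0 ≤ B ∧ ∀ u : ℂ, 1 ≤ u.re → ‖Complex.Gamma u / Complex.Gamma (u + h)‖ ≤ B := by
  have hG : 0 < ‖Complex.Gamma h‖ :=
    norm_pos_iff.2 (Complex.Gamma_ne_zero_of_re_pos (by simpa using hh))
  set B := ‖Complex.Gamma h‖⁻¹ * ∫ x in (0:ℝ)..1, (1 - x) ^ (h - 1)
  have key : ∀ u : ℂ, 1 ≤ u.re → ‖Complex.Gamma u / Complex.Gamma (u + h)‖ ≤ B := by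
    intro u hu
    have h1 := Complex.Gamma_mul_Gamma_eq_betaIntegral (s := u) (t := h) (by linarith)
      (by simpa using hh)
    have h2 : Complex.Gamma (u + h) ≠ 0 :=
      Complex.Gamma_ne_zero_of_re_pos (by simp; linarith)
    have h3 : Complex.Gamma u / Complex.Gamma (u + h) =
        (Complex.Gamma h)⁻¹ * Complex.betaIntegral u h := by
      field_simp [norm_pos_iff.1 hG]
      exact h1
    rw [h3, norm_mul, norm_inv]
    exact mul_le_mul_of_nonneg_left (norm_betaIntegral_le hu hh) (by positivity)
  exact ⟨B, (norm_nonneg _).trans (key 1 (by simp)), key⟩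

theorem IsLogZeta.norm_riemannZeta₁_of_two_le {L : ℂ → ℂ} (hL : IsLogZeta L) :
    ∃ A : ℝ, 1 ≤ A ∧ ∀ w : ℂ, 2 ≤ w.re →
      ‖riemannZeta₁ w‖ ≤ A * ‖w - 1‖ ∧ ‖w - 1‖ ≤ A * ‖riemannZeta₁ w‖ := by
  obtain ⟨c, hc⟩ := hL.eq_LSeries
  set A := ∑' n : ℕ, (n : ℝ) ^ (-2 : ℝ)
  have hA : 0 ≤ A := tsum_nonneg fun n => by positivity
  refine ⟨Real.exp (A + |c|), Real.one_le_exp (by positivity), fun w hw => ?_⟩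
  have hw1 : w - 1 ≠ 0 := sub_ne_zero.2 (by rintro rfl; norm_num at hw)
  have h1 : ‖riemannZeta₁ w‖ = Real.exp ((LSeries logZetaCoeff w).re + c) * ‖w - 1‖ := by
    rw [← hL.exp_eq w (by linarith), hc w (by linarith), Complex.norm_exp]
    simp only [Complex.add_re, Complex.log_re, Complex.ofReal_re]
    rw [add_right_comm, Real.exp_add, Real.exp_log (norm_pos_iff.2 hw1)]
  have h2 := abs_le.1 ((Complex.abs_re_le_norm _).trans (norm_LSeries_logZetaCoeff_le hw))
  have h3 := neg_abs_le c
  have h4 := le_abs_self c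
  rw [h1]
  constructor
  · gcongr; linarith [h2.2]
  · rw [← mul_assoc, ← Real.exp_add]
    refine le_mul_of_one_le_left (norm_nonneg _) (Real.one_le_exp ?_)
    linarith [h2.1]

/-- Controls the denominator of the ξ-quotient: up to Re w = 2 by the linear growth of L, beyond it
by the Dirichlet series. -/
theorem IsLogZeta.exists_inv_norm_le {L : ℂ → ℂ} (hL : IsLogZeta L) {h : ℝ} (hh : 0 < h) :
    ∃ C : ℝ, 0 ≤ C ∧ ∀ w : ℂ, 1 / 2 + h ≤ w.re → ‖riemannZeta₁ w‖⁻¹ ≤ C * Real.exp (C * ‖w‖) := by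
  obtain ⟨C₁, hC₁⟩ := hL.exists_norm_le hh
  obtain ⟨A, hA1, hA⟩ := hL.norm_riemannZeta₁_of_two_le
  set C := |C₁| + Real.exp |C₁| + A
  have hC0 : 0 ≤ C := by positivity
  refine ⟨C, hC0, fun w hw => ?_⟩
  have h1 : 1 ≤ Real.exp (C * ‖w‖) := Real.one_le_exp (by positivity)
  rcases le_total w.re 2 with h2 | h2
  · rw [← hL.exp_eq w (by linarith), Complex.norm_exp, ← Real.exp_neg]
    have h3 : -(L w).re ≤ |C₁| * (1 + ‖w‖) := by
      refine (neg_le_abs _).trans ((Complex.abs_re_le_norm _).trans ((hC₁ w hw h2).trans ?_))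
      have := Complex.abs_im_le_norm w
      have := le_abs_self C₁
      gcongr
    calc _ ≤ Real.exp (|C₁| * (1 + ‖w‖)) := Real.exp_le_exp.2 h3
      _ = Real.exp |C₁| * Real.exp (|C₁| * ‖w‖) := by rw [← Real.exp_add]; ring_nf
      _ ≤ C * Real.exp (C * ‖w‖) := by
        have e1 : |C₁| ≤ C := by simp only [C]; linarith [Real.exp_pos |C₁|]
        have e2 : Real.exp |C₁| ≤ C := by simp only [C]; linarith [abs_nonneg C₁]
        gcongr
  · have h3 := (hA w h2).2
    have h4 : 1 ≤ ‖w - 1‖ := by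
      have := Complex.abs_re_le_norm (w - 1)
      have := le_abs_self (w - 1).re
      simp at *; linarith
    have h5 : 0 < ‖riemannZeta₁ w‖ := by
      by_contra h
      have := le_antisymm (not_lt.1 h) (norm_nonneg _)
      rw [this] at h3; linarith
    calc ‖riemannZeta₁ w‖⁻¹ ≤ A := by
          rw [inv_le_iff_one_le_mul₀ h5]; linarith
      _ ≤ C := by simp only [C]; linarith [Real.exp_pos |C₁|, abs_nonneg C₁]
      _ ≤ _ := le_mul_of_one_le_right hC0 h1

theorem IsLogZeta.xiHalf_ne_zero {L : ℂ → ℂ} (hL : IsLogZeta L) {w : ℂ} (hw : 1 / 2 < w.re) :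
    xiHalf w ≠ 0 := by
  refine mul_ne_zero (mul_ne_zero ?_ (Complex.Gamma_ne_zero_of_re_pos (by simp; linarith))) ?_
  · rw [Complex.cpow_ne_zero_iff]; left; exact_mod_cast Real.pi_ne_zero
  · rw [← hL.exp_eq w hw]; exact Complex.exp_ne_zero _

theorem differentiableAt_xiHalf {w : ℂ} (hw : 0 < w.re) : DifferentiableAt ℂ xiHalf w := by
  have h1 : DifferentiableAt ℂ (fun w : ℂ => (Real.pi : ℂ) ^ (-w / 2)) w :=
    (differentiableAt_id.neg.div_const 2).const_cpow
      (Or.inl (by exact_mod_cast Real.pi_ne_zero))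
  have h2 : DifferentiableAt ℂ (fun w : ℂ => Complex.Gamma (w / 2 + 1)) w := by
    refine DifferentiableAt.comp (g := Complex.Gamma) w (Complex.differentiableAt_Gamma _ ?_)
      ((differentiableAt_id.div_const 2).add_const 1)
    intro m hm
    have := congrArg Complex.re hm
    simp at this
    have hm0 : (0:ℝ) ≤ m := m.cast_nonneg
    linarith
  exact (h1.mul h2).mul (differentiable_riemannZeta₁ w)

theorem norm_xiHalf_div_le {h : ℝ} (hh : 0 < h) :
    ∃ B : ℝ, 0 ≤ B ∧ ∀ s : ℂ, 1 / 2 ≤ s.re → h ≤ 1 / 4 →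
      ‖xiHalf (s - h) / xiHalf (s + h)‖ ≤ B * (‖riemannZeta₁ (s - h)‖ * ‖riemannZeta₁ (s + h)‖⁻¹) := by
  obtain ⟨B, hB0, hB⟩ := exists_norm_Gamma_div_le hh
  refine ⟨Real.pi ^ h * B, by positivity, fun s hs hh' => ?_⟩
  have h1 := hB ((s - h) / 2 + 1) (by simp; linarith)
  rw [show (s - h) / 2 + 1 + (h : ℂ) = (s + h) / 2 + 1 by ring, norm_div] at h1
  simp only [xiHalf, norm_div, norm_mul]
  rw [Complex.norm_cpow_eq_rpow_re_of_pos Real.pi_pos, Complex.norm_cpow_eq_rpow_re_of_pos Real.pi_pos]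
  have h2 : Real.pi ^ (-(s - h) / 2).re = Real.pi ^ h * Real.pi ^ (-(s + h) / 2).re := by
    rw [← Real.rpow_add Real.pi_pos]; congr 1; simp; ring
  rw [h2]
  have h3 : 0 < Real.pi ^ (-(s + h) / 2).re := Real.rpow_pos_of_pos Real.pi_pos _
  calc _ = Real.pi ^ h * (‖Complex.Gamma ((s - h) / 2 + 1)‖ / ‖Complex.Gamma ((s + h) / 2 + 1)‖) *
        (‖riemannZeta₁ (s - h)‖ * ‖riemannZeta₁ (s + h)‖⁻¹) := by
        field_simp
    _ ≤ _ := by gcongr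

/-- On the Riemann hypothesis the completed zeta function grows away from the critical line. -/
theorem IsLogZeta.norm_xiHalf_le {L : ℂ → ℂ} (hL : IsLogZeta L) {h : ℝ} (hh : 0 < h)
    (hh' : h ≤ 1 / 4) {s : ℂ} (hs : 1 / 2 ≤ s.re) : ‖xiHalf (s - h)‖ ≤ ‖xiHalf (s + h)‖ := by
  obtain ⟨B, hB0, hB⟩ := norm_xiHalf_div_le hh
  obtain ⟨C₀, hC₀, hZ⟩ := exists_norm_riemannZeta₁_le
  obtain ⟨C, hC0, hC⟩ := hL.exists_inv_norm_le hh
  obtain ⟨A, hA1, hA⟩ := hL.norm_riemannZeta₁_of_two_le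
  set f : ℂ → ℂ := fun z => xiHalf (z + 1/2 - h) / xiHalf (z + 1/2 + h) with hf
  have hre : ∀ z : ℂ, (z + 1 / 2).re = z.re + 1 / 2 := fun z => by simp
  have hd : DiffContOnCl ℂ f {z | 0 < z.re} := by
    refine DifferentiableOn.diffContOnCl fun z hz => DifferentiableAt.differentiableWithinAt ?_
    have hz0 : 0 ≤ z.re := by
      rwa [Complex.closure_setOfPred_lt_re] at hz
    refine DifferentiableAt.div ?_ ?_ (hL.xiHalf_ne_zero (by simp; linarith))
    · exact DifferentiableAt.comp (g := xiHalf) z (differentiableAt_xiHalf (by simp; linarith))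
        ((differentiableAt_id.add_const _).sub_const _)
    · exact DifferentiableAt.comp (g := xiHalf) z (differentiableAt_xiHalf (by simp; linarith))
        ((differentiableAt_id.add_const _).add_const _)
  -- The quotient has no poles because RH keeps the zeros of the denominator out of the closed
  -- half-plane. It is of exponential growth of order one, bounded on the positive real axis, and of
  -- modulus one on the imaginary axis by reflection. Hence its modulus is at most one throughout.
  have key := PhragmenLindelof.right_half_plane_of_bounded_on_real (f := f) (C := 1)
    (z := s - 1/2) hd ?_ ?_ ?_ (by simp; linarith)
  · simp only [hf, sub_add_cancel, norm_div] at key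
    rwa [div_le_one (norm_pos_iff.2 (hL.xiHalf_ne_zero (by simp; linarith)))] at key
  · refine ⟨1, by norm_num, C + 2, Asymptotics.IsBigO.of_bound
      (B * (C₀ * Real.exp 2 * (C * Real.exp C))) ?_⟩
    refine eventually_inf_principal.2 (Eventually.of_forall fun z (hz : 0 < z.re) => ?_)
    have hs : 1 / 2 ≤ (z + 1/2).re := by rw [hre]; linarith
    refine (hB (z + 1/2) hs hh').trans ?_
    have hhn : ‖(h : ℂ)‖ = h := by rw [Complex.norm_real, Real.norm_of_nonneg hh.le]
    have hhalf : ‖(1 / 2 : ℂ)‖ = 1 / 2 := by norm_num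
    have n1 : ‖z + 1/2 - h‖ ≤ ‖z‖ + 1 := by
      have := norm_sub_le (z + 1/2) h
      have := norm_add_le z (1/2)
      linarith
    have n2 : ‖z + 1/2 + h‖ ≤ ‖z‖ + 1 := by
      have := norm_add_le (z + 1/2) h
      have := norm_add_le z (1/2)
      linarith
    have b1 : ‖riemannZeta₁ (z + 1/2 - h)‖ ≤ C₀ * Real.exp 2 * Real.exp (2 * ‖z‖) := by
      refine (hZ _ (by simp; linarith)).trans ?_
      rw [mul_assoc, ← Real.exp_add]
      refine mul_le_mul_of_nonneg_left ?_ (by linarith)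
      have := Real.add_one_le_exp (‖z‖ + 1)
      calc (1 + ‖z + 1/2 - h‖) ^ 2 ≤ Real.exp (‖z‖ + 1) ^ 2 := by
            refine pow_le_pow_left₀ (by positivity) (by linarith) 2
        _ = _ := by rw [← Real.exp_nat_mul]; push_cast; ring_nf
    have b2 : ‖riemannZeta₁ (z + 1/2 + h)‖⁻¹ ≤ C * Real.exp C * Real.exp (C * ‖z‖) := by
      refine (hC _ (by simp; linarith)).trans ?_
      rw [mul_assoc, ← Real.exp_add]
      refine mul_le_mul_of_nonneg_left (Real.exp_le_exp.2 ?_) hC0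
      nlinarith
    rw [Real.rpow_one, Real.norm_of_nonneg (Real.exp_nonneg _), add_mul, Real.exp_add]
    calc _ ≤ B * ((C₀ * Real.exp 2 * Real.exp (2 * ‖z‖)) * (C * Real.exp C * Real.exp (C * ‖z‖))) := by
          gcongr
      _ = _ := by ring
  · refine ⟨B * (A * A), ?_⟩
    rw [eventually_map]
    filter_upwards [eventually_ge_atTop (2:ℝ)] with x hx
    have hs : 1 / 2 ≤ ((x : ℂ) + 1/2).re := by rw [hre, Complex.ofReal_re]; linarith
    refine (hB _ hs hh').trans (mul_le_mul_of_nonneg_left ?_ hB0)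
    have h1 := (hA (x + 1/2 - h) (by simp; linarith)).1
    have h2 := (hA (x + 1/2 + h) (by simp; linarith)).2
    have e1 : ‖(x + 1/2 - h - 1 : ℂ)‖ = x - 1/2 - h := by
      have : (x + 1/2 - h - 1 : ℂ) = ((x - 1/2 - h : ℝ) : ℂ) := by push_cast; ring
      rw [this, Complex.norm_real, Real.norm_of_nonneg (by linarith)]
    have e2 : ‖(x + 1/2 + h - 1 : ℂ)‖ = x - 1/2 + h := by
      have : (x + 1/2 + h - 1 : ℂ) = ((x - 1/2 + h : ℝ) : ℂ) := by push_cast; ring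
      rw [this, Complex.norm_real, Real.norm_of_nonneg (by linarith)]
    rw [e1] at h1
    rw [e2] at h2
    have h3 : 0 < ‖riemannZeta₁ (x + 1/2 + h)‖ := by
      rcases (norm_nonneg (riemannZeta₁ (x + 1/2 + h))).eq_or_lt with h | h
      · rw [← h] at h2; linarith
      · exact h
    rw [← div_eq_mul_inv, div_le_iff₀ h3]
    nlinarith
  · intro x
    have e : (x * Complex.I + 1/2 - h : ℂ) = 1 - starRingEnd ℂ (x * Complex.I + 1/2 + h) := by
      apply Complex.ext
      · simp; ring
      · simp
    rw [hf]
    simp only [norm_div]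
    rw [e, norm_xiHalf_reflect (by simp; linarith) (by simp; linarith)]
    exact div_self_le_one _

/-- Logarithms of the ξ-inequality. The Gamma factors have argument (s ± h)/2 + 1, so their
comparison is used with step h/2, which is the origin of the coefficient 1/2 in the slope; the power
of π has the favourable sign. -/
theorem IsLogZeta.re_sub_re_ge {L : ℂ → ℂ} (hL : IsLogZeta L) {h : ℝ} (hh : 0 < h)
    (hh' : h ≤ 1 / 4) {s : ℂ} (hs : 1 / 2 + h < s.re) (hs1 : s.re ≤ 1) :
    -(h * (Real.log (|s.im| + 2) + 2)) ≤ (L (s + h)).re - (L (s - h)).re := by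
  have h1 := hL.norm_xiHalf_le hh hh' (s := s) (by linarith)
  have p1 : 1 / 2 < (s + h).re := by simp; linarith
  have p2 : 1 / 2 < (s - h).re := by simp; linarith
  have hG : ∀ w : ℂ, 0 < w.re → 0 < ‖Complex.Gamma (w / 2 + 1)‖ := fun w hw =>
    norm_pos_iff.2 (Complex.Gamma_ne_zero_of_re_pos (by simp; linarith))
  have hlog : ∀ w : ℂ, 1 / 2 < w.re → Real.log ‖xiHalf w‖ =
      (-w.re / 2) * Real.log Real.pi + Real.log ‖Complex.Gamma (w / 2 + 1)‖ + (L w).re := by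
    intro w hw
    have hz : 0 < ‖riemannZeta₁ w‖ := by
      rw [← hL.exp_eq w hw]; exact norm_pos_iff.2 (Complex.exp_ne_zero _)
    have hp : 0 < Real.pi ^ (-w / 2).re := Real.rpow_pos_of_pos Real.pi_pos _
    rw [xiHalf, norm_mul, norm_mul, Complex.norm_cpow_eq_rpow_re_of_pos Real.pi_pos, hL.log_norm hw,
      Real.log_mul (mul_ne_zero hp.ne' (hG w (by linarith)).ne') hz.ne',
      Real.log_mul hp.ne' (hG w (by linarith)).ne', Real.log_rpow Real.pi_pos]
    congr 3; simp
  have h2 := Real.log_le_log (norm_pos_iff.2 (hL.xiHalf_ne_zero p2)) h1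
  rw [hlog _ p1, hlog _ p2] at h2
  have h3 := norm_Gamma_add_le (z := s / 2 + 1) (h := h / 2) (by linarith) (by linarith)
    (by simp; linarith) (by simp; linarith)
  have e1 : s / 2 + 1 + ((h / 2 : ℝ) : ℂ) = (s + h) / 2 + 1 := by push_cast; ring
  have e2 : s / 2 + 1 - ((h / 2 : ℝ) : ℂ) = (s - h) / 2 + 1 := by push_cast; ring
  have e3 : (s / 2 + 1).im = s.im / 2 := by simp
  rw [e1, e2, e3] at h3
  have h4 := Real.log_le_log (hG _ (by linarith)) h3
  rw [Real.log_mul (hG _ (by linarith)).ne' (Real.exp_ne_zero _), Real.log_exp] at h4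
  have h5 : Real.log (|s.im / 2| + 2) ≤ Real.log (|s.im| + 2) := by
    refine Real.log_le_log (by positivity) ?_
    rw [abs_div, abs_two]; linarith [abs_nonneg s.im]
  have h6 : 0 < Real.log Real.pi := Real.log_pos (by linarith [Real.pi_gt_three])
  simp only [Complex.add_re, Complex.sub_re, Complex.ofReal_re] at h2
  nlinarith

/-- The preceding inequality divided by 2h, as h → 0. Since Re L' is the derivative of Im L along a
vertical line, this is the one-sided slope bound. -/
theorem IsLogZeta.re_deriv_ge {L : ℂ → ℂ} (hL : IsLogZeta L) {s : ℂ} (hs : 1 / 2 < s.re)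
    (hs1 : s.re ≤ 1) : -(1 / 2 * Real.log (|s.im| + 2) + 1) ≤ (deriv L s).re := by
  have hd := (hL.differentiableAt s hs).hasDerivAt
  have h1 : HasDerivAt (fun h : ℝ => L (s + h)) (deriv L s) 0 := by
    have : HasDerivAt (fun h : ℂ => L (s + h)) (deriv L s) ((0 : ℝ) : ℂ) := by
      have := HasDerivAt.comp_const_add (f := L) (f' := deriv L s) s ((0 : ℝ) : ℂ) (by simpa using hd)
      exact this
    exact this.comp_ofReal
  have h2 : HasDerivAt (fun h : ℝ => L (s - h)) (-deriv L s) 0 := by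
    have : HasDerivAt (fun h : ℂ => L (s - h)) (-deriv L s) ((0 : ℝ) : ℂ) := by
      have := HasDerivAt.comp_const_sub (f := L) (f' := deriv L s) s ((0 : ℝ) : ℂ) (by simpa using hd)
      exact this
    exact this.comp_ofReal
  have h3 : HasDerivAt (fun h : ℝ => (L (s + h) - L (s - h)).re) (deriv L s - -deriv L s).re 0 :=
    Complex.reCLM.hasFDerivAt.comp_hasDerivAt (0:ℝ) (h1.sub h2)
  have h4 := (h3.tendsto_slope_zero).mono_left (nhdsGT_le_nhdsNE (0:ℝ))
  have h5 : -(Real.log (|s.im| + 2) + 2) ≤ (deriv L s - -deriv L s).re := by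
    refine ge_of_tendsto h4 ?_
    have hmem : Set.Ioo 0 (min (1/4) (s.re - 1/2)) ∈ 𝓝[>] (0:ℝ) :=
      Ioo_mem_nhdsGT (lt_min (by norm_num) (by linarith))
    filter_upwards [hmem] with h hh
    have := hL.re_sub_re_ge hh.1 (hh.2.le.trans (min_le_left _ _)) (s := s)
      (by linarith [hh.2.trans_le (min_le_right _ _)]) hs1
    simp only [zero_add, Complex.ofReal_zero, add_zero, sub_zero, sub_self, Complex.zero_re,
      smul_eq_mul, Complex.sub_re]
    rw [inv_mul_eq_div, le_div_iff₀ hh.1]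
    linarith
  simp only [sub_neg_eq_add, Complex.add_re] at h5
  linarith

/-! ### Integrals over vertical lines. -/

theorem integral_inv_one_add_sq_real : ∫ τ : ℝ, (1 + τ ^ 2)⁻¹ = Real.pi := integral_univ_inv_one_add_sq

open MeasureTheory in
theorem integrable_vertical {f : ℂ → ℂ} {a C : ℝ}
    (hd : ∀ s : ℂ, s.re = a → ContinuousAt f s)
    (hC : ∀ s : ℂ, s.re = a → ‖f s‖ ≤ C * (1 + s.im ^ 2)⁻¹) :
    Integrable fun τ : ℝ => f (a + τ * Complex.I) := by
  refine (integrable_inv_one_add_sq.const_mul C).mono' ?_ (ae_of_all _ fun τ => ?_)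
  · refine Continuous.aestronglyMeasurable (continuous_iff_continuousAt.2 fun τ => ?_)
    exact ContinuousAt.comp (f := fun τ : ℝ => (a + τ * Complex.I : ℂ)) (hd _ (by simp))
      (by fun_prop)
  · simpa using hC (a + τ * Complex.I) (by simp)

open MeasureTheory in
theorem norm_integral_vertical_le {f : ℂ → ℂ} {a C : ℝ}
    (hC : ∀ s : ℂ, s.re = a → ‖f s‖ ≤ C * (1 + s.im ^ 2)⁻¹) :
    ‖∫ τ : ℝ, f (a + τ * Complex.I)‖ ≤ C * Real.pi := by
  rw [← integral_inv_one_add_sq_real, ← integral_const_mul]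
  refine norm_integral_le_of_norm_le (integrable_inv_one_add_sq.const_mul C)
    (ae_of_all _ fun τ => ?_)
  simpa using hC (a + τ * Complex.I) (by simp)

open MeasureTheory in
/-- Moving a vertical line of integration. -/
theorem integral_vertical_eq {f : ℂ → ℂ} {a b C : ℝ} (hab : a ≤ b)
    (hd : ∀ s : ℂ, a ≤ s.re → s.re ≤ b → DifferentiableAt ℂ f s)
    (hC : ∀ s : ℂ, a ≤ s.re → s.re ≤ b → ‖f s‖ ≤ C * (1 + s.im ^ 2)⁻¹) :
    ∫ τ : ℝ, f (a + τ * Complex.I) = ∫ τ : ℝ, f (b + τ * Complex.I) := by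
  have ha := integrable_vertical (f := f) (a := a)
    (fun s hs => (hd s hs.ge (hs.le.trans hab)).continuousAt)
    (fun s hs => hC s hs.ge (hs.le.trans hab))
  have hb := integrable_vertical (f := f) (a := b)
    (fun s hs => (hd s (hab.trans hs.ge) hs.le).continuousAt)
    (fun s hs => hC s (hab.trans hs.ge) hs.le)
  have hrect : ∀ T : ℝ, (∫ y in (-T)..T, f (a + y * Complex.I)) =
      (∫ y in (-T)..T, f (b + y * Complex.I)) + (-Complex.I) *
        ((∫ x in a..b, f (x + ((-T : ℝ) : ℂ) * Complex.I)) - ∫ x in a..b, f (x + (T : ℂ) * Complex.I)) := by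
    intro T
    have h := Complex.integral_boundary_rect_eq_zero_of_differentiableOn f
      (a + ((-T : ℝ) : ℂ) * Complex.I) (b + (T : ℂ) * Complex.I) (fun s hs => by
        have h1 := hs.1
        simp only [Set.mem_preimage] at h1
        simp at h1
        rw [Set.uIcc_of_le hab] at h1
        exact (hd s h1.1 h1.2).differentiableWithinAt)
    simp only [Complex.add_re, Complex.ofReal_re, Complex.mul_re, Complex.I_re, mul_zero,
      Complex.ofReal_im, Complex.I_im, mul_one, sub_self, add_zero, Complex.add_im, Complex.mul_im,
      zero_add, smul_eq_mul] at h
    linear_combination Complex.I * h + ((∫ y in (-T)..T, f (a + y * Complex.I)) -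
      ∫ y in (-T)..T, f (b + y * Complex.I)) * Complex.I_sq
  -- The sign ε treats the top and bottom edges of the rectangle together; both integrals vanish in
  -- the limit.
  have hhor : ∀ ε : ℝ, |ε| = 1 → Tendsto
      (fun T : ℝ => ∫ x in a..b, f (x + ((ε * T : ℝ) : ℂ) * Complex.I)) atTop (𝓝 0) := by
    intro ε hε
    have h1 : Tendsto (fun T : ℝ => C * (1 + T ^ 2)⁻¹ * |b - a|) atTop (𝓝 0) := by
      have : Tendsto (fun T : ℝ => 1 + T ^ 2) atTop atTop :=
        tendsto_atTop_add_const_left _ _ (tendsto_pow_atTop two_ne_zero)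
      simpa using (this.inv_tendsto_atTop.const_mul C).mul_const |b - a|
    refine squeeze_zero_norm (fun T => ?_) h1
    refine intervalIntegral.norm_integral_le_of_norm_le_const fun x hx => ?_
    rw [Set.uIoc_of_le hab] at hx
    have := hC (x + ((ε * T : ℝ) : ℂ) * Complex.I) (by simpa using hx.1.le) (by simpa using hx.2)
    have e : (x + ((ε * T : ℝ) : ℂ) * Complex.I).im ^ 2 = T ^ 2 := by
      simp only [Complex.add_im, Complex.ofReal_im, Complex.mul_im, Complex.ofReal_re, Complex.I_im,
        mul_one, Complex.I_re, mul_zero, add_zero, zero_add, mul_pow]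
      rw [← sq_abs ε, hε]; ring
    rwa [e] at this
  have h1 := intervalIntegral_tendsto_integral ha tendsto_neg_atTop_atBot tendsto_id
  have h2 := intervalIntegral_tendsto_integral hb tendsto_neg_atTop_atBot tendsto_id
  have h3 := h2.add (((hhor (-1) (by simp)).sub (hhor 1 (by simp))).const_mul (-Complex.I))
  simp only [sub_zero, mul_zero, add_zero] at h3
  refine tendsto_nhds_unique h1 (h3.congr fun T => ?_)
  simp only [id, neg_mul, one_mul]
  rw [hrect T]
  simp

/-! ### The kernel as an entire function of exponential type. -/

/-- The entire function `sin z / z`. -/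
noncomputable def complexSinc : ℂ → ℂ := dslope Complex.sin 0

theorem differentiable_complexSinc : Differentiable ℂ complexSinc :=
  fun z => ((Complex.differentiableOn_dslope (s := Set.univ) univ_mem).2
    Complex.differentiable_sin.differentiableOn z (Set.mem_univ z)).differentiableAt univ_mem

theorem complexSinc_of_ne {z : ℂ} (hz : z ≠ 0) : complexSinc z = Complex.sin z / z := by
  rw [complexSinc, dslope_of_ne _ hz, slope_def_field]; simp

theorem complexSinc_zero : complexSinc 0 = 1 := by
  rw [complexSinc, dslope_same]; simp

theorem complexSinc_ofReal (x : ℝ) : complexSinc x = Real.sinc x := by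
  rcases eq_or_ne x 0 with rfl | hx
  · simp [complexSinc_zero]
  · rw [complexSinc_of_ne (by exact_mod_cast hx), Real.sinc_of_ne_zero hx]; push_cast; rfl

theorem norm_exp_mul_I_le (z : ℂ) : ‖Complex.exp (z * Complex.I)‖ ≤ Real.exp |z.im| := by
  rw [Complex.norm_exp]
  refine Real.exp_le_exp.2 ?_
  simpa using neg_le_abs z.im

theorem norm_sin_le (z : ℂ) : ‖Complex.sin z‖ ≤ Real.exp |z.im| := by
  rw [Complex.sin, norm_div, norm_mul, Complex.norm_I, mul_one, Complex.norm_ofNat,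
    div_le_iff₀ two_pos]
  have h1 := norm_exp_mul_I_le z
  have h2 := norm_exp_mul_I_le (-z)
  rw [Complex.neg_im, abs_neg] at h2
  linarith [norm_sub_le (Complex.exp (-z * Complex.I)) (Complex.exp (z * Complex.I))]

theorem norm_cos_le (z : ℂ) : ‖Complex.cos z‖ ≤ Real.exp |z.im| := by
  rw [Complex.cos, norm_div, Complex.norm_ofNat, div_le_iff₀ two_pos]
  have h1 := norm_exp_mul_I_le z
  have h2 := norm_exp_mul_I_le (-z)
  rw [Complex.neg_im, abs_neg] at h2
  linarith [norm_add_le (Complex.exp (z * Complex.I)) (Complex.exp (-z * Complex.I))]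

/-- Two bounds are added: |sin z| ≤ e^{|Im z|} divided by |Re z|, and the mean value inequality for
sin on the strip of height |Im z|, where |cos| ≤ e^{|Im z|}. -/
theorem norm_complexSinc_le (z : ℂ) : ‖complexSinc z‖ ≤ 2 * Real.exp |z.im| / (1 + |z.re|) := by
  rw [le_div_iff₀ (by positivity)]
  have h1 : ‖complexSinc z‖ * |z.re| ≤ Real.exp |z.im| := by
    rcases eq_or_ne z 0 with rfl | hz
    · simp
    · rw [complexSinc_of_ne hz, norm_div, div_mul_eq_mul_div, div_le_iff₀ (norm_pos_iff.2 hz)]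
      exact mul_le_mul (norm_sin_le z) (Complex.abs_re_le_norm z) (abs_nonneg _) (Real.exp_nonneg _)
  have h2 : ‖complexSinc z‖ ≤ Real.exp |z.im| := by
    rcases eq_or_ne z 0 with rfl | hz
    · simp [complexSinc_zero]
    · rw [complexSinc_of_ne hz, norm_div, div_le_iff₀ (norm_pos_iff.2 hz)]
      have h := Convex.norm_image_sub_le_of_norm_hasDerivWithin_le (𝕜 := ℂ) (f := Complex.sin)
        (f' := Complex.cos) (s := {w | |w.im| ≤ |z.im|}) (x := 0) (y := z) (C := Real.exp |z.im|)
        (fun w _ => (Complex.hasDerivAt_sin w).hasDerivWithinAt)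
        (fun w hw => (norm_cos_le w).trans (Real.exp_le_exp.2 hw)) ?_ (by simp) (by simp)
      · simpa using h
      · have : {w : ℂ | |w.im| ≤ |z.im|} = Complex.im ⁻¹' (Set.Icc (-|z.im|) |z.im|) := by
          ext w; simp [abs_le]
        rw [this]
        exact (convex_Icc _ _).is_linear_preimage
          ⟨Complex.add_im, fun c w => by simp⟩
  linarith

/-- The kernel, as an entire function on the `s`-plane: on `Re s = σ` it is
`sinc (l (Im s - v)) ^ 4`. -/
noncomputable def smoothingKernel (σ l v : ℝ) (s : ℂ) : ℂ :=
  complexSinc (l * (-Complex.I * (s - σ) - v)) ^ 4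

theorem differentiable_smoothingKernel (σ l v : ℝ) : Differentiable ℂ (smoothingKernel σ l v) := by
  unfold smoothingKernel
  exact (differentiable_complexSinc.comp (by fun_prop)).pow 4

theorem smoothingKernel_line (σ l v τ : ℝ) :
    smoothingKernel σ l v (σ + τ * Complex.I) = ((Real.sinc (l * (τ - v)) ^ 4 : ℝ) : ℂ) := by
  have : (l * (-Complex.I * (σ + τ * Complex.I - σ) - v) : ℂ) = ((l * (τ - v) : ℝ) : ℂ) := by
    push_cast; linear_combination (-l * τ : ℂ) * Complex.I_sq
  rw [smoothingKernel, this, complexSinc_ofReal]; push_cast; rfl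

/-- The growth rate 4l to the right is what n^{-s} outweighs as soon as n > e^{4l}. -/
theorem norm_smoothingKernel_le {σ l v : ℝ} (hl : 0 ≤ l) {s : ℂ} (hs : σ ≤ s.re) :
    ‖smoothingKernel σ l v s‖ ≤
      16 * Real.exp (4 * l * (s.re - σ)) / (1 + l * |s.im - v|) ^ 4 := by
  set w : ℂ := l * (-Complex.I * (s - σ) - v) with hw
  have h1 : w.re = l * (s.im - v) := by rw [hw]; simp
  have h2 : w.im = -(l * (s.re - σ)) := by rw [hw]; simp; ring
  have h3 : |w.im| = l * (s.re - σ) := by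
    rw [h2, abs_neg, abs_of_nonneg (mul_nonneg hl (by linarith))]
  have h := norm_complexSinc_le w
  rw [h1, h3, abs_mul, abs_of_nonneg hl] at h
  rw [smoothingKernel, norm_pow]
  refine (pow_le_pow_left₀ (norm_nonneg _) h 4).trans (le_of_eq ?_)
  rw [div_pow, mul_pow, ← Real.exp_nat_mul]
  norm_num
  ring_nf

theorem one_add_abs_le_mul {l : ℝ} (hl : 1 ≤ l) (a b : ℝ) :
    1 + |a| ≤ (1 + |b|) * (1 + l * |a - b|) := by
  have h1 : |a| ≤ |b| + |a - b| := by
    have := abs_add_le b (a - b); rwa [add_sub_cancel] at this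
  have h2 : |a - b| ≤ l * |a - b| := le_mul_of_one_le_left (abs_nonneg _) hl
  nlinarith [abs_nonneg b, abs_nonneg (a - b), mul_nonneg (abs_nonneg b) ((abs_nonneg (a-b)).trans h2)]

/-- Fourth-power decay pays for one factor of linear growth and still leaves an integrable bound.
The loss (1 + |v|)^3 is harmless: this estimate serves only to justify convergence and contour
shifts. -/
theorem mul_norm_smoothingKernel_le {σ l v : ℝ} (hl : 1 ≤ l) {s : ℂ} (hs : σ ≤ s.re) :
    (1 + |s.im|) * ‖smoothingKernel σ l v s‖ ≤
      16 * Real.exp (4 * l * (s.re - σ)) * (1 + |v|) ^ 3 * (1 + s.im ^ 2)⁻¹ := by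
  have h1 := norm_smoothingKernel_le (v := v) (by linarith : 0 ≤ l) hs
  have h2 := one_add_abs_le_mul hl s.im v
  set D := 1 + l * |s.im - v| with hD
  have hD1 : 1 ≤ D := by
    have : 0 ≤ l * |s.im - v| := by positivity
    linarith
  have h3 : (1 + |s.im|) ^ 3 ≤ (1 + |v|) ^ 3 * D ^ 4 := by
    calc (1 + |s.im|) ^ 3 ≤ ((1 + |v|) * D) ^ 3 := pow_le_pow_left₀ (by positivity) h2 3
      _ = (1 + |v|) ^ 3 * D ^ 3 := by ring
      _ ≤ _ := mul_le_mul_of_nonneg_left (pow_le_pow_right₀ hD1 (by norm_num)) (by positivity)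
  have h4 : (1 + |s.im|) * (1 + s.im ^ 2) ≤ (1 + |s.im|) ^ 3 := by
    have : 1 + s.im ^ 2 ≤ (1 + |s.im|) ^ 2 := by rw [← sq_abs]; nlinarith [abs_nonneg s.im]
    calc _ ≤ (1 + |s.im|) * (1 + |s.im|) ^ 2 := mul_le_mul_of_nonneg_left this (by positivity)
      _ = _ := by ring
  rw [← div_eq_mul_inv, le_div_iff₀ (by positivity)]
  have hD0 : 0 < D ^ 4 := by positivity
  rw [le_div_iff₀ hD0] at h1
  set E := 16 * Real.exp (4 * l * (s.re - σ))
  have hK := norm_nonneg (smoothingKernel σ l v s)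
  set K := ‖smoothingKernel σ l v s‖
  calc (1 + |s.im|) * K * (1 + s.im ^ 2) = K * ((1 + |s.im|) * (1 + s.im ^ 2)) := by ring
    _ ≤ K * ((1 + |v|) ^ 3 * D ^ 4) := mul_le_mul_of_nonneg_left (h4.trans h3) hK
    _ = (K * D ^ 4) * (1 + |v|) ^ 3 := by ring
    _ ≤ E * (1 + |v|) ^ 3 := mul_le_mul_of_nonneg_right h1 (by positivity)

theorem norm_smoothingKernel_le' {σ l v : ℝ} (hl : 1 ≤ l) {s : ℂ} (hs : σ ≤ s.re) :
    ‖smoothingKernel σ l v s‖ ≤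
      16 * Real.exp (4 * l * (s.re - σ)) * (1 + |v|) ^ 3 * (1 + s.im ^ 2)⁻¹ :=
  (le_mul_of_one_le_left (norm_nonneg _) (by linarith [abs_nonneg s.im])).trans
    (mul_norm_smoothingKernel_le hl hs)

/-! ### The smoothed logarithm of zeta. -/

/-- A partial sum of the Dirichlet series of `log ζ`. -/
noncomputable def logZetaPartial (N : ℕ) (s : ℂ) : ℂ :=
  ∑ n ∈ Finset.range (N + 1), LSeries.term logZetaCoeff s n

theorem differentiable_logZetaPartial (N : ℕ) : Differentiable ℂ (logZetaPartial N) := by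
  unfold logZetaPartial
  exact Differentiable.fun_sum fun n _ s => (LSeries.hasDerivAt_term logZetaCoeff n s).differentiableAt

theorem norm_term_logZetaCoeff_le_rpow (s : ℂ) {n : ℕ} (hn : n ≠ 0) :
    ‖LSeries.term logZetaCoeff s n‖ ≤ (n : ℝ) ^ (-s.re) := by
  rw [LSeries.norm_term_eq, if_neg hn, Real.rpow_neg (by positivity), div_eq_mul_inv]
  exact mul_le_of_le_one_left (by positivity) (norm_logZetaCoeff_le n)

theorem norm_logZetaPartial_le {N : ℕ} {s : ℂ} (hs : 0 ≤ s.re) : ‖logZetaPartial N s‖ ≤ N + 1 := by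
  refine (norm_sum_le _ _).trans ((Finset.sum_le_sum (g := fun _ => (1:ℝ)) fun n _ => ?_).trans
    (by simp))
  rcases eq_or_ne n 0 with rfl | hn
  · simp
  · refine (norm_term_logZetaCoeff_le_rpow s hn).trans ?_
    exact Real.rpow_le_one_of_one_le_of_nonpos (by exact_mod_cast Nat.one_le_iff_ne_zero.2 hn)
      (by linarith)

theorem sum_rpow_neg_half_le (N : ℕ) :
    ∑ n ∈ Finset.range N, 1 / Real.sqrt ((n : ℝ) + 1) ≤ 2 * Real.sqrt N := by
  induction N with
  | zero => simp
  | succ N ih =>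
    rw [Finset.sum_range_succ]
    have h1 := Real.sqrt_nonneg (N : ℝ)
    have h2 : 0 < Real.sqrt ((N : ℝ) + 1) := Real.sqrt_pos.2 (by positivity)
    have h3 := Real.sq_sqrt (by positivity : (0:ℝ) ≤ N)
    have h4 := Real.sq_sqrt (by positivity : (0:ℝ) ≤ (N : ℝ) + 1)
    have h5 : 1 / Real.sqrt ((N : ℝ) + 1) ≤ 2 * Real.sqrt ((N : ℝ) + 1) - 2 * Real.sqrt N := by
      rw [div_le_iff₀ h2]
      nlinarith [sq_nonneg (Real.sqrt ((N : ℝ) + 1) - Real.sqrt N)]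
    push_cast
    linarith

theorem norm_logZetaPartial_le_sqrt {N : ℕ} {s : ℂ} (hs : 1 / 2 ≤ s.re) :
    ‖logZetaPartial N s‖ ≤ 2 * Real.sqrt N := by
  rw [logZetaPartial, Finset.sum_range_succ', LSeries.term_zero, add_zero]
  refine (norm_sum_le _ _).trans ((Finset.sum_le_sum fun n _ => ?_).trans (sum_rpow_neg_half_le N))
  refine (norm_term_logZetaCoeff_le_rpow s n.succ_ne_zero).trans ?_
  rw [Real.sqrt_eq_rpow, one_div, ← Real.rpow_neg (by positivity)]
  push_cast
  exact Real.rpow_le_rpow_of_exponent_le (by linarith [n.cast_nonneg (α := ℝ)]) (by linarith)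

theorem norm_LSeries_sub_logZetaPartial_le (N : ℕ) {s : ℂ} (hs : 2 ≤ s.re) :
    ‖LSeries logZetaCoeff s - logZetaPartial N s‖ ≤
      (∑' n : ℕ, (n : ℝ) ^ (-2 : ℝ)) * ((N : ℝ) + 1) ^ (2 - s.re) := by
  have hsum : LSeriesSummable logZetaCoeff s :=
    LSeriesSummable_of_abscissaOfAbsConv_lt_re (abscissa_logZetaCoeff_lt (by linarith))
  have h1 : LSeries logZetaCoeff s - logZetaPartial N s =
      ∑' n, LSeries.term logZetaCoeff s (n + (N + 1)) := by
    rw [LSeries, ← Summable.sum_add_tsum_nat_add (N + 1) hsum, logZetaPartial]; ring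
  have hs2 : Summable fun n : ℕ => ((n + (N + 1) : ℕ) : ℝ) ^ (-2 : ℝ) :=
    (summable_nat_add_iff (N + 1)).2 summable_rpow_neg_two
  have h2 : ∑' n : ℕ, ((n + (N + 1) : ℕ) : ℝ) ^ (-2 : ℝ) ≤ ∑' n : ℕ, (n : ℝ) ^ (-2 : ℝ) := by
    rw [← Summable.sum_add_tsum_nat_add (N + 1) summable_rpow_neg_two]
    exact le_add_of_nonneg_left (Finset.sum_nonneg fun n _ => by positivity)
  rw [h1]
  refine le_trans ?_ (mul_le_mul_of_nonneg_right h2 (by positivity))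
  refine tsum_of_norm_bounded (hs2.hasSum.mul_right _) fun n => ?_
  refine (norm_term_logZetaCoeff_le_rpow s (by omega)).trans ?_
  have h3 : (0:ℝ) < ((n + (N + 1) : ℕ) : ℝ) := by positivity
  have h4 : -s.re = -2 + (2 - s.re) := by ring
  rw [h4, Real.rpow_add h3]
  refine mul_le_mul_of_nonneg_left ?_ (by positivity)
  exact Real.rpow_le_rpow_of_nonpos (by positivity) (by push_cast; linarith [n.cast_nonneg (α := ℝ)])
    (by linarith)

/-- The derivative 1/w is O(1/(1 + |Im s|)) on the horizontal segment of length 2 between the two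
points. This decay is the reason for dividing (s - 1)ζ(s) by s + 1. -/
theorem norm_log_sub_log_le {s : ℂ} (hs : s.re = 2) :
    ‖Complex.log (s - 1) - Complex.log (s + 1)‖ ≤ 4 / (1 + |s.im|) := by
  have h := Convex.norm_image_sub_le_of_norm_hasDerivWithin_le (𝕜 := ℂ) (f := Complex.log)
    (f' := fun w => w⁻¹) (s := {w | 1 ≤ w.re} ∩ {w | w.im = s.im}) (x := s + 1) (y := s - 1)
    (C := 2 / (1 + |s.im|)) (fun w hw => ?_) (fun w hw => ?_) ?_ ?_ ?_
  · have : ‖s - 1 - (s + 1)‖ = 2 := by rw [show s - 1 - (s + 1) = -2 by ring]; simp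
    rw [this] at h
    exact h.trans (le_of_eq (by ring))
  · exact (Complex.hasDerivAt_log (Or.inl (by linarith [hw.1.out]))).hasDerivWithinAt
  · have h1 : 1 ≤ ‖w‖ := hw.1.out.trans ((le_abs_self _).trans (Complex.abs_re_le_norm w))
    have h2 : |s.im| ≤ ‖w‖ := by rw [← hw.2.out]; exact Complex.abs_im_le_norm w
    rw [norm_inv, inv_eq_one_div, div_le_div_iff₀ (by linarith) (by positivity)]
    linarith
  · refine (convex_halfSpace_re_ge 1).inter ?_
    have : {w : ℂ | w.im = s.im} = Complex.im ⁻¹' {s.im} := rfl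
    rw [this]
    exact (convex_singleton _).is_linear_preimage ⟨Complex.add_im, fun c w => by simp⟩
  · exact ⟨by simp; linarith, by simp⟩
  · exact ⟨by simp; linarith, by simp⟩

open MeasureTheory in
-- The line is moved to Re s = Y → ∞. The tail decays like (N + 1)^{-Y} and the kernel grows like
-- e^{4lY}, so the integral is O(q^Y) with q < 1. This expresses the compact Fourier support of
-- sinc^4.
theorem integral_tail_mul_kernel_eq_zero {σ l v : ℝ} (hσ : σ ≤ 2) (hl : 1 ≤ l) {N : ℕ}
    (hN : Real.exp (4 * l) < N + 1) :
    ∫ τ : ℝ, (fun s => (LSeries logZetaCoeff s - logZetaPartial N s) * smoothingKernel σ l v s)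
      ((2 : ℝ) + τ * Complex.I) = 0 := by
  set f : ℂ → ℂ := fun s => (LSeries logZetaCoeff s - logZetaPartial N s) * smoothingKernel σ l v s
  set A := ∑' n : ℕ, (n : ℝ) ^ (-2 : ℝ)
  have hA : 0 ≤ A := tsum_nonneg fun n => by positivity
  set q := Real.exp (4 * l) / (N + 1) with hq
  have hq1 : q < 1 := (div_lt_one (by positivity)).2 hN
  have hq0 : 0 < q := by positivity
  set B := A * (16 * Real.exp (4 * l * (2 - σ)) * (1 + |v|) ^ 3) with hB
  have hf : ∀ s : ℂ, 2 ≤ s.re → ‖f s‖ ≤ B * q ^ (s.re - 2) * (1 + s.im ^ 2)⁻¹ := by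
    intro s hs
    rw [norm_mul]
    refine (mul_le_mul (norm_LSeries_sub_logZetaPartial_le N hs)
      (norm_smoothingKernel_le' (v := v) hl (hσ.trans hs)) (norm_nonneg _) (by positivity)).trans
      (le_of_eq ?_)
    have e1 : q ^ (s.re - 2) = Real.exp (4 * l * (s.re - 2)) * ((N : ℝ) + 1) ^ (2 - s.re) := by
      rw [hq, Real.div_rpow (by positivity) (by positivity), ← Real.exp_mul, div_eq_mul_inv,
        ← Real.rpow_neg (by positivity), neg_sub]
    have e2 : Real.exp (4 * l * (s.re - σ)) =
        Real.exp (4 * l * (2 - σ)) * Real.exp (4 * l * (s.re - 2)) := by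
      rw [← Real.exp_add]; ring_nf
    rw [e1, e2, hB]; ring
  have hB0 : 0 ≤ B := by positivity
  have key : ∀ Y : ℝ, 2 ≤ Y → ‖∫ τ : ℝ, f ((2 : ℝ) + τ * Complex.I)‖ ≤ B * q ^ (Y - 2) * Real.pi := by
    intro Y hY
    rw [integral_vertical_eq (C := B) hY (fun s hs _ => ?_) (fun s hs _ => ?_)]
    · exact norm_integral_vertical_le fun s hs => hs ▸ hf s (hY.trans hs.ge)
    · exact ((hasDerivAt_LSeries_logZetaCoeff (by linarith)).differentiableAt.sub
        (differentiable_logZetaPartial N s)).mul (differentiable_smoothingKernel σ l v s)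
    · refine (hf s hs).trans ?_
      refine mul_le_mul_of_nonneg_right (mul_le_of_le_one_right hB0 ?_) (by positivity)
      exact Real.rpow_le_one hq0.le hq1.le (by linarith)
  have hlim : Tendsto (fun Y : ℝ => B * q ^ (Y - 2) * Real.pi) atTop (𝓝 0) := by
    have h1 : Tendsto (fun Y : ℝ => q ^ (Y - 2)) atTop (𝓝 0) :=
      (tendsto_rpow_atTop_of_base_lt_one q (by linarith) hq1).comp
        (tendsto_atTop_add_const_right _ _ tendsto_id)
    simpa using (h1.const_mul B).mul_const Real.pi
  have := ge_of_tendsto hlim ((eventually_ge_atTop 2).mono key)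
  exact norm_le_zero_iff.1 this

open MeasureTheory in
-- This is the contribution of the pole. The exponent 6l bounds 4l(2 - σ) for σ ≥ 1/2, the price of
-- working on Re s = 2.
theorem norm_integral_log_mul_kernel_le {σ l v : ℝ} (hσ : 1 / 2 ≤ σ) (hσ2 : σ ≤ 2) (hl : 1 ≤ l) :
    ‖∫ τ : ℝ, (fun s => (Complex.log (s - 1) - Complex.log (s + 1)) * smoothingKernel σ l v s)
      ((2 : ℝ) + τ * Complex.I)‖ ≤ 64 * Real.pi * Real.exp (6 * l) / (1 + |v|) / l := by
  have hl0 : 0 < l := by linarith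
  have hint : ∫ τ : ℝ, (1 + (l * (τ - v)) ^ 2)⁻¹ = Real.pi / l := by
    rw [integral_sub_right_eq_self (fun τ => (1 + (l * τ) ^ 2)⁻¹) v,
      Measure.integral_comp_mul_left (fun τ => (1 + τ ^ 2)⁻¹), integral_inv_one_add_sq_real,
      abs_inv, abs_of_pos hl0, smul_eq_mul]
    ring
  have hi : Integrable fun τ : ℝ => (1 + (l * (τ - v)) ^ 2)⁻¹ :=
    (integrable_inv_one_add_sq.comp_mul_left' hl0.ne').comp_sub_right v
  have e : 64 * Real.pi * Real.exp (6 * l) / (1 + |v|) / l =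
      ∫ τ : ℝ, 64 * Real.exp (6 * l) / (1 + |v|) * (1 + (l * (τ - v)) ^ 2)⁻¹ := by
    rw [integral_const_mul, hint]; ring
  rw [e]
  refine norm_integral_le_of_norm_le (hi.const_mul _) (ae_of_all _ fun τ => ?_)
  have h1 := norm_log_sub_log_le (s := (2 : ℝ) + τ * Complex.I) (by simp)
  have h2 := norm_smoothingKernel_le (σ := σ) (v := v) hl0.le (s := (2 : ℝ) + τ * Complex.I)
    (by simpa using hσ2)
  have h3 : ((2 : ℝ) + τ * Complex.I : ℂ).im = τ := by simp
  have h4 : ((2 : ℝ) + τ * Complex.I : ℂ).re = 2 := by simp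
  rw [h3] at h1
  rw [h3, h4] at h2
  have h5 : Real.exp (4 * l * (2 - σ)) ≤ Real.exp (6 * l) := Real.exp_le_exp.2 (by nlinarith)
  have h6 := one_add_abs_le_mul hl v τ
  rw [abs_sub_comm] at h6
  set D := 1 + l * |τ - v| with hD
  have hD1 : 1 ≤ D := by
    have : 0 ≤ l * |τ - v| := by positivity
    linarith
  have h7 : 1 + (l * (τ - v)) ^ 2 ≤ D ^ 2 := by
    rw [hD, mul_pow, ← sq_abs (τ - v)]
    have : 0 ≤ l * |τ - v| := by positivity
    nlinarith
  simp only [norm_mul]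
  calc _ ≤ 4 / (1 + |τ|) * (16 * Real.exp (4 * l * (2 - σ)) / D ^ 4) :=
        mul_le_mul h1 h2 (norm_nonneg _) (by positivity)
    _ ≤ 4 / (1 + |τ|) * (16 * Real.exp (6 * l) / D ^ 4) := by gcongr
    _ = 64 * Real.exp (6 * l) * (1 / ((1 + |τ|) * D ^ 4)) := by field_simp; norm_num
    _ ≤ 64 * Real.exp (6 * l) * (1 / ((1 + |v|) * (1 + (l * (τ - v)) ^ 2))) := by
        refine mul_le_mul_of_nonneg_left (one_div_le_one_div_of_le (by positivity) ?_) (by positivity)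
        calc (1 + |v|) * (1 + (l * (τ - v)) ^ 2) ≤ ((1 + |τ|) * D) * D ^ 2 := by gcongr
          _ = (1 + |τ|) * D ^ 3 := by ring
          _ ≤ _ := mul_le_mul_of_nonneg_left (pow_le_pow_right₀ hD1 (by norm_num)) (by positivity)
    _ = _ := by field_simp

open MeasureTheory in
-- On Re s = σ the kernel is real and nonnegative, so the real constant c drops out of the imaginary
-- part and the partial sum is bounded by the sum of n^{-1/2}.
theorem abs_im_integral_partial_mul_kernel_le {σ l v c : ℝ} (hσ : 1 / 2 ≤ σ) (hl : 1 ≤ l) (N : ℕ) :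
    |(∫ τ : ℝ, (fun s => (logZetaPartial N s + c) * smoothingKernel σ l v s)
      (σ + τ * Complex.I)).im| ≤ 2 * Real.sqrt N * (2 * Real.pi / 3) / l := by
  have hl0 : 0 < l := by linarith
  have hK : ∫ τ : ℝ, Real.sinc (l * (τ - v)) ^ 4 = (2 * Real.pi / 3) / l := by
    rw [integral_sub_right_eq_self (fun τ => Real.sinc (l * τ) ^ 4) v,
      Measure.integral_comp_mul_left (fun τ => Real.sinc τ ^ 4), integral_sinc_pow_four,
      abs_inv, abs_of_pos hl0, smul_eq_mul]
    ring
  have hKi : Integrable fun τ : ℝ => Real.sinc (l * (τ - v)) ^ 4 :=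
    (integrable_sinc_pow_four.comp_mul_left' hl0.ne').comp_sub_right v
  have hPc : Continuous fun τ : ℝ => logZetaPartial N (σ + τ * Complex.I) :=
    (differentiable_logZetaPartial N).continuous.comp (by fun_prop)
  have hPb : ∀ τ : ℝ, ‖logZetaPartial N (σ + τ * Complex.I) * ((Real.sinc (l * (τ - v)) ^ 4 : ℝ) : ℂ)‖
      ≤ 2 * Real.sqrt N * Real.sinc (l * (τ - v)) ^ 4 := by
    intro τ
    rw [norm_mul, Complex.norm_real, Real.norm_of_nonneg (by positivity)]
    exact mul_le_mul_of_nonneg_right (norm_logZetaPartial_le_sqrt (by simpa using hσ)) (by positivity)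
  have hPi : Integrable fun τ : ℝ =>
      logZetaPartial N (σ + τ * Complex.I) * ((Real.sinc (l * (τ - v)) ^ 4 : ℝ) : ℂ) :=
    (hKi.const_mul _).mono' (Continuous.aestronglyMeasurable (hPc.mul (by fun_prop)))
      (ae_of_all _ hPb)
  simp only [smoothingKernel_line, add_mul]
  have hKi' : Integrable fun τ : ℝ => (c : ℂ) * ((Real.sinc (l * (τ - v)) ^ 4 : ℝ) : ℂ) :=
    (hKi.ofReal (𝕜 := ℂ)).const_mul _
  rw [integral_add hPi hKi', integral_const_mul, integral_complex_ofReal,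
    ← Complex.ofReal_mul, Complex.add_im, Complex.ofReal_im, add_zero]
  refine (Complex.abs_im_le_norm _).trans ?_
  rw [mul_div_assoc, ← hK, ← integral_const_mul]
  exact norm_integral_le_of_norm_le (hKi.const_mul _) (ae_of_all _ hPb)

/-- A determination of `log ((s - 1) ζ(s) / (s + 1))`, for `L` a determination of
`log ((s - 1) ζ(s))`. -/
noncomputable def logZetaQuot (L : ℂ → ℂ) (s : ℂ) : ℂ := L s - Complex.log (s + 1)

theorem add_one_mem_slitPlane {s : ℂ} (hs : 1 / 2 < s.re) : s + 1 ∈ Complex.slitPlane :=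
  Or.inl (by simp; linarith)

theorem norm_log_add_one_le {s : ℂ} (hs : 1 / 2 < s.re) (hs2 : s.re ≤ 2) :
    ‖Complex.log (s + 1)‖ ≤ 7 * (1 + |s.im|) := by
  have h1 : 1 ≤ ‖s + 1‖ := by
    refine le_trans ?_ ((le_abs_self _).trans (Complex.abs_re_le_norm (s + 1)))
    simp; linarith
  have h2 : ‖s + 1‖ ≤ 3 + |s.im| := by
    refine (Complex.norm_le_abs_re_add_abs_im _).trans ?_
    rw [Complex.add_re, Complex.one_re, abs_of_pos (by linarith)]
    simp; linarith
  have h3 := Real.log_le_sub_one_of_pos (by linarith : 0 < ‖s + 1‖)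
  have h4 := Complex.norm_le_abs_re_add_abs_im (Complex.log (s + 1))
  rw [Complex.log_re, Complex.log_im, abs_of_nonneg (Real.log_nonneg h1)] at h4
  have h5 := Complex.abs_arg_le_pi (s + 1)
  linarith [Real.pi_le_four, abs_nonneg s.im]

theorem IsLogZeta.differentiableAt_logZetaQuot {L : ℂ → ℂ} (hL : IsLogZeta L) {s : ℂ}
    (hs : 1 / 2 < s.re) : DifferentiableAt ℂ (logZetaQuot L) s :=
  (hL.differentiableAt s hs).sub
    ((differentiableAt_id.add_const 1).clog (add_one_mem_slitPlane hs))

theorem IsLogZeta.exists_norm_logZetaQuot_le {L : ℂ → ℂ} (hL : IsLogZeta L) {σ : ℝ}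
    (hσ : 1 / 2 < σ) : ∃ C : ℝ, 0 ≤ C ∧
      ∀ s : ℂ, σ ≤ s.re → s.re ≤ 2 → ‖logZetaQuot L s‖ ≤ C * (1 + |s.im|) := by
  obtain ⟨C, hC⟩ := hL.exists_norm_le (sub_pos.2 hσ)
  refine ⟨|C| + 7, by positivity, fun s h1 h2 => ?_⟩
  have h3 := hC s (by linarith) h2
  have h4 := norm_log_add_one_le (hσ.trans_le h1) h2
  have h5 := norm_sub_le (L s) (Complex.log (s + 1))
  have h6 := mul_le_mul_of_nonneg_right (le_abs_self C) (by positivity : 0 ≤ 1 + |s.im|)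
  rw [logZetaQuot]
  linarith

open MeasureTheory in
-- After a shift to Re s = 2 the logarithm splits into the Dirichlet tail, the partial sum plus c,
-- and log(s - 1) - log(s + 1). The tail integrates to zero, the partial sum is moved back to Re s =
-- σ, and the last piece is estimated where it stands.
theorem IsLogZeta.abs_im_integral_logZetaQuot_mul_kernel_le {L : ℂ → ℂ} (hL : IsLogZeta L)
    {σ l v : ℝ} (hσ : 1 / 2 < σ) (hσ1 : σ ≤ 1) (hl : 1 ≤ l) :
    |(∫ τ : ℝ, (fun s => logZetaQuot L s * smoothingKernel σ l v s) (σ + τ * Complex.I)).im| ≤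
      (2 * Real.exp (2 * l) * (2 * Real.pi / 3) +
        64 * Real.pi * Real.exp (6 * l) / (1 + |v|)) / l := by
  obtain ⟨c, hc⟩ := hL.eq_LSeries
  obtain ⟨C, hC0, hC⟩ := hL.exists_norm_logZetaQuot_le hσ
  -- The least length for which the tail disappears; the partial sum then costs √N ≤ e^{2l}.
  set N := ⌊Real.exp (4 * l)⌋₊
  have hN : Real.exp (4 * l) < N + 1 := Nat.lt_floor_add_one _
  have hN' : Real.sqrt N ≤ Real.exp (2 * l) := by
    rw [← Real.sqrt_sq (Real.exp_pos (2 * l)).le, ← Real.exp_nat_mul]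
    refine Real.sqrt_le_sqrt ((Nat.floor_le (Real.exp_pos _).le).trans (le_of_eq ?_))
    push_cast; ring_nf
  set K := smoothingKernel σ l v
  set D := 16 * Real.exp (4 * l * (2 - σ)) * (1 + |v|) ^ 3
  have hD0 : 0 ≤ D := by positivity
  have hK : ∀ s : ℂ, σ ≤ s.re → s.re ≤ 2 → (1 + |s.im|) * ‖K s‖ ≤ D * (1 + s.im ^ 2)⁻¹ := by
    intro s h1 h2
    refine (mul_norm_smoothingKernel_le hl h1).trans ?_
    have : Real.exp (4 * l * (s.re - σ)) ≤ Real.exp (4 * l * (2 - σ)) :=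
      Real.exp_le_exp.2 (by nlinarith)
    refine mul_le_mul_of_nonneg_right ?_ (by positivity)
    exact mul_le_mul_of_nonneg_right (mul_le_mul_of_nonneg_left this (by norm_num)) (by positivity)
  have hbound : ∀ (F : ℂ → ℂ) (C : ℝ), 0 ≤ C →
      (∀ s : ℂ, σ ≤ s.re → s.re ≤ 2 → ‖F s‖ ≤ C * (1 + |s.im|)) →
      ∀ s : ℂ, σ ≤ s.re → s.re ≤ 2 → ‖F s * K s‖ ≤ C * D * (1 + s.im ^ 2)⁻¹ := by
    intro F C hC hF s h1 h2
    rw [norm_mul]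
    calc _ ≤ C * (1 + |s.im|) * ‖K s‖ := mul_le_mul_of_nonneg_right (hF s h1 h2) (norm_nonneg _)
      _ = C * ((1 + |s.im|) * ‖K s‖) := by ring
      _ ≤ C * (D * (1 + s.im ^ 2)⁻¹) := mul_le_mul_of_nonneg_left (hK s h1 h2) hC
      _ = _ := by ring
  set P : ℂ → ℂ := fun s => logZetaPartial N s + c
  have hPn : ∀ s : ℂ, σ ≤ s.re → s.re ≤ 2 → ‖P s‖ ≤ (N + 1 + |c|) * (1 + |s.im|) := by
    intro s h1 h2
    have h3 := norm_logZetaPartial_le (N := N) (s := s) (by linarith)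
    have h4 : ‖P s‖ ≤ N + 1 + |c| :=
      (norm_add_le _ _).trans (by rw [Complex.norm_real, Real.norm_eq_abs]; linarith)
    exact h4.trans (le_mul_of_one_le_right (by positivity) (by linarith [abs_nonneg s.im]))
  have hPd : Differentiable ℂ P := (differentiable_logZetaPartial N).add_const _
  have hKd : Differentiable ℂ K := differentiable_smoothingKernel σ l v
  have hσ2 : σ ≤ 2 := by linarith
  have hGb := hbound _ C hC0 hC
  have hPb := hbound P _ (by positivity) hPn
  have eG := integral_vertical_eq (f := fun s => logZetaQuot L s * K s) hσ2
    (fun s h1 _ => (hL.differentiableAt_logZetaQuot (hσ.trans_le h1)).mul (hKd s)) hGb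
  have eP := integral_vertical_eq (f := fun s => P s * K s) hσ2
    (fun s _ _ => (hPd s).mul (hKd s)) hPb
  set T : ℂ → ℂ := fun s => LSeries logZetaCoeff s - logZetaPartial N s
  set R : ℂ → ℂ := fun s => Complex.log (s - 1) - Complex.log (s + 1)
  have hTK := integral_tail_mul_kernel_eq_zero (v := v) hσ2 hl hN
  have hRK := norm_integral_log_mul_kernel_le (v := v) hσ.le hσ2 hl
  have hPK := abs_im_integral_partial_mul_kernel_le (v := v) (c := c) hσ.le hl N
  have hGi : Integrable fun τ : ℝ => (fun s => logZetaQuot L s * K s) ((2 : ℝ) + τ * Complex.I) :=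
    integrable_vertical (fun s h => ((hL.differentiableAt_logZetaQuot (by linarith)).mul
      (hKd s)).continuousAt) fun s h => hGb s (by linarith) (by linarith)
  have hPi : Integrable fun τ : ℝ => (fun s => P s * K s) ((2 : ℝ) + τ * Complex.I) :=
    integrable_vertical (fun s _ => (hPd s |>.mul (hKd s)).continuousAt)
      fun s h => hPb s (by linarith) (by linarith)
  have hRn : ∀ s : ℂ, s.re = 2 → ‖R s‖ ≤ 4 * (1 + |s.im|) := fun s h =>
    (norm_log_sub_log_le h).trans ((div_le_self (by norm_num) (by linarith [abs_nonneg s.im])).trans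
      (by linarith [abs_nonneg s.im]))
  have hRb : ∀ s : ℂ, s.re = 2 → ‖R s * K s‖ ≤ 4 * D * (1 + s.im ^ 2)⁻¹ := by
    intro s h
    rw [norm_mul]
    calc _ ≤ 4 * (1 + |s.im|) * ‖K s‖ := mul_le_mul_of_nonneg_right (hRn s h) (norm_nonneg _)
      _ = 4 * ((1 + |s.im|) * ‖K s‖) := by ring
      _ ≤ 4 * (D * (1 + s.im ^ 2)⁻¹) :=
        mul_le_mul_of_nonneg_left (hK s (by linarith) (by linarith)) (by norm_num)
      _ = _ := by ring
  have hRi : Integrable fun τ : ℝ => (fun s => R s * K s) ((2 : ℝ) + τ * Complex.I) := by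
    refine integrable_vertical (fun s h => ?_) hRb
    refine ContinuousAt.mul ?_ (hKd s).continuousAt
    exact (((differentiableAt_id.sub_const 1).clog (sub_one_mem_slitPlane (s := s) (by linarith))).sub
      ((differentiableAt_id.add_const 1).clog (add_one_mem_slitPlane (s := s) (by linarith)))).continuousAt
  have split : ∀ τ : ℝ, (fun s => T s * K s) ((2 : ℝ) + τ * Complex.I) =
      (fun s => logZetaQuot L s * K s) ((2 : ℝ) + τ * Complex.I) -
        (fun s => P s * K s) ((2 : ℝ) + τ * Complex.I) -
        (fun s => R s * K s) ((2 : ℝ) + τ * Complex.I) := by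
    intro τ
    have := hc ((2 : ℝ) + τ * Complex.I) (by simp)
    simp only [logZetaQuot, T, P, R, this]
    ring
  have hsum : (∫ τ : ℝ, (fun s => logZetaQuot L s * K s) ((2 : ℝ) + τ * Complex.I)) =
      (∫ τ : ℝ, (fun s => P s * K s) ((2 : ℝ) + τ * Complex.I)) +
        ∫ τ : ℝ, (fun s => R s * K s) ((2 : ℝ) + τ * Complex.I) := by
    have gen : ∀ A B C : ℝ → ℂ, Integrable A → Integrable B → Integrable C →
        ∫ τ, (A τ - B τ - C τ) = (∫ τ, A τ) - (∫ τ, B τ) - ∫ τ, C τ := fun A B C hA hB hC => by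
      rw [integral_sub (f := fun τ => A τ - B τ) (hA.sub hB) hC, integral_sub hA hB]
    have h := (gen _ _ _ hGi hPi hRi).symm.trans
      ((integral_congr_ae (ae_of_all _ split)).symm.trans hTK)
    linear_combination h
  rw [eG, hsum, ← eP, Complex.add_im]
  refine (abs_add_le _ _).trans ?_
  rw [add_div]
  refine add_le_add (hPK.trans ?_) ((Complex.abs_im_le_norm _).trans hRK)
  gcongr

open MeasureTheory in
theorem IsLogZeta.abs_integral_im_logZetaQuot_le {L : ℂ → ℂ} (hL : IsLogZeta L)
    {σ l v : ℝ} (hσ : 1 / 2 < σ) (hσ1 : σ ≤ 1) (hl : 1 ≤ l) :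
    |∫ y : ℝ, (logZetaQuot L (σ + (v + y / l : ℝ) * Complex.I)).im * Real.sinc y ^ 4| ≤
      64 * Real.pi * Real.exp (2 * l) + 64 * Real.pi * Real.exp (6 * l) / (1 + |v|) := by
  have hl0 : 0 < l := by linarith
  have h := hL.abs_im_integral_logZetaQuot_mul_kernel_le (v := v) hσ hσ1 hl
  obtain ⟨C, hC0, hC⟩ := hL.exists_norm_logZetaQuot_le hσ
  simp only [smoothingKernel_line] at h
  set f : ℝ → ℂ := fun τ => logZetaQuot L (σ + τ * Complex.I) * ((Real.sinc (l * (τ - v)) ^ 4 : ℝ) : ℂ)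
    with hf
  have hfi : Integrable f := by
    have h1 : Integrable fun τ : ℝ =>
        (fun s => logZetaQuot L s * smoothingKernel σ l v s) (σ + τ * Complex.I) := by
      refine integrable_vertical (f := fun s => logZetaQuot L s * smoothingKernel σ l v s) (a := σ)
        (C := C * (16 * Real.exp (4 * l * (σ - σ)) * (1 + |v|) ^ 3))
        (fun s h => ?_) fun s h => ?_
      · exact ((hL.differentiableAt_logZetaQuot (s := s) (by linarith)).mul
          (differentiable_smoothingKernel σ l v s)).continuousAt
      · have h2 := mul_norm_smoothingKernel_le (v := v) hl h.ge
        rw [h] at h2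
        rw [norm_mul]
        calc _ ≤ C * (1 + |s.im|) * ‖smoothingKernel σ l v s‖ :=
              mul_le_mul_of_nonneg_right (hC s h.ge (by linarith)) (norm_nonneg _)
          _ = C * ((1 + |s.im|) * ‖smoothingKernel σ l v s‖) := by ring
          _ ≤ _ := mul_le_mul_of_nonneg_left h2 hC0
          _ = _ := by ring
    simpa only [smoothingKernel_line] using h1
  have e1 : (∫ τ, f τ).im = ∫ τ, (f τ).im := (integral_im hfi).symm
  have e2 : ∫ y : ℝ, (logZetaQuot L (σ + (v + y / l : ℝ) * Complex.I)).im * Real.sinc y ^ 4 =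
      l * ∫ τ, (f τ).im := by
    have h3 := Measure.integral_comp_div (fun y : ℝ => (f (v + y)).im) l
    rw [abs_of_pos hl0, smul_eq_mul, integral_add_left_eq_self (fun τ => (f τ).im) v] at h3
    rw [← h3]
    refine integral_congr_ae (ae_of_all _ fun y => ?_)
    simp only [hf, Complex.im_mul_ofReal]
    rw [add_sub_cancel_left, mul_div_cancel₀ _ hl0.ne']
  rw [e2, ← e1, abs_mul, abs_of_pos hl0]
  change |(∫ τ, f τ).im| ≤ _ at h
  rw [le_div_iff₀ hl0] at h
  rw [mul_comm]
  refine h.trans (add_le_add_left ?_ _)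
  -- The true coefficient 4π/3 of e^{2l} is enlarged to 64π so that both error terms share one
  -- constant B.
  nlinarith [Real.pi_pos, Real.exp_pos (2 * l), mul_pos Real.pi_pos (Real.exp_pos (2 * l))]

/-! ### The bound for Im log on vertical lines, uniform in σ. -/

/-- This lets the slope at an intermediate point be read off at either end of an interval of length
u, at the cost of u^2. -/
theorem slopeBound_le (c a b : ℝ) : slopeBound c a ≤ slopeBound c b + |a - b| := by
  have h1 := abs_sub_abs_le_abs_sub a b
  have hb : 0 < |b| + 2 := by positivity
  have ha : 0 < |a| + 2 := by positivity
  have h2 := Real.log_le_sub_one_of_pos (div_pos ha hb)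
  rw [Real.log_div ha.ne' hb.ne'] at h2
  have h3 : (|a| + 2) / (|b| + 2) - 1 ≤ |a - b| := by
    rw [sub_le_iff_le_add, div_le_iff₀ hb]
    nlinarith [abs_nonneg (a - b), abs_nonneg b]
  unfold slopeBound
  linarith [abs_nonneg (a - b)]

theorem exists_sub_eq_mul {g g' : ℝ → ℝ} (hg : ∀ τ, HasDerivAt g (g' τ) τ) (τ : ℝ) {u : ℝ}
    (hu : 0 ≤ u) : ∃ ξ, τ ≤ ξ ∧ ξ ≤ τ + u ∧ g (τ + u) - g τ = u * g' ξ := by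
  rcases hu.eq_or_lt with rfl | hu
  · exact ⟨τ, le_rfl, by simp, by simp⟩
  · obtain ⟨ξ, hξ, h⟩ := exists_hasDerivAt_eq_slope g g' (by linarith : τ < τ + u)
      (HasDerivAt.continuousOn fun x _ => hg x) (fun x _ => hg x)
    refine ⟨ξ, hξ.1.le, hξ.2.le, ?_⟩
    rw [h, add_sub_cancel_left, mul_div_cancel₀ _ hu.ne']

theorem sub_slopeBound_le {g g' : ℝ → ℝ} {c : ℝ} (hg : ∀ τ, HasDerivAt g (g' τ) τ)
    (h : ∀ τ, -slopeBound c τ ≤ g' τ) {b τ u : ℝ} (hu : 0 ≤ u) (hab : b = τ ∨ b = τ + u) :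
    g τ - u * slopeBound c b - u ^ 2 ≤ g (τ + u) := by
  obtain ⟨ξ, h1, h2, h3⟩ := exists_sub_eq_mul hg τ hu
  have h4 : |ξ - b| ≤ u := by
    rcases hab with rfl | rfl <;> rw [abs_le] <;> constructor <;> linarith
  have h5 := slopeBound_le c ξ b
  have h6 := mul_le_mul_of_nonneg_left (h ξ) hu
  nlinarith

theorem HasDerivAt.im_vertical {F : ℂ → ℂ} {F' : ℂ} {σ τ : ℝ}
    (h : HasDerivAt F F' (σ + τ * Complex.I)) :
    HasDerivAt (fun x : ℝ => (F (σ + x * Complex.I)).im) F'.re τ := by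
  have h1 : HasDerivAt (fun z : ℂ => (σ : ℂ) + z * Complex.I) Complex.I (τ : ℂ) := by
    simpa using ((hasDerivAt_id (τ : ℂ)).mul_const Complex.I).const_add (σ : ℂ)
  have h2 := (HasDerivAt.comp (τ : ℂ) h h1).comp_ofReal
  have h3 := Complex.imCLM.hasFDerivAt.comp_hasDerivAt τ h2
  have e : F'.re = Complex.imCLM (F' * Complex.I) := by simp
  rw [e]
  exact h3

theorem IsLogZeta.hasDerivAt_im {L : ℂ → ℂ} (hL : IsLogZeta L) {σ : ℝ} (hσ : 1 / 2 < σ) (τ : ℝ) :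
    HasDerivAt (fun x : ℝ => (L (σ + x * Complex.I)).im) (deriv L (σ + τ * Complex.I)).re τ :=
  (hL.differentiableAt _ (by simpa using hσ)).hasDerivAt.im_vertical

theorem re_inv_add_one_le {s : ℂ} (hs : 0 ≤ s.re) : ((s + 1)⁻¹).re ≤ 1 := by
  refine (Complex.re_le_norm _).trans ?_
  rw [norm_inv]
  refine inv_le_one_of_one_le₀ ?_
  refine le_trans ?_ ((le_abs_self _).trans (Complex.abs_re_le_norm (s + 1)))
  simpa using hs

theorem IsLogZeta.hasDerivAt_im_logZetaQuot {L : ℂ → ℂ} (hL : IsLogZeta L) {σ : ℝ}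
    (hσ : 1 / 2 < σ) (τ : ℝ) :
    HasDerivAt (fun x : ℝ => (logZetaQuot L (σ + x * Complex.I)).im)
      ((deriv L (σ + τ * Complex.I)).re - ((σ + τ * Complex.I + 1 : ℂ)⁻¹).re) τ := by
  have hs : 1 / 2 < (σ + τ * Complex.I : ℂ).re := by simpa using hσ
  have h1 := (hL.differentiableAt _ hs).hasDerivAt
  have h2 := ((hasDerivAt_id (σ + τ * Complex.I : ℂ)).add_const 1).clog (add_one_mem_slitPlane hs)
  have h3 := (h1.sub h2).im_vertical
  simpa [logZetaQuot] using h3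

/-- The slope constant 2 is 1 from L' plus 1 from the derivative of log(s + 1). The right side does
not involve σ, which permits the later passage to the critical line. -/
theorem IsLogZeta.abs_im_logZetaQuot_le {L : ℂ → ℂ} (hL : IsLogZeta L) {σ l t : ℝ}
    (hσ : 1 / 2 < σ) (hσ1 : σ ≤ 1) (hl : 1 ≤ l) (ht : 500 * Real.exp (8 * l) ≤ t) :
    |(logZetaQuot L (σ + t * Complex.I)).im| * (136 / 100) ≤
      (1 / 2 * Real.log (t + 2) + 1 / 2 + 2) * (612 / 1000 * Real.pi) / l + 7 +
        (64 * Real.pi * Real.exp (2 * l) + 4 * (64 * Real.pi)) := by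
  have hd := fun τ => hL.hasDerivAt_im_logZetaQuot hσ τ
  obtain ⟨C, hC0, hC⟩ := hL.exists_norm_logZetaQuot_le hσ
  have hslope : ∀ τ : ℝ, -slopeBound 2 τ ≤
      (deriv L (σ + τ * Complex.I)).re - ((σ + τ * Complex.I + 1 : ℂ)⁻¹).re := by
    intro τ
    have h1 := hL.re_deriv_ge (s := σ + τ * Complex.I) (by simpa using hσ) (by simpa using hσ1)
    have h2 := re_inv_add_one_le (s := σ + τ * Complex.I) (by simp; linarith)
    have h3 : (σ + τ * Complex.I : ℂ).im = τ := by simp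
    rw [h3] at h1
    unfold slopeBound
    linarith
  refine abs_le_of_smoothing (g := fun τ : ℝ => (logZetaQuot L (σ + τ * Complex.I)).im) (C := C)
    (continuous_iff_continuousAt.2 fun τ => (hd τ).continuousAt) (fun τ => ?_) (by norm_num)
    (by positivity) (fun τ u hu => sub_slopeBound_le hd hslope hu (Or.inl rfl))
    (fun τ u hu => sub_slopeBound_le hd hslope hu (Or.inr rfl)) hl ht fun v => ?_
  · refine (Complex.abs_im_le_norm _).trans ?_
    simpa using hC (σ + τ * Complex.I) (by simp) (by simp; linarith)
  · exact hL.abs_integral_im_logZetaQuot_le hσ hσ1 hl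

/-! ### Passage to arg ζ(1/2 + it). -/

theorem IsLogZeta.zeta_polar {L : ℂ → ℂ} (hL : IsLogZeta L) {s : ℂ} (hs : 1 / 2 < s.re)
    (hs1 : s ≠ 1) : riemannZeta s =
      ‖riemannZeta s‖ * Complex.exp (((L s).im - (s - 1).arg : ℝ) * Complex.I) := by
  have h1 := hL.exp_eq s hs
  rw [riemannZeta₁_eq hs1] at h1
  have h0 : s - 1 ≠ 0 := sub_ne_zero.2 hs1
  have h2 : Complex.exp (L s - Complex.log (s - 1)) = riemannZeta s := by
    rw [Complex.exp_sub, Complex.exp_log h0, h1, mul_div_cancel_left₀ _ h0]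
  have h3 : (L s).im - (s - 1).arg = (L s - Complex.log (s - 1)).im := by simp [Complex.log_im]
  rw [← h2, Complex.norm_exp, h3, Complex.ofReal_exp, ← Complex.exp_add, Complex.re_add_im]

theorem argPath_re_gt {t u : ℝ} (hu : u < 2) : 1 / 2 < (argPath t u).re := by
  unfold argPath
  split_ifs with h
  · simp; norm_num
  · simp; linarith

theorem argPath_sub_one_mem_slitPlane {t : ℝ} (ht : 0 < t) (u : ℝ) :
    argPath t u - 1 ∈ Complex.slitPlane := by
  unfold argPath
  split_ifs with h
  · left; norm_num
  · right; simpa using ht.ne'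

/-- Both sides lift the same path in the circle and vanish at the start. The end u = 2 is excluded
because L is controlled only for Re s > 1/2. -/
theorem IsLogZeta.eq_of_isZetaArgAlong {L : ℂ → ℂ} (hL : IsLogZeta L) {t : ℝ} (ht : 0 < t)
    (hord : ¬ IsZetaOrdinate t) {θ : ℝ → ℝ} (hθ : IsZetaArgAlong t θ) {u : ℝ}
    (hu : u ∈ Set.Ico (0 : ℝ) 2) :
    θ u = (L (argPath t u)).im - (argPath t u - 1).arg := by
  refine Circle.isCoveringMap_exp.eqOn_of_comp_eqOn (s := Set.Ico (0 : ℝ) 2) isPreconnected_Ico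
    (hθ.continuousOn.mono Set.Ico_subset_Icc_self)
    (g₂ := fun u => (L (argPath t u)).im - (argPath t u - 1).arg) ?_ (fun u hu => ?_) (a := 0)
    (by norm_num) ?_ hu
  · intro u hu
    refine (ContinuousAt.sub ?_ ?_).continuousWithinAt
    · exact Complex.continuous_im.continuousAt.comp
        ((hL.differentiableAt _ (argPath_re_gt hu.2)).continuousAt.comp
          (continuous_argPath t).continuousAt)
    · exact (Complex.continuousAt_arg (argPath_sub_one_mem_slitPlane ht u)).comp
        (f := fun u => argPath t u - 1)
        ((continuous_argPath t).sub continuous_const).continuousAt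
  · have hz := zeta_argPath_ne_zero hord hu.2.le
    apply Circle.ext
    exact ((circle_exp_eq_iff hz _).1 (hθ.polar u ⟨hu.1, hu.2.le⟩)).trans
      ((circle_exp_eq_iff hz _).1 (hL.zeta_polar (argPath_re_gt hu.2) (argPath_ne_one ht u))).symm
  · have h1 : (2 - 1 : ℂ) = 1 := by norm_num
    simp only [argPath_zero, hL.im_two, hθ.zero, h1, Complex.arg_one, sub_zero]

theorem IsLogZeta.tendsto_zetaArg {L : ℂ → ℂ} (hL : IsLogZeta L) {t : ℝ} (ht : 0 < t)
    (hord : ¬ IsZetaOrdinate t) :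
    Tendsto (fun σ : ℝ => (L (σ + t * Complex.I)).im - (σ + t * Complex.I - 1 : ℂ).arg)
      (𝓝[>] (1 / 2)) (𝓝 (zetaArg t)) := by
  obtain ⟨θ, hθ⟩ := exists_isZetaArgAlong ht hord
  rw [zetaArg_eq hord hθ]
  have h1 : Tendsto (fun σ : ℝ => 1 + (2 - σ) * (2 / 3)) (𝓝[>] (1 / 2)) (𝓝[Set.Icc 0 2] 2) := by
    refine tendsto_nhdsWithin_iff.2 ⟨?_, ?_⟩
    · have : Continuous fun σ : ℝ => 1 + (2 - σ) * (2 / 3) := by fun_prop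
      exact (this.tendsto' (1 / 2) 2 (by norm_num)).mono_left nhdsWithin_le_nhds
    · filter_upwards [Ioo_mem_nhdsGT (show (1 / 2 : ℝ) < 2 by norm_num)] with σ hσ
      exact ⟨by linarith [hσ.2], by linarith [hσ.1]⟩
  refine ((hθ.continuousOn 2 (by norm_num)).tendsto.comp h1).congr' ?_
  filter_upwards [Ioo_mem_nhdsGT (show (1 / 2 : ℝ) < 2 by norm_num)] with σ hσ
  have h2 : argPath t (1 + (2 - σ) * (2 / 3)) = σ + t * Complex.I := by
    rw [argPath, if_neg (by linarith [hσ.2])]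
    congr 2; ring
  rw [Function.comp_apply, hL.eq_of_isZetaArgAlong ht hord hθ
    ⟨by linarith [hσ.2], by linarith [hσ.1]⟩, h2]

theorem IsLogZeta.abs_zetaArg_le {L : ℂ → ℂ} (hL : IsLogZeta L) {l t : ℝ}
    (hord : ¬ IsZetaOrdinate t) (hl : 1 ≤ l) (ht : 500 * Real.exp (8 * l) ≤ t) :
    |zetaArg t| * (136 / 100) ≤
      (1 / 2 * Real.log (t + 2) + 1 / 2 + 2) * (612 / 1000 * Real.pi) / l + 7 +
        (64 * Real.pi * Real.exp (2 * l) + 4 * (64 * Real.pi)) + 2 * Real.pi * (136 / 100) := by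
  have ht0 : 0 < t := lt_of_lt_of_le (by positivity) ht
  refine le_of_tendsto (((hL.tendsto_zetaArg ht0 hord).abs).mul_const _) ?_
  filter_upwards [Ioo_mem_nhdsGT (show (1 / 2 : ℝ) < 1 by norm_num)] with σ hσ
  have h1 := hL.abs_im_logZetaQuot_le hσ.1 hσ.2.le hl ht
  set s : ℂ := σ + t * Complex.I
  have h2 : (L s).im - (s - 1).arg =
      (logZetaQuot L s).im + (s + 1).arg - (s - 1).arg := by
    simp [logZetaQuot, Complex.log_im]
  -- The principal arguments of s + 1 and s - 1 cost at most π each.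
  have h3 : |(L s).im - (s - 1).arg| ≤ |(logZetaQuot L s).im| + Real.pi + Real.pi := by
    rw [h2]
    refine (abs_sub _ _).trans (add_le_add ((abs_add_le _ _).trans ?_) (Complex.abs_arg_le_pi _))
    exact add_le_add le_rfl (Complex.abs_arg_le_pi _)
  linarith

/-! ### Choice of the parameter l. -/

theorem IsLogZeta.abs_zetaArg_le_of_loglog {L : ℂ → ℂ} (hL : IsLogZeta L) {t : ℝ}
    (hord : ¬ IsZetaOrdinate t) (ht : Real.exp (Real.exp (10 ^ 7)) ≤ t) :
    1 / Real.pi * |zetaArg t| ≤ 1 / 2 * (Real.log t / Real.log (Real.log t)) := by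
  have ht0 : 0 < t := (Real.exp_pos _).trans_le ht
  set X := Real.log t
  have hX : Real.exp (10 ^ 7) ≤ X := (Real.le_log_iff_exp_le ht0).2 ht
  have hX0 : 0 < X := (Real.exp_pos _).trans_le hX
  set Y := Real.log X
  have hY : 10 ^ 7 ≤ Y := (Real.le_log_iff_exp_le hX0).2 hX
  have hY0 : 0 < Y := lt_of_lt_of_le (by norm_num) hY
  have eX : X = Real.exp Y := (Real.exp_log hX0).symm
  have et : t = Real.exp X := (Real.exp_log ht0).symm
  have hXq : Y ^ 2 / 2 ≤ X := by
    have := Real.quadratic_le_exp_of_nonneg hY0.le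
    rw [eX]; linarith
  -- Here l = 0.475 Y. The factor must be below 1/2, so that e^{2l} = X^{0.95} is of smaller order
  -- than X/Y, and above 0.45, so that 0.306/(1.36 · 0.475) stays below 1/2.
  have hl8 : 500 * Real.exp (8 * (475 / 1000 * Y)) ≤ t := by
    have h500 : (500 : ℝ) ≤ Real.exp 7 := by
      have h := Real.exp_one_gt_d9
      have : Real.exp 7 = Real.exp 1 ^ 7 := by rw [← Real.exp_nat_mul]; norm_num
      rw [this]
      calc (500 : ℝ) ≤ (2.7 : ℝ) ^ 7 := by norm_num
        _ ≤ _ := pow_le_pow_left₀ (by norm_num) (by linarith) 7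
    calc _ ≤ Real.exp 7 * Real.exp (8 * (475 / 1000 * Y)) := by gcongr
      _ = Real.exp (7 + 8 * (475 / 1000 * Y)) := (Real.exp_add _ _).symm
      _ ≤ Real.exp X := Real.exp_le_exp.2 (by nlinarith)
      _ = t := et.symm
  have h := hL.abs_zetaArg_le hord (by linarith : 1 ≤ 475 / 1000 * Y) hl8
  have hlog : Real.log (t + 2) ≤ X + 1 := by
    have h2 : 2 ≤ t := le_trans (by
      have := Real.add_one_le_exp (Real.exp (10 ^ 7))
      have := Real.add_one_le_exp ((10 : ℝ) ^ 7)
      linarith) ht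
    rw [Real.log_le_iff_le_exp (by linarith), Real.exp_add, ← et]
    nlinarith [Real.exp_one_gt_d9]
  set Z := Real.exp (2 * (475 / 1000 * Y))
  have hZ1 : 1 ≤ Z := Real.one_le_exp (by positivity)
  -- As X = e^{Y/20} Z, it is enough that (Y/20)^2/2 ≥ 12200 Y, that is Y ≥ 9.76 · 10^6. This
  -- explains the threshold 10^7.
  have hZ : 12200 * Y * Z ≤ X := by
    have h1 : 12200 * Y ≤ Real.exp (5 / 100 * Y) := by
      have := Real.quadratic_le_exp_of_nonneg (by positivity : 0 ≤ 5 / 100 * Y)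
      nlinarith
    calc _ ≤ Real.exp (5 / 100 * Y) * Z := by gcongr
      _ = X := by rw [eX, ← Real.exp_add]; congr 1; ring
  have hpi := Real.pi_gt_three
  have hA : |zetaArg t| * (136 / 100) ≤ Real.pi *
      ((1 / 2 * X + 3) * (612 / 475) / Y + 3 + 64 * Z + 256 + 3) := by
    have e1 : (1 / 2 * Real.log (t + 2) + 1 / 2 + 2) * (612 / 1000 * Real.pi) / (475 / 1000 * Y) ≤
        Real.pi * ((1 / 2 * X + 3) * (612 / 475) / Y) := by
      rw [show Real.pi * ((1 / 2 * X + 3) * (612 / 475) / Y) =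
        (1 / 2 * X + 3) * (612 / 1000 * Real.pi) / (475 / 1000 * Y) by field_simp]
      refine div_le_div_of_nonneg_right ?_ (by positivity)
      exact mul_le_mul_of_nonneg_right (by linarith) (by positivity)
    nlinarith
  -- The target 0.68 is half of 1.36. The main term takes 306/475 < 0.645, and since Z ≥ 1 the terms
  -- without Y are at most 326 Z, less than 0.027 X/Y.
  have hB : (1 / 2 * X + 3) * (612 / 475) / Y + 3 + 64 * Z + 256 + 3 ≤ 68 / 100 * (X / Y) := by
    have h1 : 12200 * Z ≤ X / Y := by rw [le_div_iff₀ hY0]; linarith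
    have h2 : 1 / Y ≤ 1 / 10 ^ 7 := one_div_le_one_div_of_le (by norm_num) hY
    have e : (1 / 2 * X + 3) * (612 / 475) / Y = 306 / 475 * (X / Y) + 1836 / 475 * (1 / Y) := by
      ring
    rw [e]
    linarith
  rw [one_div, inv_mul_le_iff₀ Real.pi_pos]
  have := mul_le_mul_of_nonneg_left hB Real.pi_pos.le
  linarith

/-! ### Isolated ordinates and one-sided limits of arg ζ. -/

theorem riemannZeta₁_eq_zero_of_isZetaOrdinate (hRH : RiemannHypothesis) {t : ℝ}
    (ht : IsZetaOrdinate t) : riemannZeta₁ (1 / 2 + t * Complex.I) = 0 := by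
  obtain ⟨ρ, h0, h1, h2, h3⟩ := ht
  have hρ1 : ρ ≠ 1 := by rintro rfl; simp at h2
  have hre : ρ.re = 1 / 2 := by
    refine hRH ρ h0 ?_ hρ1
    rintro ⟨n, rfl⟩
    have : (-2 * ((n : ℂ) + 1)).re = -2 * ((n : ℝ) + 1) := by simp
    rw [this] at h1
    linarith [n.cast_nonneg (α := ℝ)]
  have e : (1 / 2 + t * Complex.I : ℂ) = ρ := by
    apply Complex.ext
    · simp [hre]
    · simp [h3]
  rw [e, riemannZeta₁_eq hρ1, h0, mul_zero]

theorem eventually_not_isZetaOrdinate (hRH : RiemannHypothesis) (t₀ : ℝ) :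
    ∀ᶠ t in 𝓝[≠] t₀, ¬ IsZetaOrdinate t := by
  set f : ℂ → ℂ := fun z => riemannZeta₁ (1 / 2 + z * Complex.I) with hf
  have hd : Differentiable ℂ f := differentiable_riemannZeta₁.comp (by fun_prop)
  have ha : AnalyticOnNhd ℂ f Set.univ := fun z _ => hd.analyticAt z
  have hne : ∀ᶠ z in 𝓝[≠] (t₀ : ℂ), f z ≠ 0 := by
    refine (hd.analyticAt (t₀ : ℂ)).eventually_eq_zero_or_eventually_ne_zero.resolve_left fun h => ?_
    have h0 := AnalyticOnNhd.eq_of_eventuallyEq (g := fun _ => (0 : ℂ)) ha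
      (fun _ _ => analyticAt_const) h
    refine riemannZeta₁_ne_zero hRH (s := 3 / 2) (by norm_num) ?_
    -- The point z = -i corresponds to s = 3/2, where (s - 1)ζ(s) does not vanish.
    have h1 := congrFun h0 (-Complex.I)
    rw [hf] at h1
    rw [← h1]
    congr 1
    linear_combination Complex.I_sq
  have ht : Tendsto (fun t : ℝ => (t : ℂ)) (𝓝[≠] t₀) (𝓝[≠] (t₀ : ℂ)) := by
    refine tendsto_nhdsWithin_iff.2
      ⟨Complex.continuous_ofReal.continuousAt.mono_left nhdsWithin_le_nhds, ?_⟩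
    filter_upwards [self_mem_nhdsWithin] with t h
    simpa using h
  filter_upwards [ht.eventually hne] with t h1 h2
  exact h1 (riemannZeta₁_eq_zero_of_isZetaOrdinate hRH h2)

/-- A determination of `arg ((s - 1) ζ(s))` at `s = 1/2 + i t`, made increasing by a linear term. -/
noncomputable def zetaArgShift (b t : ℝ) : ℝ :=
  zetaArg t + ((1 / 2 : ℝ) + t * Complex.I - 1 : ℂ).arg + b * t

theorem sub_one_mem_slitPlane_of_im {s : ℂ} (hs : s.im ≠ 0) : s - 1 ∈ Complex.slitPlane :=
  Or.inr (by simpa using hs)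

theorem IsLogZeta.tendsto_zetaArgShift {L : ℂ → ℂ} (hL : IsLogZeta L) {t : ℝ} (ht : 0 < t)
    (hord : ¬ IsZetaOrdinate t) (b : ℝ) :
    Tendsto (fun σ : ℝ => (L (σ + t * Complex.I)).im + b * t)
      (𝓝[>] (1 / 2)) (𝓝 (zetaArgShift b t)) := by
  have h1 : ContinuousAt (fun σ : ℝ => (σ + t * Complex.I - 1 : ℂ).arg) (1 / 2) :=
    (Complex.continuousAt_arg (sub_one_mem_slitPlane_of_im (by simpa using ht.ne'))).comp
      (f := fun σ : ℝ => (σ + t * Complex.I - 1 : ℂ)) (by fun_prop)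
  have h2 := (((hL.tendsto_zetaArg ht hord).add
    (h1.tendsto.mono_left nhdsWithin_le_nhds)).add_const (b * t))
  rw [zetaArgShift]
  simpa only [sub_add_cancel] using h2

/-- On each line Re s = σ with 1/2 < σ < 1 the slope bound and the mean value theorem give the
inequality for Im L + bτ; then σ → 1/2. The argument of s - 1 is added back because the slope bound
concerns L rather than log ζ. -/
theorem IsLogZeta.zetaArgShift_le {L : ℂ → ℂ} (hL : IsLogZeta L) {b a t : ℝ} (ha : 0 < a)
    (hat : a ≤ t) (hb : slopeBound 1 t ≤ b) (ha' : ¬ IsZetaOrdinate a) (ht' : ¬ IsZetaOrdinate t) :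
    zetaArgShift b a ≤ zetaArgShift b t := by
  refine le_of_tendsto_of_tendsto (hL.tendsto_zetaArgShift ha ha' b)
    (hL.tendsto_zetaArgShift (ha.trans_le hat) ht' b) ?_
  filter_upwards [Ioo_mem_nhdsGT (show (1 / 2 : ℝ) < 1 by norm_num)] with σ hσ
  obtain ⟨ξ, h1, h2, h3⟩ := exists_sub_eq_mul (fun τ => hL.hasDerivAt_im hσ.1 τ) a
    (sub_nonneg.2 hat)
  rw [add_sub_cancel] at h2 h3
  have h4 := hL.re_deriv_ge (s := σ + ξ * Complex.I) (by simpa using hσ.1) (by simpa using hσ.2.le)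
  have h5 : (σ + ξ * Complex.I : ℂ).im = ξ := by simp
  rw [h5] at h4
  have h6 : Real.log (|ξ| + 2) ≤ Real.log (|t| + 2) := by
    refine Real.log_le_log (by positivity) ?_
    rw [abs_of_pos (by linarith), abs_of_pos (by linarith)]; linarith
  have h7 : -b ≤ (deriv L (σ + ξ * Complex.I)).re := by
    unfold slopeBound at hb; linarith
  have h8 := mul_le_mul_of_nonneg_left h7 (sub_nonneg.2 hat)
  linarith

/-- In a punctured neighbourhood free of ordinates the shifted argument is increasing. A value on
the far side of t bounds it, so both one-sided limits exist, and the shift itself is continuous at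
t. -/
theorem IsLogZeta.exists_tendsto_zetaArg {L : ℂ → ℂ} (hL : IsLogZeta L) (hRH : RiemannHypothesis)
    {t : ℝ} (ht : 0 < t) :
    (∃ a, Tendsto zetaArg (𝓝[>] t) (𝓝 a)) ∧ ∃ a, Tendsto zetaArg (𝓝[<] t) (𝓝 a) := by
  obtain ⟨δ, hδ, hball⟩ := Metric.mem_nhdsWithin_iff.1 (eventually_not_isZetaOrdinate hRH t)
  set η := min δ t
  have hη : 0 < η := lt_min hδ ht
  have hηt : η ≤ t := min_le_right _ _
  have hno : ∀ x, t - η < x → x < t + η → x ≠ t → ¬ IsZetaOrdinate x := by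
    intro x h1 h2 h3
    refine hball ⟨?_, h3⟩
    rw [Metric.mem_ball, Real.dist_eq, abs_lt]
    constructor <;> linarith [min_le_left δ t]
  set b := slopeBound 1 (t + η)
  have hmono : ∀ x y, t - η < x → x ≤ y → y < t + η → x ≠ t → y ≠ t →
      zetaArgShift b x ≤ zetaArgShift b y := by
    intro x y h1 h2 h3 h4 h5
    refine hL.zetaArgShift_le (by linarith) h2 ?_ (hno x h1 (by linarith) h4)
      (hno y (by linarith) h3 h5)
    have : Real.log (|y| + 2) ≤ Real.log (|t + η| + 2) := by
      refine Real.log_le_log (by positivity) ?_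
      rw [abs_of_pos (by linarith), abs_of_pos (by linarith)]; linarith
    simp only [b, slopeBound]; linarith
  have hright := MonotoneOn.tendsto_nhdsWithin_Ioo_right (f := zetaArgShift b)
    (Set.nonempty_Ioo.2 (by linarith : t < t + η))
    (fun x hx y hy hxy => hmono x y (by linarith [hx.1]) hxy hy.2 hx.1.ne' hy.1.ne')
    ⟨zetaArgShift b (t - η / 2), by
      rintro _ ⟨x, hx, rfl⟩
      exact hmono _ _ (by linarith) (by linarith [hx.1]) hx.2 (by linarith) hx.1.ne'⟩
  have hleft := MonotoneOn.tendsto_nhdsWithin_Ioo_left (f := zetaArgShift b)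
    (Set.nonempty_Ioo.2 (by linarith : t - η < t))
    (fun x hx y hy hxy => hmono x y hx.1 hxy (by linarith [hy.2]) hx.2.ne hy.2.ne)
    ⟨zetaArgShift b (t + η / 2), by
      rintro _ ⟨x, hx, rfl⟩
      exact hmono _ _ hx.1 (by linarith [hx.2]) (by linarith) hx.2.ne (by linarith)⟩
  have hc : ContinuousAt (fun x : ℝ => ((1 / 2 : ℝ) + x * Complex.I - 1 : ℂ).arg + b * x) t := by
    refine ContinuousAt.add ?_ (by fun_prop)
    exact (Complex.continuousAt_arg (sub_one_mem_slitPlane_of_im (by simpa using ht.ne'))).comp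
      (f := fun x : ℝ => ((1 / 2 : ℝ) + x * Complex.I - 1 : ℂ)) (by fun_prop)
  have he : ∀ x, zetaArg x =
      zetaArgShift b x - (((1 / 2 : ℝ) + x * Complex.I - 1 : ℂ).arg + b * x) := by
    intro x; rw [zetaArgShift]; ring
  exact ⟨⟨_, (hright.sub (hc.tendsto.mono_left nhdsWithin_le_nhds)).congr fun x => (he x).symm⟩,
    _, (hleft.sub (hc.tendsto.mono_left nhdsWithin_le_nhds)).congr fun x => (he x).symm⟩

/-! ### The function S at all t > 0. -/

theorem zetaS_of_not_isZetaOrdinate {t : ℝ} (ht : ¬ IsZetaOrdinate t) :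
    zetaS t = 1 / Real.pi * zetaArg t := if_neg ht

theorem tendsto_const_add_nhdsGT (t : ℝ) : Tendsto (fun ε : ℝ => t + ε) (𝓝[>] 0) (𝓝[>] t) := by
  refine tendsto_nhdsWithin_iff.2 ⟨?_, ?_⟩
  · have : Continuous fun ε : ℝ => t + ε := by fun_prop
    exact (this.tendsto' 0 t (by simp)).mono_left nhdsWithin_le_nhds
  · filter_upwards [self_mem_nhdsWithin] with ε hε
    simpa using hε

theorem tendsto_const_sub_nhdsGT (t : ℝ) : Tendsto (fun ε : ℝ => t - ε) (𝓝[>] 0) (𝓝[<] t) := by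
  refine tendsto_nhdsWithin_iff.2 ⟨?_, ?_⟩
  · have : Continuous fun ε : ℝ => t - ε := by fun_prop
    exact (this.tendsto' 0 t (by simp)).mono_left nhdsWithin_le_nhds
  · filter_upwards [self_mem_nhdsWithin] with ε hε
    simpa using hε

theorem eventually_not_isZetaOrdinate_add_sub (hRH : RiemannHypothesis) (t : ℝ) :
    ∀ᶠ ε in 𝓝[>] (0 : ℝ), ¬ IsZetaOrdinate (t + ε) ∧ ¬ IsZetaOrdinate (t - ε) := by
  have h := eventually_not_isZetaOrdinate hRH t
  exact ((tendsto_const_add_nhdsGT t).eventually (h.filter_mono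
      (nhdsWithin_mono t fun x hx => ne_of_gt hx))).and
    ((tendsto_const_sub_nhdsGT t).eventually (h.filter_mono
      (nhdsWithin_mono t fun x hx => ne_of_lt hx)))

theorem tendsto_zetaS (hRH : RiemannHypothesis) {t : ℝ} (ht : 0 < t) (hord : IsZetaOrdinate t) :
    Tendsto (fun ε : ℝ => 1 / 2 * (zetaS (t + ε) + zetaS (t - ε))) (𝓝[>] 0) (𝓝 (zetaS t)) := by
  obtain ⟨L, hL⟩ := exists_isLogZeta hRH
  obtain ⟨⟨a, ha⟩, ⟨b, hb⟩⟩ := hL.exists_tendsto_zetaArg hRH ht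
  have h := ((ha.comp (tendsto_const_add_nhdsGT t)).const_mul (1 / Real.pi)).add
    ((hb.comp (tendsto_const_sub_nhdsGT t)).const_mul (1 / Real.pi))
  rw [zetaS, if_pos hord]
  simp only [Function.comp_apply] at h
  rw [h.limUnder_eq]
  refine (h.const_mul (1 / 2)).congr' ?_
  filter_upwards [eventually_not_isZetaOrdinate_add_sub hRH t] with ε hε
  rw [zetaS_of_not_isZetaOrdinate hε.1, zetaS_of_not_isZetaOrdinate hε.2]

/-- At an ordinate S is the limit of averages of values at nearby non-ordinates, and the bound is
continuous in t. The strict inequality on t keeps t - ε in the admissible range. -/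
theorem abs_zetaS_le (hRH : RiemannHypothesis) {t : ℝ} (ht : Real.exp (Real.exp (10 ^ 7)) < t) :
    |zetaS t| ≤ 1 / 2 * (Real.log t / Real.log (Real.log t)) := by
  obtain ⟨L, hL⟩ := exists_isLogZeta hRH
  have hle : ∀ x, Real.exp (Real.exp (10 ^ 7)) ≤ x → ¬ IsZetaOrdinate x →
      |zetaS x| ≤ 1 / 2 * (Real.log x / Real.log (Real.log x)) := by
    intro x hx hord
    rw [zetaS_of_not_isZetaOrdinate hord, abs_mul, abs_of_pos (by positivity)]
    exact hL.abs_zetaArg_le_of_loglog hord hx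
  by_cases hord : IsZetaOrdinate t
  · have ht0 : 0 < t := (Real.exp_pos _).trans ht
    have hX : Real.exp (10 ^ 7) < Real.log t := (Real.lt_log_iff_exp_lt ht0).2 ht
    have hX0 : 0 < Real.log t := (Real.exp_pos _).trans hX
    have hY : (10 : ℝ) ^ 7 < Real.log (Real.log t) := (Real.lt_log_iff_exp_lt hX0).2 hX
    have hY0 : Real.log (Real.log t) ≠ 0 := by
      have : (0 : ℝ) < 10 ^ 7 := by norm_num
      linarith
    have hF : ContinuousAt (fun x : ℝ => 1 / 2 * (Real.log x / Real.log (Real.log x))) t :=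
      continuousAt_const.mul ((Real.continuousAt_log ht0.ne').div
        ((Real.continuousAt_log ht0.ne').log hX0.ne') hY0)
    have hadd := tendsto_const_add_nhdsGT t
    have hsub := tendsto_const_sub_nhdsGT t
    have hFa := (hF.tendsto.mono_left nhdsWithin_le_nhds).comp hadd
    have hFs := (hF.tendsto.mono_left nhdsWithin_le_nhds).comp hsub
    have hlim := (hFa.add hFs).const_mul (1 / 2)
    rw [show 1 / 2 * (Real.log t / Real.log (Real.log t)) = 1 / 2 *
      (1 / 2 * (Real.log t / Real.log (Real.log t)) +
        1 / 2 * (Real.log t / Real.log (Real.log t))) by ring]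
    refine le_of_tendsto_of_tendsto (tendsto_zetaS hRH ht0 hord).abs hlim ?_
    filter_upwards [eventually_not_isZetaOrdinate_add_sub hRH t,
      hadd.eventually (mem_nhdsWithin_of_mem_nhds (Ioi_mem_nhds ht)),
      hsub.eventually (mem_nhdsWithin_of_mem_nhds (Ioi_mem_nhds ht))] with ε h1 h2 h3
    have h4 := hle _ (le_of_lt h2) h1.1
    have h5 := hle _ (le_of_lt h3) h1.2
    have h6 := abs_add_le (zetaS (t + ε)) (zetaS (t - ε))
    rw [abs_mul, abs_of_pos (by norm_num : (0 : ℝ) < 1 / 2)]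
    simp only [Function.comp_apply]
    linarith
  · exact hle t ht.le hord

/-- Assume RH. Then `S` is well defined (the limit that defines it at an ordinate exists), and
`|S(t)| ≤ (1/2 + o(1)) log t / log log t` for all sufficiently large `t`. -/
theorem theorem2 (hRH : RiemannHypothesis) :
    (∀ t : ℝ, 0 < t → IsZetaOrdinate t →
      Tendsto (fun ε : ℝ => 1 / 2 * (zetaS (t + ε) + zetaS (t - ε))) (𝓝[>] 0) (𝓝 (zetaS t))) ∧
    ∃ o : ℝ → ℝ, Tendsto o atTop (𝓝 0) ∧
      ∀ᶠ t : ℝ in atTop,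
        |zetaS t| ≤ (1 / 2 + o t) * (Real.log t / Real.log (Real.log t)) := by
  -- The constant obtained is strictly below 1/2 before errors are absorbed, so o = 0 is a valid
  -- choice.
  refine ⟨fun t ht hord => tendsto_zetaS hRH ht hord, fun _ => 0, tendsto_const_nhds, ?_⟩
  filter_upwards [eventually_gt_atTop (Real.exp (Real.exp (10 ^ 7)))] with t ht
  simpa using abs_zetaS_le hRH ht
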